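/- Let $\Omega=(-\pi,\pi)\subset\mathbb R$, $0<\alpha<2$, and let $H_0^{\alpha/2}(\Omega)$ be the space of all $u\in L^2(\Omega)$ whose extension by zero to $\mathbb R$ (again denoted $u$) satisfies $$\|u\|_{H_0^{\alpha/2}}^2:=\|u\|_{L^2(\Omega)}^2+\int_{\mathbb R}\int_{\mathbb R}\frac{|u(x)-u(y)|^2}{|x-y|^{1+\alpha}}\,dy\,dx<\infty .$$ For $\varphi\in C_c^\infty(\mathbb R)$ let $$(-\Delta)^{\alpha/2}\varphi(x)=\frac{\alpha}{2^{1-\alpha}\pi^{1/2}}\,\frac{\Gamma(\frac{1+\alpha}{2})}{\Gamma(1-\frac{\alpha}{2})}\;\lim_{\epsilon\downarrow0}\int_{|x-y|\ge\epsilon}\frac{\varphi(x)-\varphi(y)}{|x-y|^{1+\alpha}}\,dy .$$ Let $A_\alpha=-(-\Delta)^{\alpha/2}$ be the operator in $L^2(\Omega)$ whose domain consists of all $u\in H_0^{\alpha/2}(\Omega)$ for which there is $h\in L^2(\Omega)$ with $\int_\Omega u\,(-\Delta)^{\alpha/2}\varphi\,dx=\int_\Omega h\varphi\,dx$ for all $\varphi\in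 C_c^\infty(\Omega)$, and then $A_\alpha u=-h$. Let $g\in L^2(\Omega)$, and let $f:\mathbb R\to\mathbb R$ satisfy: * the map $u\mapsto f(u)$ takes $H_0^{\alpha/2}(\Omega)$ into $L^2(\Omega)$ and is Lipschitz continuous from each bounded subset of $H_0^{\alpha/2}(\Omega)$ to $L^2(\Omega)$; * there are $p\ge2$ and constants $c_1,c_2,c_3,c_4>0$ with $c_1|s|^p-c_2\le f(s)s\le c_3|s|^p+c_4$ for all $s\in\mathbb R$. Consider the problem $$u_t+(-\Delta)^{\alpha/2}u+f(u)=g\ \text{ in }\Omega,\qquad u=0\ \text{ in }\mathbb R\setminus\Omega,\qquad u(0)=u_0 .$$ For $I=[0,T]$ or $I=[0,\infty)$, a solution on $I$ is a function $u\in C^0(I,H_0^{\alpha/2}(\Omega))$ such that $$u(t)=e^{tA_\alpha}u_0-\int_0^te^{(t-s)A_\alpha}\bigl(f(u(s))-g\bigr)\,ds\qquad(t\in I),$$ where $e^{tA_\alpha}$ is the strongly continuous semigroup on $L^2(\Omega)$ generated by $A_\alpha$. (That $A_\alpha$ generates such a semigroup is part of the claim.) Then: 1. For every $u_0\in H_0^{\alpha/2}(\Omega)$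 there is a solution $u\in C^0([0,\infty),H_0^{\alpha/2}(\Omega))$, and for every $T>0$ each solution on $[0,T]$ with the same initial value coincides with $u$ on $[0,T]$. 2. For every $M\ge0$ there is $K\ge0$ such that every solution on $[0,\infty)$ with $\|u_0\|_{H_0^{\alpha/2}}\le M$ satisfies $\sup_{t\ge0}\|u(t)\|_{H_0^{\alpha/2}}\le K$ (hence also $\sup_{t\ge0}\|u(t)\|_{L^2(\Omega)}\le K$). 3. There is $R\ge0$ such that for every $M\ge0$ there is $t_0\ge0$ such that every solution on $[0,\infty)$ with $\|u_0\|_{H_0^{\alpha/2}}\le M$ satisfies $\|u(t)\|_{H_0^{\alpha/2}}\le R$ for all $t\ge t_0$; that is, there is a bounded absorbing set. -/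

import Mathlib

open Set Filter Topology MeasureTheory
open scoped NNReal ENNReal ContDiff

noncomputable section

/-- The spatial domain `Ω = (-π, π)`. -/
def Omega : Set ℝ := Ioo (-Real.pi) Real.pi

/-- The real Hilbert space `L²(Ω)`. -/
abbrev L2Omega : Type := Lp ℝ 2 (volume.restrict Omega)

/-- The extension of `u ∈ L²(Ω)` to the whole line by `0` outside `Ω`. -/
def zeroExt (u : L2Omega) : ℝ → ℝ := Omega.indicator u

/-- The squared Gagliardo seminorm of order `α / 2` over the whole line of the zero extension
of `u`, namely `∬ |u x - u y|² / |x - y|^(1 + α) dy dx`, with values in `[0, ∞]`. -/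
def gagliardoSq (α : ℝ) (u : L2Omega) : ℝ≥0∞ :=
  ∫⁻ x : ℝ, ∫⁻ y : ℝ, ENNReal.ofReal ((zeroExt u x - zeroExt u y) ^ 2 / |x - y| ^ (1 + α))

/-- The norm of `H₀^{α/2}(Ω)`, extended by `∞` to all of `L²(Ω)`. -/
def eH0Norm (α : ℝ) (u : L2Omega) : ℝ≥0∞ :=
  (‖u‖ₑ ^ 2 + gagliardoSq α u) ^ (1 / 2 : ℝ)

/-- Membership in `H₀^{α/2}(Ω)`: the functions on `Ω` whose extension by `0` lies in
`H^{α/2}(ℝ)`. -/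
def MemH0 (α : ℝ) (u : L2Omega) : Prop := eH0Norm α u < ⊤

/-- The constant `C(n, α)` of the fractional Laplacian, in dimension `n = 1`. -/
def fracLapConst (α : ℝ) : ℝ :=
  α / (2 ^ (1 - α) * Real.pi ^ (1 / 2 : ℝ)) * (Real.Gamma ((1 + α) / 2) / Real.Gamma (1 - α / 2))

/-- The fractional Laplacian `(-Δ)^{α/2} φ` on the line, as a principal value integral.
It is used only for smooth compactly supported `φ`, for which the limit exists. -/
def fracLap (α : ℝ) (φ : ℝ → ℝ) (x : ℝ) : ℝ :=
  fracLapConst α *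
    limUnder (𝓝[>] (0 : ℝ)) fun ε : ℝ =>
      ∫ y in (Metric.ball x ε)ᶜ, (φ x - φ y) / |x - y| ^ (1 + α)

/-- Test functions: smooth with compact support inside `Ω`. -/
def IsTestFunction (φ : ℝ → ℝ) : Prop :=
  ContDiff ℝ ∞ φ ∧ HasCompactSupport φ ∧ tsupport φ ⊆ Omega

/-- The graph of the fractional Laplacian in `L²(Ω)` with the exterior condition `u = 0` on
`ℝ \ Ω`: `u` belongs to the domain and `(-Δ)^{α/2} u = h` when `u ∈ H₀^{α/2}(Ω)` and
`h ∈ L²(Ω)` is the fractional Laplacian of `u` on `Ω` in the sense of distributions. -/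
def HasFracLap (α : ℝ) (u h : L2Omega) : Prop :=
  MemH0 α u ∧ ∀ φ : ℝ → ℝ, IsTestFunction φ →
    ∫ x in Omega, u x * fracLap α φ x = ∫ x in Omega, h x * φ x

/-- `S` is, on `t ≥ 0`, the strongly continuous semigroup `exp (t A_α)` on `L²(Ω)` whose
infinitesimal generator (with its full domain) is `A_α = -(-Δ)^{α/2}`. -/
structure IsFracHeatSemigroup (α : ℝ) (S : ℝ → L2Omega →L[ℝ] L2Omega) : Prop where
  zero : S 0 = ContinuousLinearMap.id ℝ L2Omega
  add : ∀ s t : ℝ, 0 ≤ s → 0 ≤ t → S (s + t) = (S s).comp (S t)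
  continuousOn : ∀ w : L2Omega, ContinuousOn (fun t : ℝ => S t w) (Ici 0)
  generator : ∀ w h : L2Omega,
    Tendsto (fun t : ℝ => t⁻¹ • (S t w - w)) (𝓝[>] 0) (𝓝 h) ↔ HasFracLap α w (-h)

open Classical in
/-- The superposition operator `u ↦ f(u)` into `L²(Ω)` (with value `0` where `f(u)` is not
square integrable). -/
def superpose (f : ℝ → ℝ) (u : L2Omega) : L2Omega :=
  if h : MemLp (fun x => f (u x)) 2 (volume.restrict Omega) then h.toLp _ else 0

/-- `u ↦ f(u)` maps `H₀^{α/2}(Ω)` into `L²(Ω)` and is Lipschitz continuous on bounded sets. -/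
def LipschitzOnBoundedSets (α : ℝ) (f : ℝ → ℝ) : Prop :=
  (∀ u : L2Omega, MemH0 α u → MemLp (fun x => f (u x)) 2 (volume.restrict Omega)) ∧
  ∀ R : ℝ≥0, ∃ L : ℝ≥0, ∀ u v : L2Omega, eH0Norm α u ≤ R → eH0Norm α v ≤ R →
    ‖superpose f u - superpose f v‖ₑ ≤ L * eH0Norm α (u - v)

/-- The growth and dissipativity condition on the nonlinearity. -/
def GrowthCondition (f : ℝ → ℝ) : Prop :=
  ∃ p : ℝ, 2 ≤ p ∧ ∃ c₁ c₂ c₃ c₄ : ℝ, 0 < c₁ ∧ 0 < c₂ ∧ 0 < c₃ ∧ 0 < c₄ ∧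
    ∀ s : ℝ, c₁ * |s| ^ p - c₂ ≤ f s * s ∧ f s * s ≤ c₃ * |s| ^ p + c₄

/-- `u` is a solution in `C⁰(I, H₀^{α/2}(Ω))` of `u_t + (-Δ)^{α/2} u + f(u) = g` in `Ω`,
`u = 0` outside `Ω`, `u(0) = u₀`, in the sense of the variation of constants formula.
The interval `I` is `[0, T]` or `[0, ∞)`. -/
structure IsSolutionOn (α : ℝ) (f : ℝ → ℝ) (g u₀ : L2Omega) (I : Set ℝ) (u : ℝ → L2Omega) :
    Prop where
  mem : ∀ t ∈ I, MemH0 α (u t)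
  continuousOn : ∀ t ∈ I, Tendsto (fun s : ℝ => eH0Norm α (u s - u t)) (𝓝[I] t) (𝓝 0)
  duhamel : ∃ S : ℝ → L2Omega →L[ℝ] L2Omega, IsFracHeatSemigroup α S ∧
    ∀ t ∈ I, u t = S t u₀ - ∫ s in (0 : ℝ)..t, S (t - s) (superpose f (u s) - g)

end

/-!
Since `j : H₀^{α/2}(Ω) → L²(Ω)` is injective and compact with dense range, its singular value
decomposition diagonalises the operator of the form `γ (⟪v, w⟫ - ⟪j v, j w⟫)`, and the equation
becomes an abstract semilinear gradient flow in the coordinates of the singular basis. Test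
functions are dense in `H₀^{α/2}(Ω)`, so this operator is the distributional fractional
Laplacian; each singular vector is then an eigenvector of the generator of every semigroup `exp
(t A_α)`, which determines that semigroup.

The smoothing `‖exp (-t A)‖_{L² → H₀^{α/2}} ≲ t^(-1/2)` makes the Picard map a contraction in a
weighted norm after truncation of the nonlinearity. The energy `½ ⟪A v, v⟫ + J v`, with `J` the
potential of `f(u) - g`, is nonincreasing: it is differentiated along Galerkin truncations.
Integrated along rays, the dissipativity `a ‖v‖² - b ≤ ⟪A v, v⟫ + ⟪N v, j v⟫` makes the energy
coercive, which yields global bounds. Integrated along a solution, it forces the solution into a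
fixed ball within a time depending only on the size of the initial value; from then on the
energy, and hence the norm, is bounded independently of that value.
-/

noncomputable section

open scoped InnerProductSpace

/-! ### Diagonalisation of operators and semigroups -/

section HilbertBasis

variable {ι X : Type*} [NormedAddCommGroup X] [InnerProductSpace ℝ X] (e : HilbertBasis ι ℝ X)

theorem eq_of_forall_inner_hilbertBasis_eq {𝕜 ι X : Type*} [RCLike 𝕜] [NormedAddCommGroup X]
    [InnerProductSpace 𝕜 X] (e : HilbertBasis ι 𝕜 X) {x y : X}
    (h : ∀ i, inner 𝕜 (e i) x = inner 𝕜 (e i) y) : x = y := by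
  apply e.repr.injective
  ext i
  rw [e.repr_apply_apply, e.repr_apply_apply, h]

theorem hasSum_inner_hilbertBasis_sq (x : X) :
    HasSum (fun i => inner ℝ (e i) x ^ 2) (‖x‖ ^ 2) := by
  have h := e.hasSum_inner_mul_inner x x
  rw [real_inner_self_eq_norm_sq] at h
  refine h.congr_fun fun i => ?_
  rw [sq, real_inner_comm]

theorem sum_inner_hilbertBasis_sq_le (x : X) (F : Finset ι) :
    ∑ i ∈ F, inner ℝ (e i) x ^ 2 ≤ ‖x‖ ^ 2 :=
  sum_le_hasSum F (fun _ _ => sq_nonneg _) (hasSum_inner_hilbertBasis_sq e x)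

theorem norm_sub_sum_inner_hilbertBasis_sq_le {M : ι → ℝ} (hM : Summable M) {x : X}
    (hx : ∀ i, inner ℝ (e i) x ^ 2 ≤ M i) (F : Finset ι) :
    ‖x - ∑ i ∈ F, inner ℝ (e i) x • e i‖ ^ 2 ≤ ∑' i, M i - ∑ i ∈ F, M i := by
  have hpythagoras : ‖x - ∑ i ∈ F, inner ℝ (e i) x • e i‖ ^ 2 =
      ‖x‖ ^ 2 - ∑ i ∈ F, inner ℝ (e i) x ^ 2 := by
    have hcross : inner ℝ x (∑ i ∈ F, inner ℝ (e i) x • e i) = ∑ i ∈ F, inner ℝ (e i) x ^ 2 := by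
      simp only [inner_sum, inner_smul_right, real_inner_comm x, sq]
    have hnorm : ‖∑ i ∈ F, inner ℝ (e i) x • e i‖ ^ 2 = ∑ i ∈ F, inner ℝ (e i) x ^ 2 := by
      rw [← real_inner_self_eq_norm_sq, e.orthonormal.inner_sum]
      simp only [conj_trivial, sq]
    rw [norm_sub_sq_real, hcross, hnorm]
    ring
  have hrest := sum_le_hasSum F (fun i _ => sub_nonneg.2 (hx i))
    (hM.hasSum.sub (hasSum_inner_hilbertBasis_sq e x))
  rw [Finset.sum_sub_distrib] at hrest
  linarith

theorem norm_le_of_inner_hilbertBasis_sq_le {Y : Type*} [NormedAddCommGroup Y]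
    [InnerProductSpace ℝ Y] (b : HilbertBasis ι ℝ Y) {x : X} {y : Y}
    (h : ∀ i, inner ℝ (e i) x ^ 2 ≤ inner ℝ (b i) y ^ 2) : ‖x‖ ≤ ‖y‖ :=
  le_of_sq_le_sq (hasSum_le h (hasSum_inner_hilbertBasis_sq e x) (hasSum_inner_hilbertBasis_sq b y))
    (norm_nonneg _)

theorem exists_forall_inner_hilbertBasis_eq {a : ι → ℝ} (ha : Summable fun i => a i ^ 2) :
    ∃ x : X, ∀ i, inner ℝ (e i) x = a i := by
  have hmem : Memℓp a 2 := memℓp_gen (by simpa using ha)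
  refine ⟨e.repr.symm ⟨a, hmem⟩, fun i => ?_⟩
  rw [← e.repr_apply_apply, LinearIsometryEquiv.apply_symm_apply]

theorem tendsto_of_inner_hilbertBasis {κ : Type*} {l : Filter κ} {x : κ → X} {y : X} {M : ι → ℝ}
    (hM : Summable M) (hb : ∀ᶠ a in l, ∀ i, inner ℝ (e i) (x a) ^ 2 ≤ M i)
    (h : ∀ i, Tendsto (fun a => inner ℝ (e i) (x a)) l (𝓝 (inner ℝ (e i) y))) :
    Tendsto x l (𝓝 y) := by
  rw [tendsto_iff_norm_sub_tendsto_zero]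
  have hsum : Tendsto (fun a => ∑' i, (inner ℝ (e i) (x a) - inner ℝ (e i) y) ^ 2) l
      (𝓝 (∑' _ : ι, (0 : ℝ))) := by
    refine tendsto_tsum_of_dominated_convergence
      (bound := fun i => 2 * M i + 2 * inner ℝ (e i) y ^ 2)
      ((hM.mul_left 2).add ((hasSum_inner_hilbertBasis_sq e y).summable.mul_left 2))
      (fun i => ?_) ?_
    · simpa using ((h i).sub_const (inner ℝ (e i) y)).pow 2
    · filter_upwards [hb] with a ha i
      rw [Real.norm_of_nonneg (sq_nonneg _)]
      nlinarith [ha i, sq_nonneg (inner ℝ (e i) (x a) + inner ℝ (e i) y)]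
  have hsqrt := hsum.sqrt
  rw [tsum_zero, Real.sqrt_zero] at hsqrt
  refine hsqrt.congr fun a => ?_
  rw [← Real.sqrt_sq (norm_nonneg (x a - y)),
    ← (hasSum_inner_hilbertBasis_sq e (x a - y)).tsum_eq]
  simp only [inner_sub_right]

theorem continuousOn_of_inner_hilbertBasis {Y : Type*} [TopologicalSpace Y] {s : Set Y}
    {x : Y → X} {M : ι → ℝ} (hM : Summable M) (hb : ∀ a ∈ s, ∀ i, inner ℝ (e i) (x a) ^ 2 ≤ M i)
    (h : ∀ i, ContinuousOn (fun a => inner ℝ (e i) (x a)) s) : ContinuousOn x s := fun a ha =>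
  tendsto_of_inner_hilbertBasis e hM (eventually_mem_nhdsWithin.mono hb) fun i => h i a ha

theorem exists_clm_inner_hilbertBasis_eq_mul {m : ι → ℝ} {C : ℝ} (hm : ∀ i, |m i| ≤ C) :
    ∃ D : X →L[ℝ] X, ∀ w i, inner ℝ (e i) (D w) = m i * inner ℝ (e i) w := by
  have hle (w : X) (i : ι) : (m i * inner ℝ (e i) w) ^ 2 ≤ C ^ 2 * inner ℝ (e i) w ^ 2 := by
    rw [mul_pow, ← sq_abs (m i)]
    exact mul_le_mul_of_nonneg_right (pow_le_pow_left₀ (abs_nonneg _) (hm i) 2) (sq_nonneg _)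
  have hsummable (w : X) : Summable fun i => (m i * inner ℝ (e i) w) ^ 2 :=
    Summable.of_nonneg_of_le (fun i => sq_nonneg _) (hle w)
      ((hasSum_inner_hilbertBasis_sq e w).summable.mul_left _)
  choose D hD using fun w => exists_forall_inner_hilbertBasis_eq e (hsummable w)
  refine ⟨LinearMap.mkContinuous
    { toFun := D
      map_add' := fun x y => eq_of_forall_inner_hilbertBasis_eq e fun i => by
        rw [hD, inner_add_right, inner_add_right, hD, hD, mul_add]
      map_smul' := fun c x => eq_of_forall_inner_hilbertBasis_eq e fun i => by
        rw [hD, inner_smul_right, RingHom.id_apply, inner_smul_right, hD]; ring }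
    |C| fun w => ?_, hD⟩
  refine le_of_sq_le_sq ?_ (by positivity)
  rw [mul_pow, sq_abs]
  refine hasSum_le (fun i => ?_) (hasSum_inner_hilbertBasis_sq e (D w))
    ((hasSum_inner_hilbertBasis_sq e w).mul_left (C ^ 2))
  rw [hD]
  exact hle w i

end HilbertBasis

section Spectral

theorem exists_hilbertBasis_mem_of_orthogonalFamily.{u, v} {𝕜 : Type*} {κ : Type v} {X : Type u}
    [RCLike 𝕜] [NormedAddCommGroup X] [InnerProductSpace 𝕜 X] [CompleteSpace X]
    {U : κ → Submodule 𝕜 X} [∀ k, CompleteSpace (U k)]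
    (hU : OrthogonalFamily 𝕜 (fun k => U k) fun k => (U k).subtypeₗᵢ)
    (htop : (⨆ k, U k)ᗮ = ⊥) :
    ∃ (ι : Type (max u v)) (e : HilbertBasis ι 𝕜 X), ∀ i, ∃ k, e i ∈ U k := by
  choose w b _ using fun k => exists_hilbertBasis 𝕜 (U k)
  have horth := hU.orthonormal_sigma_orthonormal (v_family := fun k => b k)
    fun k => (b k).orthonormal
  have hbot : (Submodule.span 𝕜 (Set.range fun a : (Σ k, w k) => (U a.1).subtypeₗᵢ (b a.1 a.2)))ᗮ
      = ⊥ := by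
    rw [eq_bot_iff, ← htop, ← Submodule.iInf_orthogonal]
    refine le_iInf fun k x hx => ?_
    rw [← Submodule.orthogonalProjectionOnto_eq_zero_iff]
    refine eq_of_forall_inner_hilbertBasis_eq (b k) fun i => ?_
    rw [Submodule.inner_orthogonalProjectionOnto_eq_of_mem_left, inner_zero_right]
    exact (Submodule.mem_orthogonal _ _).1 hx _ (Submodule.subset_span ⟨⟨k, i⟩, rfl⟩)
  refine ⟨_, HilbertBasis.mkOfOrthogonalEqBot horth hbot, fun a => ⟨a.1, ?_⟩⟩
  rw [HilbertBasis.coe_mkOfOrthogonalEqBot]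
  exact (b a.1 a.2).2

open Module.End in
theorem exists_hilbertBasis_eigenvectors.{u} {X : Type u} [NormedAddCommGroup X]
    [InnerProductSpace ℝ X] [CompleteSpace X] {T : X →L[ℝ] X} (hT : IsCompactOperator T)
    (hs : (T : X →ₗ[ℝ] X).IsSymmetric) :
    ∃ (ι : Type u) (e : HilbertBasis ι ℝ X) (κ : ι → ℝ), ∀ i, T (e i) = κ i • e i := by
  have hcomplete (μ : ℝ) : CompleteSpace (eigenspace (T : X →ₗ[ℝ] X) μ) := by
    refine IsClosed.completeSpace_coe (hs := ?_)
    have : (eigenspace (T : X →ₗ[ℝ] X) μ : Set X) = {x | T x = μ • x} := by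
      ext x; exact mem_eigenspace_iff
    rw [this]
    exact isClosed_eq T.continuous (continuous_const_smul μ)
  obtain ⟨ι, e, he⟩ := exists_hilbertBasis_mem_of_orthogonalFamily hs.orthogonalFamily_eigenspaces
    (ContinuousLinearMap.orthogonalComplement_iSup_eigenspaces_eq_bot hT hs)
  choose κ hκ using he
  exact ⟨ι, e, κ, fun i => mem_eigenspace_iff.1 (hκ i)⟩

section SingularValues

universe u
variable {X : Type u} {V : Type*}
  [NormedAddCommGroup X] [InnerProductSpace ℝ X] [CompleteSpace X]
  [NormedAddCommGroup V] [InnerProductSpace ℝ V] [CompleteSpace V] {j : V →L[ℝ] X}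

theorem inner_adjoint_eq_mul_of_eigenvector {x y : X} {κ : ℝ}
    (h : j (ContinuousLinearMap.adjoint j y) = κ • y) :
    ⟪ContinuousLinearMap.adjoint j x, ContinuousLinearMap.adjoint j y⟫_ℝ = κ * ⟪x, y⟫_ℝ := by
  rw [ContinuousLinearMap.adjoint_inner_left, h, inner_smul_right]

theorem exists_hilbertBasis_singularValues (hj : IsCompactOperator j)
    (hinj : Function.Injective j) (hdense : ∀ h : X, (∀ v, ⟪h, j v⟫_ℝ = 0) → h = 0) :
    ∃ (ι : Type u) (e : HilbertBasis ι ℝ X) (b : HilbertBasis ι ℝ V) (σ : ι → ℝ),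
      (∀ i, 0 < σ i) ∧ ∀ i v, ⟪e i, j v⟫_ℝ = σ i * ⟪b i, v⟫_ℝ := by
  set js := ContinuousLinearMap.adjoint j
  have hadj (x : X) (v : V) : ⟪js x, v⟫_ℝ = ⟪x, j v⟫_ℝ :=
    ContinuousLinearMap.adjoint_inner_left j v x
  have hsymm : ((j.comp js : X →L[ℝ] X) : X →ₗ[ℝ] X).IsSymmetric := fun x y => by
    change ⟪j (js x), y⟫_ℝ = ⟪x, j (js y)⟫_ℝ
    rw [← hadj x, real_inner_comm, ← hadj y, real_inner_comm]
  obtain ⟨ι, e, κ, he⟩ := exists_hilbertBasis_eigenvectors (hj.comp_clm js) hsymm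
  have hpos (i) : 0 < ‖js (e i)‖ := by
    refine norm_pos_iff.2 fun h => e.orthonormal.ne_zero i (hdense _ fun v => ?_)
    rw [← hadj, h, inner_zero_left]
  have horth : Orthonormal ℝ fun i => ‖js (e i)‖⁻¹ • js (e i) := by
    refine ⟨fun i => ?_, fun i k hik => ?_⟩
    · rw [norm_smul, norm_inv, norm_norm, inv_mul_cancel₀ (hpos i).ne']
    · simp only [inner_smul_left, inner_smul_right]
      rw [inner_adjoint_eq_mul_of_eigenvector (he k), e.orthonormal.2 hik, mul_zero, mul_zero,
        mul_zero]
  have hbot : (Submodule.span ℝ (Set.range fun i => ‖js (e i)‖⁻¹ • js (e i)))ᗮ = ⊥ := by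
    refine (Submodule.eq_bot_iff _).2 fun v hv => hinj ?_
    refine (eq_of_forall_inner_hilbertBasis_eq e fun i => ?_).trans (map_zero j).symm
    have h := (Submodule.mem_orthogonal _ _).1 hv _ (Submodule.subset_span ⟨i, rfl⟩)
    rw [inner_smul_left, hadj] at h
    rw [inner_zero_right]
    exact (mul_eq_zero.1 h).resolve_left (inv_ne_zero (hpos i).ne')
  refine ⟨ι, e, HilbertBasis.mkOfOrthogonalEqBot horth hbot, fun i => ‖js (e i)‖, hpos,
    fun i v => ?_⟩
  rw [HilbertBasis.coe_mkOfOrthogonalEqBot, real_inner_smul_left, hadj,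
    mul_inv_cancel_left₀ (hpos i).ne']

end SingularValues

end Spectral

section Semigroup

variable {E : Type*} [NormedAddCommGroup E] [NormedSpace ℝ E] {S : ℝ → E →L[ℝ] E}

theorem hasDerivWithinAt_semigroup
    (hadd : ∀ s t : ℝ, 0 ≤ s → 0 ≤ t → S (s + t) = (S s).comp (S t)) {x y : E}
    (hgen : Tendsto (fun t : ℝ => t⁻¹ • (S t x - x)) (𝓝[>] 0) (𝓝 y)) {t : ℝ} (ht : 0 ≤ t) :
    HasDerivWithinAt (fun s => S s x) (S t y) (Ici t) t := by
  rw [← hasDerivWithinAt_Ioi_iff_Ici, hasDerivWithinAt_iff_tendsto_slope' self_notMem_Ioi]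
  have hsub : Tendsto (fun s : ℝ => s - t) (𝓝[>] t) (𝓝[>] 0) := by
    refine tendsto_nhdsWithin_iff.2 ⟨?_, ?_⟩
    · exact ((continuous_sub_right t).tendsto' t 0 (sub_self t)).mono_left nhdsWithin_le_nhds
    · filter_upwards [self_mem_nhdsWithin] with s hs using sub_pos.2 (mem_Ioi.1 hs)
  refine ((((S t).continuous.tendsto _).comp hgen).comp hsub).congr' ?_
  filter_upwards [self_mem_nhdsWithin] with s hs
  have hst : 0 ≤ s - t := (sub_pos.2 (mem_Ioi.1 hs)).le
  simp only [Function.comp_apply, map_smul, map_sub, slope, vsub_eq_sub]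
  rw [← ContinuousLinearMap.comp_apply, ← hadd t (s - t) ht hst, add_sub_cancel]

theorem semigroup_apply_eq_exp_smul (hzero : S 0 = ContinuousLinearMap.id ℝ E)
    (hadd : ∀ s t : ℝ, 0 ≤ s → 0 ≤ t → S (s + t) = (S s).comp (S t)) {x : E} {m : ℝ}
    (hcont : ContinuousOn (fun t => S t x) (Ici 0))
    (hgen : Tendsto (fun t : ℝ => t⁻¹ • (S t x - x)) (𝓝[>] 0) (𝓝 (m • x))) {T : ℝ}
    (hT : 0 ≤ T) : S T x = Real.exp (m * T) • x := by
  have hexp (t : ℝ) : HasDerivAt (fun t => Real.exp (-(m * t))) (Real.exp (-(m * t)) * -m) t := by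
    simpa using (((hasDerivAt_id t).const_mul m).neg).exp
  have hder : ∀ t ∈ Ico 0 T,
      HasDerivWithinAt (fun t => Real.exp (-(m * t)) • S t x) 0 (Ici t) t := by
    intro t ht
    have h := (hexp t).hasDerivWithinAt.smul (hasDerivWithinAt_semigroup hadd hgen ht.1)
    rwa [map_smul, smul_smul, ← add_smul, mul_neg, add_neg_cancel, zero_smul] at h
  have hconst := constant_of_has_deriv_right_zero (f := fun t => Real.exp (-(m * t)) • S t x)
    (ContinuousOn.smul (by fun_prop) (hcont.mono Icc_subset_Ici_self)) hder T
    (right_mem_Icc.2 hT)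
  simp only [mul_zero, neg_zero, Real.exp_zero, one_smul, hzero,
    ContinuousLinearMap.id_apply] at hconst
  nth_rewrite 2 [← hconst]
  rw [smul_smul, ← Real.exp_add, add_neg_cancel, Real.exp_zero, one_smul]

end Semigroup

section ScalarInequalities

theorem tendsto_inv_mul_exp_sub_one (m : ℝ) :
    Tendsto (fun t : ℝ => t⁻¹ * (Real.exp (m * t) - 1)) (𝓝[>] 0) (𝓝 m) := by
  have h : HasDerivAt (fun t : ℝ => Real.exp (m * t)) m 0 := by
    simpa using ((hasDerivAt_id (0 : ℝ)).const_mul m).exp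
  exact h.tendsto_slope_zero_right.congr fun t => by simp

theorem intervalIntegral_mul_sq_le {f g : ℝ → ℝ} (hf : Continuous f) (hg : Continuous g) {a b : ℝ}
    (hab : a ≤ b) : (∫ s in a..b, f s * g s) ^ 2 ≤
      (∫ s in a..b, f s ^ 2) * ∫ s in a..b, g s ^ 2 := by
  have h : ∀ x : ℝ, 0 ≤ (∫ s in a..b, f s ^ 2) * (x * x) +
      (2 * ∫ s in a..b, f s * g s) * x + ∫ s in a..b, g s ^ 2 := by
    intro x
    have hnonneg : 0 ≤ ∫ s in a..b, (x * f s + g s) ^ 2 :=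
      intervalIntegral.integral_nonneg hab fun s _ => sq_nonneg _
    have hexpand : ∫ s in a..b, (x * f s + g s) ^ 2 = ∫ s in a..b,
        ((x * x) * f s ^ 2 + (2 * x) * (f s * g s) + g s ^ 2) := by
      congr 1 with s; ring
    rw [hexpand, intervalIntegral.integral_add, intervalIntegral.integral_add,
      intervalIntegral.integral_const_mul, intervalIntegral.integral_const_mul] at hnonneg
    · linarith
    all_goals exact Continuous.intervalIntegrable (by fun_prop) _ _
  have := discrim_le_zero h
  rw [discrim] at this
  linarith

theorem integral_exp_neg_mul_sub_le {m : ℝ} (hm : 0 < m) (t : ℝ) :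
    ∫ s in (0 : ℝ)..t, Real.exp (-(m * (t - s))) ≤ 1 / m := by
  have hder : ∀ s ∈ uIcc 0 t, HasDerivAt (fun s => Real.exp (-(m * (t - s))) / m)
      (Real.exp (-(m * (t - s)))) s := fun s _ => by
    have h : HasDerivAt (fun s => -(m * (t - s))) m s := by
      simpa using! (((hasDerivAt_id s).const_sub t).const_mul m).neg
    simpa only [mul_div_cancel_right₀ _ hm.ne'] using h.exp.div_const m
  rw [intervalIntegral.integral_eq_sub_of_hasDerivAt hder
    (Continuous.intervalIntegrable (by fun_prop) _ _)]
  simp only [sub_self, mul_zero, neg_zero, Real.exp_zero, sub_le_self_iff]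
  positivity

theorem sq_integral_exp_mul_le {m l : ℝ} (hml : 0 < 2 * m + l) {k : ℝ → ℝ} (hk : Continuous k)
    {t : ℝ} (ht : 0 ≤ t) :
    (∫ s in (0 : ℝ)..t, Real.exp (-(m * (t - s))) * k s) ^ 2 ≤
      1 / (2 * m + l) * ∫ s in (0 : ℝ)..t, Real.exp (l * (t - s)) * k s ^ 2 := by
  have h := intervalIntegral_mul_sq_le (f := fun s => Real.exp (-((m + l / 2) * (t - s))))
    (g := fun s => Real.exp (l / 2 * (t - s)) * k s) (by fun_prop) (by fun_prop) ht
  have hprod (s : ℝ) : Real.exp (-((m + l / 2) * (t - s))) * (Real.exp (l / 2 * (t - s)) * k s) =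
      Real.exp (-(m * (t - s))) * k s := by
    rw [← mul_assoc, ← Real.exp_add]
    congr 2; ring
  have hleft (s : ℝ) : Real.exp (-((m + l / 2) * (t - s))) ^ 2 =
      Real.exp (-((2 * m + l) * (t - s))) := by
    rw [← Real.exp_nat_mul]; congr 1; push_cast; ring
  have hright (s : ℝ) : (Real.exp (l / 2 * (t - s)) * k s) ^ 2 =
      Real.exp (l * (t - s)) * k s ^ 2 := by
    rw [mul_pow, ← Real.exp_nat_mul]; congr 2; push_cast; ring
  simp only [hprod, hleft, hright] at h
  refine h.trans (mul_le_mul_of_nonneg_right (integral_exp_neg_mul_sub_le hml t) ?_)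
  exact intervalIntegral.integral_nonneg ht fun s _ => by positivity

theorem eq_zero_of_le_mul_integral {δ : ℝ → ℝ} (hδ : Continuous δ) (h0 : ∀ t, 0 ≤ δ t) {K T : ℝ}
    (h : ∀ t ∈ Icc 0 T, δ t ≤ K * ∫ s in (0 : ℝ)..t, δ s) : ∀ t ∈ Icc 0 T, δ t = 0 := by
  have hder (t : ℝ) : HasDerivAt (fun t => ∫ s in (0 : ℝ)..t, δ s) (δ t) t :=
    intervalIntegral.integral_hasDerivAt_right (hδ.intervalIntegrable _ _)
      (hδ.stronglyMeasurableAtFilter _ _) hδ.continuousAt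
  have hpos : ∀ t ∈ Icc 0 T, 0 ≤ ∫ s in (0 : ℝ)..t, δ s := fun t ht =>
    intervalIntegral.integral_nonneg ht.1 fun s _ => h0 s
  have hgronwall := norm_le_gronwallBound_of_norm_deriv_right_le
    (f := fun t => ∫ s in (0 : ℝ)..t, δ s) (f' := δ) (δ := 0) (K := K) (ε := 0) (a := 0) (b := T)
    (fun t _ => (hder t).continuousAt.continuousWithinAt) (fun t _ => (hder t).hasDerivWithinAt)
    (by simp) fun t ht => by
      rw [Real.norm_of_nonneg (h0 t), Real.norm_of_nonneg (hpos t ⟨ht.1, ht.2.le⟩), add_zero]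
      exact h t ⟨ht.1, ht.2.le⟩
  intro t ht
  have hzero := hgronwall t ht
  rw [gronwallBound_ε0_δ0, norm_le_zero_iff] at hzero
  exact le_antisymm ((h t ht).trans (by rw [hzero, mul_zero])) (h0 t)

theorem forall_le_of_bootstrap {φ : ℝ → ℝ} (hφ : Continuous φ) {K K' : ℝ} (hK : K < K')
    (h0 : φ 0 ≤ K) (h : ∀ T, 0 ≤ T → (∀ t ∈ Icc 0 T, φ t ≤ K') → φ T ≤ K) {t : ℝ} (ht : 0 ≤ t) :
    φ t ≤ K := by
  suffices hlt : ∀ s ∈ Icc 0 t, φ s < K' from h t ht fun s hs => (hlt s hs).le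
  by_contra! hex
  have hcompact : IsCompact (Icc 0 t ∩ {s | K' ≤ φ s}) :=
    isCompact_Icc.inter_right (isClosed_le continuous_const hφ)
  obtain ⟨T, ⟨hT, hφT⟩, hleast⟩ := hcompact.exists_isLeast hex
  have hbefore : ∀ s ∈ Ico 0 T, φ s < K' := fun s hs => by
    by_contra! hs'
    exact (hleast ⟨⟨hs.1, hs.2.le.trans hT.2⟩, hs'⟩).not_gt hs.2
  have hT0 : 0 ≠ T := by
    rintro rfl
    exact (h0.trans_lt hK).not_ge hφT
  have hclosure : T ∈ closure (Ico 0 T) := by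
    rw [closure_Ico hT0]
    exact right_mem_Icc.2 hT.1
  have hle : Ico 0 T ⊆ {s | φ s ≤ K} := fun s hs =>
    h s hs.1 fun r hr => (hbefore r ⟨hr.1, hr.2.trans_lt hs.2⟩).le
  have : φ T ≤ K := closure_minimal hle (isClosed_le hφ continuous_const) hclosure
  exact (this.trans_lt hK).not_ge hφT

end ScalarInequalities

/-! ### Semilinear gradient flows -/

section GradientFlow

variable {V X : Type*} [NormedAddCommGroup V] [InnerProductSpace ℝ V]
  [NormedAddCommGroup X] [InnerProductSpace ℝ X] {ι : Type*} {j : V →L[ℝ] X} {γ : ℝ}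

/-- A singular value decomposition of `j : V → X`, with left and right singular bases `e` and `b`
and singular values `σ`. It diagonalises the form `γ (⟪v, w⟫ - ⟪j v, j w⟫)` on `V`, and hence the
unbounded operator `A` on `X` associated with that form. -/
structure DiagonalForm (ι : Type*) (j : V →L[ℝ] X) (γ : ℝ) where
  e : HilbertBasis ι ℝ X
  b : HilbertBasis ι ℝ V
  σ : ι → ℝ
  σ_pos : ∀ i, 0 < σ i
  σ_le_one : ∀ i, σ i ≤ 1
  inner_apply : ∀ i v, ⟪e i, j v⟫_ℝ = σ i * ⟪b i, v⟫_ℝ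
  γ_pos : 0 < γ

theorem exists_diagonalForm.{u} {X : Type u} [NormedAddCommGroup X] [InnerProductSpace ℝ X]
    [CompleteSpace V] [CompleteSpace X] {j : V →L[ℝ] X} (hj : IsCompactOperator j)
    (hinj : Function.Injective j) (hdense : ∀ h : X, (∀ v, ⟪h, j v⟫_ℝ = 0) → h = 0)
    (hnorm : ∀ v, ‖j v‖ ≤ ‖v‖) (hγ : 0 < γ) : ∃ ι : Type u, Nonempty (DiagonalForm ι j γ) := by
  obtain ⟨ι, e, b, σ, hσ, he⟩ := exists_hilbertBasis_singularValues hj hinj hdense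
  refine ⟨ι, ⟨e, b, σ, hσ, fun i => ?_, he, hγ⟩⟩
  calc σ i = ⟪e i, j (b i)⟫_ℝ := by
        rw [he, real_inner_self_eq_norm_sq, b.orthonormal.1, one_pow, mul_one]
    _ ≤ ‖e i‖ * ‖j (b i)‖ := real_inner_le_norm _ _
    _ ≤ 1 := by
        rw [e.orthonormal.1, one_mul]
        exact (hnorm _).trans (b.orthonormal.1 i).le

namespace DiagonalForm

variable (Φ : DiagonalForm ι j γ)

section Semigroup

/-- The eigenvalue of `A` at the eigenvector `e i`. -/
def eig (i : ι) : ℝ := γ * ((Φ.σ i)⁻¹ ^ 2 - 1)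

theorem one_le_inv_σ_sq (i : ι) : 1 ≤ (Φ.σ i)⁻¹ ^ 2 :=
  one_le_pow₀ ((one_le_inv₀ (Φ.σ_pos i)).2 (Φ.σ_le_one i))

theorem eig_nonneg (i : ι) : 0 ≤ Φ.eig i :=
  mul_nonneg Φ.γ_pos.le (sub_nonneg.2 (Φ.one_le_inv_σ_sq i))

theorem exp_neg_eig_mul_le_one (i : ι) {t : ℝ} (ht : 0 ≤ t) : Real.exp (-(Φ.eig i * t)) ≤ 1 := by
  rw [Real.exp_le_one_iff, neg_nonpos]
  exact mul_nonneg (Φ.eig_nonneg i) ht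

theorem exists_heat (t : ℝ) : ∃ S : X →L[ℝ] X, ∀ w i,
    ⟪Φ.e i, S w⟫_ℝ = Real.exp (-(Φ.eig i * max t 0)) * ⟪Φ.e i, w⟫_ℝ := by
  refine exists_clm_inner_hilbertBasis_eq_mul Φ.e (C := 1) fun i => ?_
  rw [abs_of_pos (Real.exp_pos _)]
  exact Φ.exp_neg_eig_mul_le_one i (le_max_right _ _)

/-- The semigroup `exp (-t A)` for `t ≥ 0`; it is constant for `t ≤ 0`. -/
def heat (t : ℝ) : X →L[ℝ] X := (Φ.exists_heat t).choose

theorem inner_heat {t : ℝ} (ht : 0 ≤ t) (w : X) (i : ι) :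
    ⟪Φ.e i, Φ.heat t w⟫_ℝ = Real.exp (-(Φ.eig i * t)) * ⟪Φ.e i, w⟫_ℝ := by
  rw [heat, (Φ.exists_heat t).choose_spec, max_eq_left ht]

theorem exp_mul_sq_le {t : ℝ} (ht : 0 ≤ t) (x : ℝ) (i : ι) :
    (Real.exp (-(Φ.eig i * t)) * x) ^ 2 ≤ x ^ 2 := by
  rw [mul_pow]
  exact mul_le_of_le_one_left (sq_nonneg _)
    (pow_le_one₀ (Real.exp_pos _).le (Φ.exp_neg_eig_mul_le_one i ht))

theorem inner_heat_sq_le {t : ℝ} (ht : 0 ≤ t) (w : X) (i : ι) :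
    ⟪Φ.e i, Φ.heat t w⟫_ℝ ^ 2 ≤ ⟪Φ.e i, w⟫_ℝ ^ 2 := by
  rw [Φ.inner_heat ht]
  exact Φ.exp_mul_sq_le ht _ i

theorem norm_heat_le {t : ℝ} (ht : 0 ≤ t) (w : X) : ‖Φ.heat t w‖ ≤ ‖w‖ :=
  norm_le_of_inner_hilbertBasis_sq_le Φ.e Φ.e (Φ.inner_heat_sq_le ht w)

theorem heat_zero : Φ.heat 0 = ContinuousLinearMap.id ℝ X := by
  ext1 w
  refine eq_of_forall_inner_hilbertBasis_eq Φ.e fun i => ?_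
  rw [Φ.inner_heat le_rfl, mul_zero, neg_zero, Real.exp_zero, one_mul]
  rfl

theorem heat_add {s t : ℝ} (hs : 0 ≤ s) (ht : 0 ≤ t) :
    Φ.heat (s + t) = (Φ.heat s).comp (Φ.heat t) := by
  ext1 w
  refine eq_of_forall_inner_hilbertBasis_eq Φ.e fun i => ?_
  rw [ContinuousLinearMap.comp_apply, Φ.inner_heat (add_nonneg hs ht), Φ.inner_heat hs,
    Φ.inner_heat ht, ← mul_assoc, ← Real.exp_add, mul_add, neg_add]

theorem continuousOn_heat (w : X) : ContinuousOn (fun t => Φ.heat t w) (Ici 0) := by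
  refine continuousOn_of_inner_hilbertBasis Φ.e (hasSum_inner_hilbertBasis_sq Φ.e w).summable
    (fun t ht i => Φ.inner_heat_sq_le ht w i) fun i => ?_
  have : ContinuousOn (fun t => Real.exp (-(Φ.eig i * t)) * ⟪Φ.e i, w⟫_ℝ) (Ici 0) := by fun_prop
  exact this.congr fun t ht => Φ.inner_heat ht w i

theorem abs_inv_mul_exp_sub_one_le {m t : ℝ} (hm : 0 ≤ m) (ht : 0 < t) :
    |t⁻¹ * (Real.exp (-(m * t)) - 1)| ≤ m := by
  rw [abs_mul, abs_of_pos (inv_pos.2 ht), inv_mul_le_iff₀ ht, abs_of_nonpos]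
  · linarith [Real.add_one_le_exp (-(m * t))]
  · rw [sub_nonpos, Real.exp_le_one_iff, neg_nonpos]
    exact mul_nonneg hm ht.le

theorem tendsto_heat_iff (w h : X) :
    Tendsto (fun t : ℝ => t⁻¹ • (Φ.heat t w - w)) (𝓝[>] 0) (𝓝 h) ↔
      ∀ i, ⟪Φ.e i, h⟫_ℝ = -(Φ.eig i * ⟪Φ.e i, w⟫_ℝ) := by
  have hquot {t : ℝ} (ht : t ∈ Ioi (0 : ℝ)) (i : ι) :
      ⟪Φ.e i, t⁻¹ • (Φ.heat t w - w)⟫_ℝ =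
        t⁻¹ * (Real.exp (-(Φ.eig i * t)) - 1) * ⟪Φ.e i, w⟫_ℝ := by
    rw [inner_smul_right, inner_sub_right, Φ.inner_heat (le_of_lt ht)]; ring
  have hlim (i : ι) : Tendsto (fun t : ℝ => ⟪Φ.e i, t⁻¹ • (Φ.heat t w - w)⟫_ℝ) (𝓝[>] 0)
      (𝓝 (-(Φ.eig i * ⟪Φ.e i, w⟫_ℝ))) := by
    rw [← neg_mul]
    refine ((tendsto_inv_mul_exp_sub_one (-Φ.eig i)).mul_const _).congr' ?_
    filter_upwards [self_mem_nhdsWithin] with t ht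
    rw [hquot ht, neg_mul]
  refine ⟨fun ht i => tendsto_nhds_unique (tendsto_const_nhds.inner ht) (hlim i), fun hi => ?_⟩
  refine tendsto_of_inner_hilbertBasis Φ.e (hasSum_inner_hilbertBasis_sq Φ.e h).summable ?_
    fun i => by rw [hi]; exact hlim i
  filter_upwards [self_mem_nhdsWithin] with t ht i
  rw [hquot ht, hi, neg_sq, mul_pow, mul_pow (Φ.eig i), ← sq_abs (t⁻¹ * _)]
  exact mul_le_mul_of_nonneg_right
    (pow_le_pow_left₀ (abs_nonneg _) (abs_inv_mul_exp_sub_one_le (Φ.eig_nonneg i) ht) 2)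
    (sq_nonneg _)

theorem eq_heat_of_generator {S : ℝ → X →L[ℝ] X} (hzero : S 0 = ContinuousLinearMap.id ℝ X)
    (hadd : ∀ s t : ℝ, 0 ≤ s → 0 ≤ t → S (s + t) = (S s).comp (S t))
    (hcont : ∀ w, ContinuousOn (fun t => S t w) (Ici 0))
    (hgen : ∀ i, Tendsto (fun t : ℝ => t⁻¹ • (S t (Φ.e i) - Φ.e i)) (𝓝[>] 0)
      (𝓝 (-Φ.eig i • Φ.e i))) {t : ℝ} (ht : 0 ≤ t) : S t = Φ.heat t := by
  refine ContinuousLinearMap.ext_on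
    (Submodule.dense_iff_topologicalClosure_eq_top.2 Φ.e.dense_span) ?_
  rintro _ ⟨i, rfl⟩
  have hheat : Tendsto (fun t : ℝ => t⁻¹ • (Φ.heat t (Φ.e i) - Φ.e i)) (𝓝[>] 0)
      (𝓝 (-Φ.eig i • Φ.e i)) := by
    rw [Φ.tendsto_heat_iff]
    intro k
    rw [inner_smul_right, neg_mul]
    rcases eq_or_ne k i with rfl | hki
    · rfl
    · rw [Φ.e.orthonormal.2 hki, mul_zero, mul_zero]
  rw [semigroup_apply_eq_exp_smul hzero hadd (hcont _) (hgen i) ht,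
    semigroup_apply_eq_exp_smul Φ.heat_zero (fun _ _ => Φ.heat_add) (Φ.continuousOn_heat _) hheat
      ht]

theorem continuousOn_heat_comp {h : ℝ → X} {t : ℝ} (hh : ContinuousOn h (Icc 0 t)) :
    ContinuousOn (fun s => Φ.heat (t - s) (h s)) (Icc 0 t) := by
  intro s₀ hs₀
  have hfixed : Tendsto (fun s => Φ.heat (t - s) (h s₀)) (𝓝[Icc 0 t] s₀)
      (𝓝 (Φ.heat (t - s₀) (h s₀))) :=
    (Φ.continuousOn_heat (h s₀)).comp (f := fun s => t - s) (s := Icc 0 t) (by fun_prop)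
      (fun s hs => sub_nonneg.2 hs.2) s₀ hs₀
  have hdiff : Tendsto (fun s => Φ.heat (t - s) (h s - h s₀)) (𝓝[Icc 0 t] s₀) (𝓝 0) := by
    refine squeeze_zero_norm' ?_ (tendsto_iff_norm_sub_tendsto_zero.1 (hh s₀ hs₀))
    filter_upwards [self_mem_nhdsWithin] with s hs
    exact Φ.norm_heat_le (sub_nonneg.2 hs.2) _
  have hadd := hdiff.add hfixed
  rw [zero_add] at hadd
  refine hadd.congr fun s => ?_
  rw [← map_add, sub_add_cancel]

theorem inner_integral_heat [CompleteSpace X] {h : ℝ → X} {t : ℝ} (ht : 0 ≤ t)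
    (hh : ContinuousOn h (Icc 0 t)) (i : ι) :
    ⟪Φ.e i, ∫ s in (0 : ℝ)..t, Φ.heat (t - s) (h s)⟫_ℝ =
      ∫ s in (0 : ℝ)..t, Real.exp (-(Φ.eig i * (t - s))) * ⟪Φ.e i, h s⟫_ℝ := by
  have hint : IntervalIntegrable (fun s => Φ.heat (t - s) (h s)) volume 0 t :=
    ContinuousOn.intervalIntegrable_of_Icc ht (Φ.continuousOn_heat_comp hh)
  have hcomm := (innerSL ℝ (Φ.e i)).intervalIntegral_comp_comm hint
  simp only [innerSL_apply_apply] at hcomm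
  rw [← hcomm]
  refine intervalIntegral.integral_congr fun s hs => ?_
  rw [uIcc_of_le ht] at hs
  exact Φ.inner_heat (sub_nonneg.2 hs.2) _ i

end Semigroup

section LinearEquation

/-- The coordinate along `b i` of the mild solution of `v' + A v + h = 0`, `v 0 = v₀`. -/
def coeff (v₀ : V) (h : ℝ → X) (i : ι) (t : ℝ) : ℝ :=
  Real.exp (-(Φ.eig i * t)) * ⟪Φ.b i, v₀⟫_ℝ -
    (Φ.σ i)⁻¹ * ∫ s in (0 : ℝ)..t, Real.exp (-(Φ.eig i * (t - s))) * ⟪Φ.e i, h s⟫_ℝ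

theorem coeff_zero (v₀ : V) (h : ℝ → X) (i : ι) : Φ.coeff v₀ h i 0 = ⟪Φ.b i, v₀⟫_ℝ := by
  simp [coeff]

theorem forall_inner_eq_coeff_iff [CompleteSpace X] {v₀ x : V} {h : ℝ → X} {t : ℝ} (ht : 0 ≤ t)
    (hh : ContinuousOn h (Icc 0 t)) : (∀ i, ⟪Φ.b i, x⟫_ℝ = Φ.coeff v₀ h i t) ↔
      j x = Φ.heat t (j v₀) - ∫ s in (0 : ℝ)..t, Φ.heat (t - s) (h s) := by
  have hcoord (i : ι) : ⟪Φ.e i, Φ.heat t (j v₀) - ∫ s in (0 : ℝ)..t, Φ.heat (t - s) (h s)⟫_ℝ =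
      Φ.σ i * Φ.coeff v₀ h i t := by
    rw [inner_sub_right, Φ.inner_heat ht, Φ.inner_apply, Φ.inner_integral_heat ht hh, coeff,
      mul_sub, mul_inv_cancel_left₀ (Φ.σ_pos i).ne', mul_left_comm]
  refine ⟨fun hx => eq_of_forall_inner_hilbertBasis_eq Φ.e fun i => ?_, fun hx i => ?_⟩
  · rw [hcoord, Φ.inner_apply, hx]
  · rw [← mul_right_inj' (Φ.σ_pos i).ne', ← hcoord, ← hx, Φ.inner_apply]

theorem coeff_congr (v₀ : V) {h h' : ℝ → X} (i : ι) {t : ℝ} (ht : 0 ≤ t)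
    (hh : ∀ s ∈ Icc 0 t, h s = h' s) : Φ.coeff v₀ h i t = Φ.coeff v₀ h' i t := by
  rw [coeff, coeff]
  congr 2
  refine intervalIntegral.integral_congr fun s hs => ?_
  rw [uIcc_of_le ht] at hs
  simp only [hh s hs]

theorem hasDerivAt_coeff (v₀ : V) {h : ℝ → X} (hh : Continuous h) (i : ι) (t : ℝ) :
    HasDerivAt (Φ.coeff v₀ h i)
      (-(Φ.eig i * Φ.coeff v₀ h i t + (Φ.σ i)⁻¹ * ⟪Φ.e i, h t⟫_ℝ)) t := by
  set m := Φ.eig i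
  set k := fun s => ⟪Φ.e i, h s⟫_ℝ
  have hfactor : Φ.coeff v₀ h i = fun t => Real.exp (-(m * t)) *
      (⟪Φ.b i, v₀⟫_ℝ - (Φ.σ i)⁻¹ * ∫ s in (0 : ℝ)..t, Real.exp (m * s) * k s) := by
    funext t
    rw [coeff, mul_sub, mul_left_comm (Real.exp _) (_⁻¹),
      ← intervalIntegral.integral_const_mul (Real.exp _)]
    congr 3 with s
    rw [← mul_assoc, ← Real.exp_add]
    congr 2; ring
  have hcont : Continuous fun s => Real.exp (m * s) * k s := by fun_prop
  have hint : HasDerivAt (fun t => ∫ s in (0 : ℝ)..t, Real.exp (m * s) * k s)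
      (Real.exp (m * t) * k t) t :=
    intervalIntegral.integral_hasDerivAt_right (hcont.intervalIntegrable _ _)
      (hcont.stronglyMeasurableAtFilter _ _) hcont.continuousAt
  have hexp : HasDerivAt (fun t => Real.exp (-(m * t))) (Real.exp (-(m * t)) * -m) t := by
    simpa using (((hasDerivAt_id t).const_mul m).neg).exp
  rw [hfactor]
  refine (hexp.mul ((hint.const_mul (Φ.σ i)⁻¹).const_sub ⟪Φ.b i, v₀⟫_ℝ)).congr_deriv ?_
  have hcancel : Real.exp (-(m * t)) * Real.exp (m * t) = 1 := by
    rw [← Real.exp_add, neg_add_cancel, Real.exp_zero]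
  linear_combination (-(Φ.σ i)⁻¹ * k t) * hcancel

theorem continuous_coeff (v₀ : V) {h : ℝ → X} (hh : Continuous h) (i : ι) :
    Continuous (Φ.coeff v₀ h i) :=
  continuous_iff_continuousAt.2 fun t => (Φ.hasDerivAt_coeff v₀ hh i t).continuousAt

/-- The factor `(σ i)⁻²`, which grows like the eigenvalue, is absorbed by the decay of the
exponential: sources in `X` produce solutions in `V`. -/
theorem sq_inv_σ_mul_integral_le {l : ℝ} (hl : 2 * γ ≤ l) {h : ℝ → X} (hh : Continuous h)
    (i : ι) {t : ℝ} (ht : 0 ≤ t) :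
    ((Φ.σ i)⁻¹ * ∫ s in (0 : ℝ)..t, Real.exp (-(Φ.eig i * (t - s))) * ⟪Φ.e i, h s⟫_ℝ) ^ 2 ≤
      1 / (2 * γ) * ∫ s in (0 : ℝ)..t, Real.exp (l * (t - s)) * ⟪Φ.e i, h s⟫_ℝ ^ 2 := by
  have hγ := Φ.γ_pos
  have hσ := Φ.one_le_inv_σ_sq i
  have hrate : 2 * γ * (Φ.σ i)⁻¹ ^ 2 ≤ 2 * Φ.eig i + l := by
    rw [eig]
    linarith
  have hpos : 0 < 2 * Φ.eig i + l := lt_of_lt_of_le (by positivity) hrate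
  rw [mul_pow]
  refine (mul_le_mul_of_nonneg_left
    (sq_integral_exp_mul_le hpos (k := fun s => ⟪Φ.e i, h s⟫_ℝ) (by fun_prop) ht)
    (sq_nonneg _)).trans ?_
  rw [← mul_assoc]
  refine mul_le_mul_of_nonneg_right ?_
    (intervalIntegral.integral_nonneg ht fun s _ => by positivity)
  rw [mul_one_div, div_le_div_iff₀ hpos (by positivity)]
  linarith

theorem sum_integral_inner_sq_le {ρ : ℝ → ℝ} (hρ : Continuous ρ) (hρ0 : ∀ s, 0 ≤ ρ s) {h : ℝ → X}
    (hh : Continuous h) (F : Finset ι) {t : ℝ} (ht : 0 ≤ t) :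
    ∑ i ∈ F, ∫ s in (0 : ℝ)..t, ρ s * ⟪Φ.e i, h s⟫_ℝ ^ 2 ≤ ∫ s in (0 : ℝ)..t, ρ s * ‖h s‖ ^ 2 := by
  have hcont (i) : Continuous fun s => ρ s * ⟪Φ.e i, h s⟫_ℝ ^ 2 := by fun_prop
  rw [← intervalIntegral.integral_finsetSum fun i _ => (hcont i).intervalIntegrable _ _]
  refine intervalIntegral.integral_mono_on ht
    ((continuous_finsetSum _ fun i _ => hcont i).intervalIntegrable _ _)
    (Continuous.intervalIntegrable (by fun_prop) _ _) fun s _ => ?_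
  rw [← Finset.mul_sum]
  exact mul_le_mul_of_nonneg_left (sum_inner_hilbertBasis_sq_le Φ.e _ F) (hρ0 s)

theorem summable_integral_inner_sq {h : ℝ → X} (hh : Continuous h) {t : ℝ} (ht : 0 ≤ t) :
    Summable fun i => ∫ s in (0 : ℝ)..t, ⟪Φ.e i, h s⟫_ℝ ^ 2 := by
  refine summable_of_sum_le (c := ∫ s in (0 : ℝ)..t, ‖h s‖ ^ 2)
    (fun i => intervalIntegral.integral_nonneg ht fun s _ => sq_nonneg _) fun F => ?_
  simpa using Φ.sum_integral_inner_sq_le (ρ := fun _ => 1) continuous_const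
    (fun _ => zero_le_one) hh F ht

theorem norm_sq_le_of_inner_eq_integral {l : ℝ} (hl : 2 * γ ≤ l) {h : ℝ → X} (hh : Continuous h)
    {t : ℝ} (ht : 0 ≤ t) {x : V} (hx : ∀ i, ⟪Φ.b i, x⟫_ℝ =
      (Φ.σ i)⁻¹ * ∫ s in (0 : ℝ)..t, Real.exp (-(Φ.eig i * (t - s))) * ⟪Φ.e i, h s⟫_ℝ) :
    ‖x‖ ^ 2 ≤ 1 / (2 * γ) * ∫ s in (0 : ℝ)..t, Real.exp (l * (t - s)) * ‖h s‖ ^ 2 := by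
  have hγ := Φ.γ_pos
  rw [← (hasSum_inner_hilbertBasis_sq Φ.b x).tsum_eq]
  refine Real.tsum_le_of_sum_le (fun i => sq_nonneg _) fun F => ?_
  calc ∑ i ∈ F, ⟪Φ.b i, x⟫_ℝ ^ 2
      ≤ ∑ i ∈ F, 1 / (2 * γ) *
          ∫ s in (0 : ℝ)..t, Real.exp (l * (t - s)) * ⟪Φ.e i, h s⟫_ℝ ^ 2 := by
        refine Finset.sum_le_sum fun i _ => ?_
        rw [hx]
        exact Φ.sq_inv_σ_mul_integral_le hl hh i ht
    _ ≤ _ := by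
        rw [← Finset.mul_sum]
        refine mul_le_mul_of_nonneg_left ?_ (by positivity)
        exact Φ.sum_integral_inner_sq_le (by fun_prop) (fun s => (Real.exp_pos _).le) hh F ht

/-- A bound, summable over the modes, for the squared coefficients on `[0, T]`. -/
def coeffBound (v₀ : V) (h : ℝ → X) (T : ℝ) (i : ι) : ℝ :=
  2 * (⟪Φ.b i, v₀⟫_ℝ ^ 2 + 1 / (2 * γ) * (Real.exp (2 * γ * T) *
    ∫ s in (0 : ℝ)..T, ⟪Φ.e i, h s⟫_ℝ ^ 2))

theorem summable_coeffBound (v₀ : V) {h : ℝ → X} (hh : Continuous h) {T : ℝ} (hT : 0 ≤ T) :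
    Summable (Φ.coeffBound v₀ h T) :=
  ((hasSum_inner_hilbertBasis_sq Φ.b v₀).summable.add
    (((Φ.summable_integral_inner_sq hh hT).mul_left _).mul_left _)).mul_left 2

theorem integral_exp_mul_inner_sq_le {l : ℝ} (hl : 0 ≤ l) {h : ℝ → X} (hh : Continuous h)
    {T t : ℝ} (ht : t ∈ Icc 0 T) (i : ι) :
    ∫ s in (0 : ℝ)..t, Real.exp (l * (t - s)) * ⟪Φ.e i, h s⟫_ℝ ^ 2 ≤
      Real.exp (l * T) * ∫ s in (0 : ℝ)..T, ⟪Φ.e i, h s⟫_ℝ ^ 2 := by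
  calc _ ≤ ∫ s in (0 : ℝ)..t, Real.exp (l * T) * ⟪Φ.e i, h s⟫_ℝ ^ 2 := by
        refine intervalIntegral.integral_mono_on ht.1
          (Continuous.intervalIntegrable (by fun_prop) _ _)
          (Continuous.intervalIntegrable (by fun_prop) _ _) fun s hs => ?_
        refine mul_le_mul_of_nonneg_right (Real.exp_le_exp.2 ?_) (sq_nonneg _)
        exact mul_le_mul_of_nonneg_left (by linarith [hs.1, ht.2]) hl
    _ = Real.exp (l * T) * ∫ s in (0 : ℝ)..t, ⟪Φ.e i, h s⟫_ℝ ^ 2 :=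
        intervalIntegral.integral_const_mul _ _
    _ ≤ _ := by
        refine mul_le_mul_of_nonneg_left ?_ (Real.exp_pos _).le
        exact intervalIntegral.integral_mono_interval le_rfl ht.1 ht.2
          (ae_of_all _ fun s => sq_nonneg _) (Continuous.intervalIntegrable (by fun_prop) _ _)

theorem coeff_sq_le (v₀ : V) {h : ℝ → X} (hh : Continuous h) {T t : ℝ} (ht : t ∈ Icc 0 T) (i : ι) :
    Φ.coeff v₀ h i t ^ 2 ≤ Φ.coeffBound v₀ h T i := by
  have hγ := Φ.γ_pos
  have hsource := (Φ.sq_inv_σ_mul_integral_le le_rfl hh i ht.1).trans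
    (mul_le_mul_of_nonneg_left (Φ.integral_exp_mul_inner_sq_le (by positivity) hh ht i)
      (by positivity))
  have hfree := Φ.exp_mul_sq_le ht.1 ⟪Φ.b i, v₀⟫_ℝ i
  rw [coeff, coeffBound, sub_eq_add_neg]
  refine add_sq_le.trans ?_
  rw [neg_sq]
  linarith

theorem exists_continuous_inner_eq_coeff (v₀ : V) {h : ℝ → X} (hh : Continuous h) :
    ∃ v : ℝ → V, Continuous v ∧ ∀ t, 0 ≤ t → ∀ i, ⟪Φ.b i, v t⟫_ℝ = Φ.coeff v₀ h i t := by
  have hex : ∀ t : ℝ, ∃ x : V, 0 ≤ t → ∀ i, ⟪Φ.b i, x⟫_ℝ = Φ.coeff v₀ h i t := by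
    intro t
    by_cases ht : 0 ≤ t
    · obtain ⟨x, hx⟩ := exists_forall_inner_hilbertBasis_eq Φ.b
        (Summable.of_nonneg_of_le (fun i => sq_nonneg _)
          (fun i => Φ.coeff_sq_le v₀ hh (right_mem_Icc.2 ht) i) (Φ.summable_coeffBound v₀ hh ht))
      exact ⟨x, fun _ => hx⟩
    · exact ⟨0, fun h => absurd h ht⟩
  choose v hv using hex
  have hcont : ContinuousOn v (Ici 0) := by
    intro t ht
    have hloc : ContinuousOn v (Icc 0 (t + 1)) := by
      refine continuousOn_of_inner_hilbertBasis Φ.b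
        (Φ.summable_coeffBound v₀ hh (T := t + 1) (by linarith [mem_Ici.1 ht]))
        (fun s hs i => ?_) fun i => ?_
      · rw [hv s hs.1]; exact Φ.coeff_sq_le v₀ hh hs i
      · exact (Φ.continuous_coeff v₀ hh i).continuousOn.congr fun s hs => hv s hs.1 i
    refine (hloc t ⟨ht, by linarith⟩).mono_of_mem_nhdsWithin ?_
    filter_upwards [self_mem_nhdsWithin, mem_nhdsWithin_of_mem_nhds (Iio_mem_nhds (lt_add_one t))]
      with s hs hs'
    exact ⟨hs, le_of_lt hs'⟩
  refine ⟨fun t => v (max t 0), ?_, fun t ht i => ?_⟩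
  · exact hcont.comp_continuous (by fun_prop) fun t => mem_Ici.2 (le_max_right _ _)
  · simp only [max_eq_left ht]
    exact hv t ht i

end LinearEquation

end DiagonalForm

/-- Lipschitz continuity on every bounded subset of a normed space. -/
def LipschitzOnBalls {E F : Type*} [SeminormedAddCommGroup E] [SeminormedAddCommGroup F]
    (N : E → F) : Prop :=
  ∀ R : ℝ, ∃ L : ℝ≥0, LipschitzOnWith L N (Metric.closedBall 0 R)

namespace LipschitzOnBalls

variable {E F : Type*} [SeminormedAddCommGroup E] [SeminormedAddCommGroup F] {N : E → F}

theorem continuous (hN : LipschitzOnBalls N) : Continuous N := by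
  refine continuous_iff_continuousAt.2 fun x => ?_
  obtain ⟨L, hL⟩ := hN (‖x‖ + 1)
  exact hL.continuousOn.continuousAt
    (Metric.closedBall_mem_nhds_of_mem (mem_ball_zero_iff.2 (lt_add_one _)))

theorem exists_norm_le (hN : LipschitzOnBalls N) (R : ℝ) : ∃ C, ∀ x, ‖x‖ ≤ R → ‖N x‖ ≤ C := by
  obtain ⟨L, hL⟩ := hN R
  refine ⟨‖N 0‖ + L * R, fun x hx => ?_⟩
  have hx0 := hL.norm_sub_le (mem_closedBall_zero_iff.2 hx)
    (Metric.mem_closedBall_self ((norm_nonneg x).trans hx))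
  rw [sub_zero] at hx0
  linarith [norm_sub_norm_le (N x) (N 0), mul_le_mul_of_nonneg_left hx L.coe_nonneg]

theorem exists_lipschitzWith_eqOn_closedBall [NormedSpace ℝ F] (hN : LipschitzOnBalls N) (R : ℝ) :
    ∃ (L : ℝ≥0) (N' : E → F), LipschitzWith L N' ∧ EqOn N' N (Metric.closedBall 0 R) := by
  obtain ⟨L, hL⟩ := hN (R + 1)
  obtain ⟨C, hC⟩ := hN.exists_norm_le (R + 1)
  set χ : E → ℝ := fun x => max 0 (min 1 (R + 1 - ‖x‖)) with hχ
  have hχ_in {x} (hx : ‖x‖ ≤ R) : χ x = 1 := by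
    simp only [hχ, min_eq_left (show 1 ≤ R + 1 - ‖x‖ by linarith), max_eq_right zero_le_one]
  have hχ_out {x} (hx : R + 1 < ‖x‖) : χ x = 0 :=
    max_eq_left ((min_le_right _ _).trans (by linarith))
  have hχ_nonneg (x) : 0 ≤ χ x := le_max_left _ _
  have hχ_le_one (x) : χ x ≤ 1 := max_le zero_le_one (min_le_left _ _)
  have hχ_lip (x y) : |χ x - χ y| ≤ ‖x - y‖ := by
    refine (abs_max_sub_max_le_max _ _ _ _).trans (max_le (by simp) ?_)
    refine (abs_min_sub_min_le_max _ _ _ _).trans (max_le (by simp) ?_)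
    rw [sub_sub_sub_cancel_left, abs_sub_comm]
    exact abs_norm_sub_norm_le x y
  have hprod (x y) (hyx : ‖y‖ ≤ ‖x‖) : ‖χ x • N x - χ y • N y‖ ≤ (L + |C|) * ‖x - y‖ := by
    rcases lt_or_ge (R + 1) ‖y‖ with hy | hy
    · rw [hχ_out hy, hχ_out (hy.trans_le hyx), zero_smul, zero_smul, sub_zero, norm_zero]
      positivity
    have hfirst : ‖χ x • (N x - N y)‖ ≤ L * ‖x - y‖ := by
      rcases lt_or_ge (R + 1) ‖x‖ with hx | hx
      · rw [hχ_out hx, zero_smul, norm_zero]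
        positivity
      · rw [norm_smul, Real.norm_of_nonneg (hχ_nonneg x)]
        exact (mul_le_of_le_one_left (norm_nonneg _) (hχ_le_one x)).trans
          (hL.norm_sub_le (mem_closedBall_zero_iff.2 hx) (mem_closedBall_zero_iff.2 hy))
    have hsecond : ‖(χ x - χ y) • N y‖ ≤ |C| * ‖x - y‖ := by
      rw [norm_smul, Real.norm_eq_abs, mul_comm]
      exact mul_le_mul ((hC y hy).trans (le_abs_self C)) (hχ_lip x y) (abs_nonneg _) (abs_nonneg _)
    calc ‖χ x • N x - χ y • N y‖ = ‖χ x • (N x - N y) + (χ x - χ y) • N y‖ := by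
          rw [sub_smul, smul_sub, sub_add_sub_cancel]
      _ ≤ _ := (norm_add_le _ _).trans (by linarith)
  refine ⟨L + ‖C‖₊, fun x => χ x • N x, LipschitzWith.of_dist_le_mul fun x y => ?_, fun x hx => ?_⟩
  · rw [dist_eq_norm, dist_eq_norm]
    rcases le_total ‖y‖ ‖x‖ with h | h
    · exact hprod x y h
    · rw [norm_sub_rev, norm_sub_rev x]
      exact hprod y x h
  · simp only [hχ_in (mem_closedBall_zero_iff.1 hx), one_smul]

end LipschitzOnBalls

open scoped BoundedContinuousFunction in
theorem norm_comp_exp_smul_sub_le {V X : Type*} [NormedAddCommGroup V]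
    [NormedSpace ℝ V] [SeminormedAddCommGroup X] {N : V → X} {L : ℝ≥0} (hN : LipschitzWith L N)
    {l : ℝ} (y y' : ℝ≥0 →ᵇ V) (s : ℝ) :
    ‖N (Real.exp (l * s) • y s.toNNReal) - N (Real.exp (l * s) • y' s.toNNReal)‖ ≤
      L * dist y y' * Real.exp (l * s) := by
  refine (hN.norm_sub_le _ _).trans ?_
  rw [← smul_sub, norm_smul, Real.norm_of_nonneg (Real.exp_pos _).le, mul_assoc,
    mul_comm (dist y y'), ← dist_eq_norm]
  gcongr
  exact BoundedContinuousFunction.dist_coe_le_dist _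

namespace DiagonalForm

variable (Φ : DiagonalForm ι j γ)

section WeightedEstimates

variable {v₀ : V} {h h' : ℝ → X} {l t : ℝ} {x x' : V}

theorem norm_sub_sq_le (hl : 2 * γ ≤ l) (hh : Continuous h) (hh' : Continuous h') (ht : 0 ≤ t)
    (hx : ∀ i, ⟪Φ.b i, x⟫_ℝ = Φ.coeff v₀ h i t) (hx' : ∀ i, ⟪Φ.b i, x'⟫_ℝ = Φ.coeff v₀ h' i t) :
    ‖x - x'‖ ^ 2 ≤ 1 / (2 * γ) * ∫ s in (0 : ℝ)..t, Real.exp (l * (t - s)) * ‖h s - h' s‖ ^ 2 := by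
  have hrev := Φ.norm_sq_le_of_inner_eq_integral hl (hh'.sub hh) ht (x := x - x') fun i => by
    rw [inner_sub_right, hx, hx', coeff, coeff, sub_sub_sub_cancel_left, ← mul_sub,
      ← intervalIntegral.integral_sub (Continuous.intervalIntegrable (by fun_prop) _ _)
        (Continuous.intervalIntegrable (by fun_prop) _ _)]
    simp only [Pi.sub_apply, inner_sub_right, mul_sub]
  simpa only [Pi.sub_apply, norm_sub_rev] using hrev

theorem norm_sub_le_mul_exp (hl : 2 * γ ≤ l) (hh : Continuous h) (hh' : Continuous h')
    (ht : 0 ≤ t) (hx : ∀ i, ⟪Φ.b i, x⟫_ℝ = Φ.coeff v₀ h i t)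
    (hx' : ∀ i, ⟪Φ.b i, x'⟫_ℝ = Φ.coeff v₀ h' i t) {C D : ℝ}
    (hC : ∀ s ∈ Icc 0 t, ‖h s - h' s‖ ≤ C * Real.exp (l * s)) (hD : 0 ≤ D)
    (hCD : C ^ 2 ≤ 2 * γ * l * D ^ 2) : ‖x - x'‖ ≤ D * Real.exp (l * t) := by
  have hγ := Φ.γ_pos
  have hl0 : 0 < l := by linarith
  have hpoint : ∀ s ∈ Icc 0 t, Real.exp (l * (t - s)) * ‖h s - h' s‖ ^ 2 ≤
      C ^ 2 * Real.exp (l * t) ^ 2 * Real.exp (-(l * (t - s))) := fun s hs => by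
    calc Real.exp (l * (t - s)) * ‖h s - h' s‖ ^ 2
        ≤ Real.exp (l * (t - s)) * (C * Real.exp (l * s)) ^ 2 := by
          gcongr
          exact hC s hs
      _ = C ^ 2 * Real.exp (l * t) ^ 2 * Real.exp (-(l * (t - s))) := by
          rw [mul_pow, mul_left_comm, mul_assoc, ← Real.exp_nat_mul, ← Real.exp_nat_mul,
            ← Real.exp_add, ← Real.exp_add]
          congr 2
          push_cast
          ring
  have hint : ∫ s in (0 : ℝ)..t, Real.exp (l * (t - s)) * ‖h s - h' s‖ ^ 2 ≤
      C ^ 2 * Real.exp (l * t) ^ 2 * (1 / l) := by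
    refine (intervalIntegral.integral_mono_on ht (Continuous.intervalIntegrable (by fun_prop) _ _)
      (Continuous.intervalIntegrable (by fun_prop) _ _) hpoint).trans ?_
    rw [intervalIntegral.integral_const_mul]
    exact mul_le_mul_of_nonneg_left (integral_exp_neg_mul_sub_le hl0 t) (by positivity)
  refine le_of_sq_le_sq ?_ (by positivity)
  calc ‖x - x'‖ ^ 2 ≤ 1 / (2 * γ) * (C ^ 2 * Real.exp (l * t) ^ 2 * (1 / l)) :=
        (Φ.norm_sub_sq_le hl hh hh' ht hx hx').trans
          (mul_le_mul_of_nonneg_left hint (by positivity))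
    _ = C ^ 2 / (2 * γ * l) * Real.exp (l * t) ^ 2 := by field_simp
    _ ≤ D ^ 2 * Real.exp (l * t) ^ 2 := by
        refine mul_le_mul_of_nonneg_right ?_ (sq_nonneg _)
        rwa [div_le_iff₀' (by positivity)]
    _ = (D * Real.exp (l * t)) ^ 2 := (mul_pow _ _ _).symm

theorem norm_le_of_inner_eq_coeff_zero (ht : 0 ≤ t)
    (hx : ∀ i, ⟪Φ.b i, x⟫_ℝ = Φ.coeff v₀ (fun _ => 0) i t) : ‖x‖ ≤ ‖v₀‖ := by
  refine norm_le_of_inner_hilbertBasis_sq_le Φ.b Φ.b fun i => ?_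
  rw [hx, coeff]
  simpa only [inner_zero_right, mul_zero, intervalIntegral.integral_zero, sub_zero] using
    Φ.exp_mul_sq_le ht ⟪Φ.b i, v₀⟫_ℝ i

end WeightedEstimates

/-- `v` is a mild solution on `[0, T]` of `∂ₜ (j v) + A (j v) + N v = 0`, `v 0 = v₀`, stated through
the coordinates in the basis `b` of `V`. -/
structure IsMild (N : V → X) (v₀ : V) (T : ℝ) (v : ℝ → V) : Prop where
  continuous : Continuous v
  inner_eq : ∀ t ∈ Icc 0 T, ∀ i, ⟪Φ.b i, v t⟫_ℝ = Φ.coeff v₀ (fun s => N (v s)) i t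

variable {Φ} {N : V → X} {v₀ : V} {T : ℝ} {v : ℝ → V}

namespace IsMild

theorem apply_zero (h : Φ.IsMild N v₀ T v) (hT : 0 ≤ T) : v 0 = v₀ :=
  eq_of_forall_inner_hilbertBasis_eq Φ.b fun i => by
    rw [h.inner_eq 0 (left_mem_Icc.2 hT), coeff_zero]

theorem eqOn (hN : LipschitzOnBalls N) {v' : ℝ → V} (h : Φ.IsMild N v₀ T v)
    (h' : Φ.IsMild N v₀ T v') : EqOn v v' (Icc 0 T) := by
  have hγ := Φ.γ_pos
  obtain ⟨R, hR⟩ := isCompact_Icc.exists_bound_of_continuousOn (h.continuous.continuousOn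
    (s := Icc 0 T))
  obtain ⟨R', hR'⟩ := isCompact_Icc.exists_bound_of_continuousOn (h'.continuous.continuousOn
    (s := Icc 0 T))
  obtain ⟨L, hL⟩ := hN (max R R')
  have hlip : ∀ s ∈ Icc 0 T, ‖N (v s) - N (v' s)‖ ≤ L * ‖v s - v' s‖ := fun s hs =>
    hL.norm_sub_le (mem_closedBall_zero_iff.2 ((hR s hs).trans (le_max_left _ _)))
      (mem_closedBall_zero_iff.2 ((hR' s hs).trans (le_max_right _ _)))
  have hc : Continuous fun s => N (v s) := hN.continuous.comp h.continuous
  have hc' : Continuous fun s => N (v' s) := hN.continuous.comp h'.continuous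
  have hδ : Continuous fun s => ‖v s - v' s‖ ^ 2 := (h.continuous.sub h'.continuous).norm.pow 2
  have hgronwall : ∀ t ∈ Icc 0 T, ‖v t - v' t‖ ^ 2 ≤
      1 / (2 * γ) * (Real.exp (2 * γ * T) * L ^ 2) * ∫ s in (0 : ℝ)..t, ‖v s - v' s‖ ^ 2 := by
    intro t ht
    refine (Φ.norm_sub_sq_le le_rfl hc hc' ht.1 (h.inner_eq t ht) (h'.inner_eq t ht)).trans ?_
    rw [mul_assoc]
    refine mul_le_mul_of_nonneg_left ?_ (by positivity)
    rw [← intervalIntegral.integral_const_mul]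
    have hsource := Continuous.mul (f := fun s => Real.exp (2 * γ * (t - s))) (by fun_prop)
      ((hc.sub hc').norm.pow 2)
    refine intervalIntegral.integral_mono_on ht.1 (hsource.intervalIntegrable _ _)
      (Continuous.intervalIntegrable (by fun_prop) _ _) fun s hs => ?_
    rw [mul_assoc (Real.exp _), ← mul_pow]
    gcongr
    · linarith [hs.1, ht.2]
    · exact hlip s ⟨hs.1, hs.2.trans ht.2⟩
  intro t ht
  have hzero := eq_zero_of_le_mul_integral hδ (fun _ => sq_nonneg _) hgronwall t ht
  rwa [sq_eq_zero_iff, norm_eq_zero, sub_eq_zero] at hzero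

end IsMild

section Existence

open scoped BoundedContinuousFunction

variable {h h' : ℝ → X} {l C : ℝ}

theorem dist_le_of_inner_exp_smul_eq (hl : 2 * γ ≤ l) (hh : Continuous h) (hh' : Continuous h')
    {y y' : ℝ≥0 →ᵇ V} (hy : ∀ (t : ℝ≥0) i, ⟪Φ.b i, Real.exp (l * t) • y t⟫_ℝ = Φ.coeff v₀ h i t)
    (hy' : ∀ (t : ℝ≥0) i, ⟪Φ.b i, Real.exp (l * t) • y' t⟫_ℝ = Φ.coeff v₀ h' i t)
    (hC : ∀ s, 0 ≤ s → ‖h s - h' s‖ ≤ C * Real.exp (l * s)) {D : ℝ} (hD : 0 ≤ D)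
    (hCD : C ^ 2 ≤ 2 * γ * l * D ^ 2) : dist y y' ≤ D := by
  rw [BoundedContinuousFunction.dist_le hD]
  intro t
  have hweighted := Φ.norm_sub_le_mul_exp hl hh hh' t.coe_nonneg (hy t) (hy' t)
    (fun s hs => hC s hs.1) hD hCD
  rw [← smul_sub, norm_smul, Real.norm_of_nonneg (Real.exp_pos _).le, mul_comm] at hweighted
  rw [dist_eq_norm]
  exact le_of_mul_le_mul_right hweighted (Real.exp_pos _)

variable (Φ) in
theorem exists_boundedContinuousFunction (hl : 2 * γ ≤ l) (v₀ : V) (hh : Continuous h)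
    (hC : ∀ s, 0 ≤ s → ‖h s‖ ≤ C * Real.exp (l * s)) :
    ∃ y : ℝ≥0 →ᵇ V, ∀ (t : ℝ≥0) i, ⟪Φ.b i, Real.exp (l * t) • y t⟫_ℝ = Φ.coeff v₀ h i t := by
  have hγ := Φ.γ_pos
  obtain ⟨v, hv, hcoeff⟩ := Φ.exists_continuous_inner_eq_coeff v₀ hh
  obtain ⟨u, -, hfree⟩ := Φ.exists_continuous_inner_eq_coeff v₀ (continuous_const (y := (0 : X)))
  have hC0 : 0 ≤ C := by simpa using (norm_nonneg _).trans (hC 0 le_rfl)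
  have hbound (t : ℝ≥0) : ‖v t‖ ≤ (‖v₀‖ + C / (2 * γ)) * Real.exp (l * t) := by
    have hu := Φ.norm_le_of_inner_eq_coeff_zero t.coe_nonneg (hfree t t.coe_nonneg)
    have hvu := Φ.norm_sub_le_mul_exp hl hh continuous_const t.coe_nonneg (hcoeff t t.coe_nonneg)
      (hfree t t.coe_nonneg) (C := C) (D := C / (2 * γ))
      (fun s hs => by rw [sub_zero]; exact hC s hs.1) (by positivity) (by
        rw [div_pow, mul_div_assoc', le_div_iff₀ (by positivity)]
        nlinarith [mul_le_mul_of_nonneg_left hl (by positivity : 0 ≤ 2 * γ * C ^ 2)])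
    have hexp : 1 ≤ Real.exp (l * t) :=
      Real.one_le_exp (mul_nonneg (by linarith) t.coe_nonneg)
    calc ‖v t‖ ≤ ‖u t‖ + ‖v t - u t‖ := norm_le_norm_add_norm_sub' _ _
      _ ≤ ‖v₀‖ * Real.exp (l * t) + C / (2 * γ) * Real.exp (l * t) :=
          add_le_add (hu.trans (le_mul_of_one_le_right (norm_nonneg _) hexp)) hvu
      _ = _ := (add_mul _ _ _).symm
  refine ⟨BoundedContinuousFunction.ofNormedAddCommGroup (fun t => Real.exp (-(l * t)) • v t)
    (by fun_prop) (‖v₀‖ + C / (2 * γ)) fun t => ?_, fun t i => ?_⟩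
  · rw [norm_smul, Real.norm_of_nonneg (Real.exp_pos _).le, Real.exp_neg, inv_mul_le_iff₀'
      (Real.exp_pos _)]
    exact hbound t
  · rw [BoundedContinuousFunction.coe_ofNormedAddCommGroup, smul_smul, ← Real.exp_add,
      add_neg_cancel, Real.exp_zero, one_smul]
    exact hcoeff t t.coe_nonneg i

variable (Φ) in
theorem exists_isMild_of_lipschitzWith [CompleteSpace V] {L : ℝ≥0} (hN : LipschitzWith L N)
    (v₀ : V) : ∃ v : ℝ → V, ∀ T, Φ.IsMild N v₀ T v := by
  have hγ := Φ.γ_pos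
  set l : ℝ := 2 * γ + 2 * L ^ 2 / γ with hl_def
  have hl : 2 * γ ≤ l := le_add_of_nonneg_right (by positivity)
  have hLl : (L : ℝ) ^ 2 ≤ γ * l / 2 := by
    rw [hl_def, mul_add, mul_div_cancel₀ _ hγ.ne']
    nlinarith
  -- The unknown is `y t = exp (-l t) v t`, for which the Picard map is a contraction.
  let source (y : ℝ≥0 →ᵇ V) (s : ℝ) : X := N (Real.exp (l * s) • y s.toNNReal)
  have hsource (y) : Continuous (source y) := by
    have := hN.continuous
    fun_prop
  have hgrowth (y : ℝ≥0 →ᵇ V) (s : ℝ) (hs : 0 ≤ s) :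
      ‖source y s‖ ≤ (‖N 0‖ + L * dist y 0) * Real.exp (l * s) := by
    have hzero : source 0 s = N 0 := by
      simp only [source, BoundedContinuousFunction.coe_zero, Pi.zero_apply, smul_zero]
    have hexp : 1 ≤ Real.exp (l * s) := Real.one_le_exp (mul_nonneg (by linarith) hs)
    calc ‖source y s‖ ≤ ‖source 0 s‖ + ‖source y s - source 0 s‖ := norm_le_norm_add_norm_sub' _ _
      _ ≤ ‖N 0‖ * Real.exp (l * s) + L * dist y 0 * Real.exp (l * s) := by
          rw [hzero]
          exact add_le_add (le_mul_of_one_le_right (norm_nonneg _) hexp)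
            (hzero ▸ norm_comp_exp_smul_sub_le hN y 0 s)
      _ = _ := (add_mul _ _ _).symm
  choose Ψ hΨ using fun y => Φ.exists_boundedContinuousFunction hl v₀ (hsource y) (hgrowth y)
  have hcontr : ContractingWith (1 / 2) Ψ := by
    refine ⟨by norm_num, LipschitzWith.of_dist_le_mul fun y y' => ?_⟩
    refine dist_le_of_inner_exp_smul_eq hl (hsource y) (hsource y') (hΨ y) (hΨ y')
      (fun s _ => norm_comp_exp_smul_sub_le hN y y' s) (by positivity) ?_
    push_cast
    nlinarith [mul_le_mul_of_nonneg_right hLl (sq_nonneg (dist y y'))]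
  set y := ContractingWith.fixedPoint Ψ hcontr
  have hy : Ψ y = y := hcontr.fixedPoint_isFixedPt
  refine ⟨fun s => Real.exp (l * s) • y s.toNNReal, fun T => ⟨by fun_prop, fun t ht i => ?_⟩⟩
  simpa only [hy, Real.coe_toNNReal t ht.1] using hΨ y t.toNNReal i

end Existence

end DiagonalForm

theorem eventually_forall_lt_of_tendstoUniformlyOn {α κ E : Type*} [TopologicalSpace α]
    [SeminormedAddCommGroup E] {l : Filter κ} {u : κ → α → E} {v : α → E} {K : Set α}
    (hK : IsCompact K) (hu : TendstoUniformlyOn u v l K) (hv : Continuous v) {D : E → α → ℝ}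
    (hD : Continuous fun p : E × α => D p.1 p.2) {C : ℝ} (hC : ∀ a ∈ K, D (v a) a < C) :
    ∀ᶠ k in l, ∀ a ∈ K, D (u k a) a < C := by
  have hnear : ∀ᶠ d : E in 𝓝 0, ∀ a ∈ K, D (v a + d) a < C := by
    refine hK.eventually_forall_of_forall_eventually fun a ha => ?_
    have hcont : Continuous fun p : E × α => D (v p.2 + p.1) p.2 :=
      hD.comp (((hv.comp continuous_snd).add continuous_fst).prodMk continuous_snd)
    refine hcont.continuousAt.eventually_lt_const ?_
    simpa only [add_zero] using hC a ha
  obtain ⟨δ, hδ, hball⟩ := Metric.eventually_nhds_iff.1 hnear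
  filter_upwards [Metric.tendstoUniformlyOn_iff.1 hu δ hδ] with k hk a ha
  simpa only [add_sub_cancel] using hball (y := u k a - v a)
    (by rw [dist_zero_right, ← dist_eq_norm, dist_comm]; exact hk a ha) a ha

variable (j γ) in
/-- The bilinear form `γ (⟪x, y⟫ - ⟪j x, j y⟫)`, as a functional of `y`. -/
def dirichletForm (x : V) : V →L[ℝ] ℝ := γ • (innerSL ℝ x - (innerSL ℝ (j x)).comp j)

theorem dirichletForm_apply (x y : V) :
    dirichletForm j γ x y = γ * (⟪x, y⟫_ℝ - ⟪j x, j y⟫_ℝ) := rfl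

theorem continuous_dirichletForm_self : Continuous fun x => dirichletForm j γ x x := by
  simp only [dirichletForm_apply]
  fun_prop

theorem hasFDerivAt_dirichletForm_self (x : V) :
    HasFDerivAt (fun x => 1 / 2 * dirichletForm j γ x x) (dirichletForm j γ x) x := by
  have hV := (hasStrictFDerivAt_norm_sq x).hasFDerivAt
  have hX := ((hasStrictFDerivAt_norm_sq (j x)).hasFDerivAt.comp x j.hasFDerivAt)
  refine (((hV.sub hX).const_mul (γ / 2)).congr_fderiv ?_).congr_of_eventuallyEq ?_
  · ext y
    simp only [dirichletForm, ContinuousLinearMap.smul_comp, smul_apply, sub_apply,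
      coe_innerSL_apply, nsmul_eq_mul, Nat.cast_ofNat, ContinuousLinearMap.comp_apply, smul_eq_mul]
    ring
  · refine Eventually.of_forall fun y => ?_
    simp only [dirichletForm_apply, real_inner_self_eq_norm_sq, Pi.sub_apply, Function.comp_apply]
    ring

namespace DiagonalForm

variable (Φ : DiagonalForm ι j γ)

section Galerkin

theorem apply_b (i : ι) : j (Φ.b i) = Φ.σ i • Φ.e i := by
  classical
  refine eq_of_forall_inner_hilbertBasis_eq Φ.e fun k => ?_
  rw [Φ.inner_apply, inner_smul_right, orthonormal_iff_ite.1 Φ.b.orthonormal,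
    orthonormal_iff_ite.1 Φ.e.orthonormal]
  split_ifs with h
  · rw [h]
  · rw [mul_zero, mul_zero]

theorem norm_apply_le (Φ : DiagonalForm ι j γ) (x : V) : ‖j x‖ ≤ ‖x‖ := by
  refine norm_le_of_inner_hilbertBasis_sq_le Φ.e Φ.b fun i => ?_
  rw [Φ.inner_apply, mul_pow]
  exact mul_le_of_le_one_left (sq_nonneg _) (pow_le_one₀ (Φ.σ_pos i).le (Φ.σ_le_one i))

theorem dirichletForm_b (x : V) (i : ι) :
    dirichletForm j γ x (Φ.b i) = Φ.σ i ^ 2 * Φ.eig i * ⟪Φ.b i, x⟫_ℝ := by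
  have hσ := (Φ.σ_pos i).ne'
  rw [dirichletForm_apply, apply_b, inner_smul_right, real_inner_comm, real_inner_comm _ (j x),
    Φ.inner_apply, eig]
  field_simp

/-- The vector field on `span (b i)_{i ∈ F}` of the Galerkin approximation of
`∂ₜ (j v) + A (j v) + k = 0`. -/
def galerkinField (F : Finset ι) (k : X) (x : V) : V :=
  ∑ i ∈ F, -(Φ.eig i * ⟪Φ.b i, x⟫_ℝ + (Φ.σ i)⁻¹ * ⟪Φ.e i, k⟫_ℝ) • Φ.b i

theorem inner_apply_galerkinField (F : Finset ι) (k l : X) (x : V) :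
    ⟪l, j (Φ.galerkinField F k x)⟫_ℝ =
      -∑ i ∈ F, (Φ.σ i * Φ.eig i * ⟪Φ.b i, x⟫_ℝ + ⟪Φ.e i, k⟫_ℝ) * ⟪Φ.e i, l⟫_ℝ := by
  rw [galerkinField, map_sum, inner_sum, ← Finset.sum_neg_distrib]
  refine Finset.sum_congr rfl fun i _ => ?_
  have hσ := (Φ.σ_pos i).ne'
  rw [map_smul, apply_b, inner_smul_right, inner_smul_right, real_inner_comm (Φ.e i) l]
  field_simp

theorem dirichletForm_add_inner_galerkinField_le (F : Finset ι) (k l : X) (x : V) :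
    dirichletForm j γ x (Φ.galerkinField F k x) + ⟪l, j (Φ.galerkinField F k x)⟫_ℝ ≤
      1 / 4 * ‖l - k‖ ^ 2 := by
  have hform : dirichletForm j γ x (Φ.galerkinField F k x) =
      -∑ i ∈ F, (Φ.σ i * Φ.eig i * ⟪Φ.b i, x⟫_ℝ + ⟪Φ.e i, k⟫_ℝ) *
        (Φ.σ i * Φ.eig i * ⟪Φ.b i, x⟫_ℝ) := by
    rw [galerkinField, map_sum, ← Finset.sum_neg_distrib]
    refine Finset.sum_congr rfl fun i _ => ?_
    have hσ := (Φ.σ_pos i).ne'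
    rw [map_smul, dirichletForm_b, smul_eq_mul]
    field_simp
  have hbessel := sum_inner_hilbertBasis_sq_le Φ.e (l - k) F
  calc _ = ∑ i ∈ F, -((Φ.σ i * Φ.eig i * ⟪Φ.b i, x⟫_ℝ + ⟪Φ.e i, k⟫_ℝ) *
          (Φ.σ i * Φ.eig i * ⟪Φ.b i, x⟫_ℝ + ⟪Φ.e i, l⟫_ℝ)) := by
        rw [hform, inner_apply_galerkinField, ← neg_add, ← Finset.sum_add_distrib,
          ← Finset.sum_neg_distrib]
        simp only [mul_add]
    _ ≤ ∑ i ∈ F, 1 / 4 * ⟪Φ.e i, l - k⟫_ℝ ^ 2 := Finset.sum_le_sum fun i _ => by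
        rw [inner_sub_right]
        nlinarith [sq_nonneg (2 * (Φ.σ i * Φ.eig i * ⟪Φ.b i, x⟫_ℝ) +
          (⟪Φ.e i, k⟫_ℝ + ⟪Φ.e i, l⟫_ℝ))]
    _ ≤ 1 / 4 * ‖l - k‖ ^ 2 := by
        rw [← Finset.mul_sum]
        linarith

theorem inner_apply_galerkinField_self {F : Finset ι} {x : V}
    (hx : ∑ i ∈ F, ⟪Φ.b i, x⟫_ℝ • Φ.b i = x) (k : X) :
    ⟪j x, j (Φ.galerkinField F k x)⟫_ℝ = -(dirichletForm j γ x x + ⟪k, j x⟫_ℝ) := by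
  have hform : dirichletForm j γ x x = ∑ i ∈ F, Φ.σ i ^ 2 * Φ.eig i * ⟪Φ.b i, x⟫_ℝ ^ 2 := by
    conv_lhs => rw [← hx, map_sum, hx]
    refine Finset.sum_congr rfl fun i _ => ?_
    rw [map_smul, dirichletForm_b, smul_eq_mul]
    ring
  have hsource : ⟪k, j x⟫_ℝ = ∑ i ∈ F, Φ.σ i * ⟪Φ.b i, x⟫_ℝ * ⟪Φ.e i, k⟫_ℝ := by
    conv_lhs => rw [← hx, map_sum, inner_sum]
    refine Finset.sum_congr rfl fun i _ => ?_
    rw [map_smul, apply_b, inner_smul_right, inner_smul_right, real_inner_comm (Φ.e i) k]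
    ring
  rw [inner_apply_galerkinField, hform, hsource, ← Finset.sum_add_distrib]
  refine congrArg _ (Finset.sum_congr rfl fun i _ => ?_)
  rw [Φ.inner_apply]
  ring

variable {N : V → X} {v₀ : V} {T : ℝ} {v : ℝ → V}

/-- The truncation to the modes in `F` of the solution of `∂ₜ (j v) + A (j v) + h = 0`,
`v 0 = v₀`. -/
def galerkin (v₀ : V) (h : ℝ → X) (F : Finset ι) (t : ℝ) : V :=
  ∑ i ∈ F, Φ.coeff v₀ h i t • Φ.b i

theorem inner_galerkin {h : ℝ → X} {F : Finset ι} {t : ℝ} {i : ι} (hi : i ∈ F) :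
    ⟪Φ.b i, Φ.galerkin v₀ h F t⟫_ℝ = Φ.coeff v₀ h i t :=
  Φ.b.orthonormal.inner_right_sum _ hi

theorem sum_inner_galerkin (h : ℝ → X) (F : Finset ι) (t : ℝ) :
    ∑ i ∈ F, ⟪Φ.b i, Φ.galerkin v₀ h F t⟫_ℝ • Φ.b i = Φ.galerkin v₀ h F t :=
  Finset.sum_congr rfl fun _ hi => by rw [inner_galerkin Φ hi]

theorem hasDerivAt_galerkin {h : ℝ → X} (hh : Continuous h) (F : Finset ι) (t : ℝ) :
    HasDerivAt (Φ.galerkin v₀ h F) (Φ.galerkinField F (h t) (Φ.galerkin v₀ h F t)) t := by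
  refine (HasDerivAt.fun_sum fun i _ => (Φ.hasDerivAt_coeff v₀ hh i t).smul_const _).congr_deriv ?_
  exact Finset.sum_congr rfl fun i hi => by rw [inner_galerkin Φ hi]

variable {Φ} in
theorem IsMild.tendstoUniformlyOn_galerkin (hN : Continuous N) (h : Φ.IsMild N v₀ T v) :
    TendstoUniformlyOn (Φ.galerkin v₀ fun s => N (v s)) v atTop (Icc 0 T) := by
  have hh : Continuous fun s => N (v s) := hN.comp h.continuous
  rw [Metric.tendstoUniformlyOn_iff]
  intro ε hε
  rcases lt_or_ge T 0 with hT | hT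
  · exact Eventually.of_forall fun F t ht => absurd (ht.1.trans ht.2) hT.not_ge
  have hM := Φ.summable_coeffBound v₀ hh hT
  have htail := (hM.hasSum.const_sub (∑' i, Φ.coeffBound v₀ (fun s => N (v s)) T i))
  rw [sub_self] at htail
  filter_upwards [htail.eventually_lt_const (sq_pos_of_pos hε)] with F hF t ht
  have htrunc : Φ.galerkin v₀ (fun s => N (v s)) F t = ∑ i ∈ F, ⟪Φ.b i, v t⟫_ℝ • Φ.b i :=
    Finset.sum_congr rfl fun i _ => by rw [h.inner_eq t ht]
  rw [dist_eq_norm, htrunc]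
  refine lt_of_pow_lt_pow_left₀ 2 hε.le (lt_of_le_of_lt ?_ hF)
  exact norm_sub_sum_inner_hilbertBasis_sq_le Φ.b hM
    (fun i => by rw [h.inner_eq t ht]; exact Φ.coeff_sq_le v₀ hh ht i) F

variable {Φ} in
theorem IsMild.sub_le_of_galerkin (hN : Continuous N) (h : Φ.IsMild N v₀ T v) {G : V → ℝ}
    {G' : V → V →L[ℝ] ℝ} (hG : ∀ x, HasFDerivAt G (G' x) x) {D : V → V → ℝ}
    (hD : Continuous fun p : V × V => D p.1 p.2)
    (hGD : ∀ (F : Finset ι) x y, ∑ i ∈ F, ⟪Φ.b i, x⟫_ℝ • Φ.b i = x →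
      G' x (Φ.galerkinField F (N y) x) ≤ D x y) {s t C : ℝ} (hs : 0 ≤ s) (hst : s ≤ t)
    (ht : t ≤ T) (hC : ∀ τ ∈ Icc s t, D (v τ) (v τ) ≤ C) : G (v t) - G (v s) ≤ C * (t - s) := by
  have hh : Continuous fun s => N (v s) := hN.comp h.continuous
  have hsub : Icc s t ⊆ Icc 0 T := Icc_subset_Icc hs ht
  set u := Φ.galerkin v₀ fun s => N (v s)
  have hu : TendstoUniformlyOn u v atTop (Icc 0 T) := h.tendstoUniformlyOn_galerkin hN
  have hGu {τ : ℝ} (hτ : τ ∈ Icc s t) : Tendsto (fun F => G (u F τ)) atTop (𝓝 (G (v τ))) :=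
    (hG _).continuousAt.tendsto.comp (hu.tendsto_at (hsub hτ))
  have hlim : Tendsto (fun C' => C' * (t - s)) (𝓝[>] C) (𝓝 (C * (t - s))) :=
    (tendsto_nhdsWithin_of_tendsto_nhds tendsto_id).mul_const _
  refine ge_of_tendsto hlim (eventually_mem_nhdsWithin.mono fun C' hC' => ?_)
  refine le_of_tendsto ((hGu (right_mem_Icc.2 hst)).sub (hGu (left_mem_Icc.2 hst))) ?_
  have hclose := eventually_forall_lt_of_tendstoUniformlyOn (D := fun x τ => D x (v τ))
    isCompact_Icc (hu.mono hsub) h.continuous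
    (hD.comp (continuous_fst.prodMk (h.continuous.comp continuous_snd)))
    fun τ hτ => (hC τ hτ).trans_lt hC'
  filter_upwards [hclose] with F hF
  have hderiv (τ : ℝ) : HasDerivAt (fun τ => G (u F τ))
      (G' (u F τ) (Φ.galerkinField F (N (v τ)) (u F τ))) τ :=
    (hG _).comp_hasDerivAt τ (Φ.hasDerivAt_galerkin hh F τ)
  refine (convex_Icc s t).image_sub_le_mul_sub_of_deriv_le
    (fun τ _ => (hderiv τ).continuousAt.continuousWithinAt)
    (fun τ _ => (hderiv τ).differentiableAt.differentiableWithinAt) (fun τ hτ => ?_)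
    s (left_mem_Icc.2 hst) t (right_mem_Icc.2 hst) hst
  rw [(hderiv τ).deriv]
  exact (hGD F _ _ (Φ.sum_inner_galerkin _ F τ)).trans (hF τ (interior_subset hτ)).le

end Galerkin

end DiagonalForm

/-- The nonlinearity `N` is the gradient of `J` with respect to the pairing of `X` with `V` through
`j`, and it is dissipative relative to the form `dirichletForm j γ`. -/
structure DissipativeGradient (j : V →L[ℝ] X) (γ : ℝ) (N : V → X) (J : V → ℝ) : Prop where
  lipschitzOnBalls : LipschitzOnBalls N
  hasFDerivAt : ∀ x, HasFDerivAt J ((innerSL ℝ (N x)).comp j) x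
  dissipative : ∃ a > 0, ∃ b, ∀ x, a * ‖x‖ ^ 2 - b ≤ dirichletForm j γ x x + ⟪N x, j x⟫_ℝ

variable (j γ) in
/-- The Lyapunov functional of the gradient flow `∂ₜ (j v) + A (j v) + ∇J v = 0`. -/
def energy (J : V → ℝ) (x : V) : ℝ := 1 / 2 * dirichletForm j γ x x + J x

namespace DissipativeGradient

variable {N : V → X} {J : V → ℝ}

section Coercivity

theorem hasFDerivAt_energy (hN : DissipativeGradient j γ N J) (x : V) :
    HasFDerivAt (energy j γ J) (dirichletForm j γ x + (innerSL ℝ (N x)).comp j) x :=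
  (hasFDerivAt_dirichletForm_self x).add (hN.hasFDerivAt x)

theorem exists_abs_energy_le (hN : DissipativeGradient j γ N J) (R : ℝ) :
    ∃ C, ∀ x, ‖x‖ ≤ R → |energy j γ J x| ≤ C := by
  obtain ⟨B, hB⟩ := hN.lipschitzOnBalls.exists_norm_le R
  set K := |γ| * (R + ‖j‖ * R * ‖j‖) + B * ‖j‖
  have hderiv : ∀ x ∈ Metric.closedBall (0 : V) R,
      ‖dirichletForm j γ x + (innerSL ℝ (N x)).comp j‖ ≤ K := by
    intro x hx
    have hxR := mem_closedBall_zero_iff.1 hx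
    have hform : ‖dirichletForm j γ x‖ ≤ |γ| * (R + ‖j‖ * R * ‖j‖) := by
      rw [dirichletForm, norm_smul, Real.norm_eq_abs]
      refine mul_le_mul_of_nonneg_left ((norm_sub_le _ _).trans (add_le_add ?_ ?_)) (abs_nonneg _)
      · rwa [innerSL_apply_norm]
      · refine (ContinuousLinearMap.opNorm_comp_le _ _).trans ?_
        rw [innerSL_apply_norm]
        gcongr
        exact j.le_opNorm_of_le hxR
    refine (norm_add_le _ _).trans (add_le_add hform ?_)
    refine (ContinuousLinearMap.opNorm_comp_le _ _).trans ?_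
    rw [innerSL_apply_norm]
    exact mul_le_mul_of_nonneg_right (hB x hxR) (norm_nonneg _)
  refine ⟨|energy j γ J 0| + K * R, fun x hx => ?_⟩
  have hR : 0 ≤ R := (norm_nonneg x).trans hx
  have hK : 0 ≤ K := (norm_nonneg _).trans (hderiv 0 (Metric.mem_closedBall_self hR))
  have hmean := (convex_closedBall (0 : V) R).norm_image_sub_le_of_norm_hasFDerivWithin_le
    (fun y _ => (hN.hasFDerivAt_energy y).hasFDerivWithinAt) hderiv
    (Metric.mem_closedBall_self hR) (mem_closedBall_zero_iff.2 hx)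
  rw [sub_zero, Real.norm_eq_abs] at hmean
  linarith [abs_sub_abs_le_abs_sub (energy j γ J x) (energy j γ J 0),
    mul_le_mul_of_nonneg_left hx hK]

theorem le_deriv_energy_ray (hN : DissipativeGradient j γ N J) {a b : ℝ}
    (hdiss : ∀ x, a * ‖x‖ ^ 2 - b ≤ dirichletForm j γ x x + ⟪N x, j x⟫_ℝ) {w : V} (hw : ‖w‖ = 1)
    {ρ : ℝ} (hρ : 1 ≤ ρ) (hab : |b| + 1 ≤ a * ρ) :
    1 ≤ deriv (fun ρ : ℝ => energy j γ J (ρ • w)) ρ := by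
  have hline : HasDerivAt (fun ρ : ℝ => ρ • w) w ρ := by
    simpa only [one_smul] using (hasDerivAt_id' ρ).smul_const w
  have hderiv : HasDerivAt (fun ρ : ℝ => energy j γ J (ρ • w))
      (dirichletForm j γ (ρ • w) w + ⟪N (ρ • w), j w⟫_ℝ) ρ :=
    (hN.hasFDerivAt_energy _).comp_hasDerivAt ρ hline
  have hray := hdiss (ρ • w)
  rw [norm_smul, hw, mul_one, Real.norm_eq_abs, sq_abs, map_smul, map_smul, inner_smul_right,
    smul_eq_mul, ← mul_add] at hray
  rw [hderiv.deriv]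
  refine le_of_mul_le_mul_left (le_trans ?_ hray) (one_pos.trans_le hρ)
  nlinarith [le_abs_self b, abs_nonneg b]

theorem exists_norm_sub_le_energy (hN : DissipativeGradient j γ N J) :
    ∃ C, ∀ x, ‖x‖ - C ≤ energy j γ J x := by
  obtain ⟨a, ha, b, hdiss⟩ := hN.dissipative
  set ρ₀ := max 1 ((|b| + 1) / a)
  obtain ⟨C, hC⟩ := hN.exists_abs_energy_le ρ₀
  refine ⟨C + ρ₀, fun x => ?_⟩
  rcases le_or_gt ‖x‖ ρ₀ with hx | hx
  · linarith [(abs_le.1 (hC x hx)).1]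
  have hx0 : 0 < ‖x‖ := one_pos.trans_le (le_max_left _ _) |>.trans hx
  set w := ‖x‖⁻¹ • x
  have hw : ‖w‖ = 1 := by
    rw [norm_smul, norm_inv, norm_norm, inv_mul_cancel₀ hx0.ne']
  have hxw : ‖x‖ • w = x := smul_inv_smul₀ hx0.ne' x
  have hdiff : Differentiable ℝ fun ρ : ℝ => energy j γ J (ρ • w) := fun ρ =>
    (hN.hasFDerivAt_energy _).differentiableAt.comp ρ (by fun_prop)
  have hgrowth := (convex_Icc ρ₀ ‖x‖).mul_sub_le_image_sub_of_le_deriv (C := 1)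
    hdiff.continuous.continuousOn hdiff.differentiableOn
    (fun ρ hρ => hN.le_deriv_energy_ray hdiss hw
      ((le_max_left _ _).trans (interior_subset hρ).1)
      ((div_le_iff₀' ha).1 ((le_max_right _ _).trans (interior_subset hρ).1)))
    ρ₀ (left_mem_Icc.2 hx.le) ‖x‖ (right_mem_Icc.2 hx.le) hx.le
  rw [hxw, one_mul] at hgrowth
  have hstart := hC (ρ₀ • w) (by
    rw [norm_smul, hw, mul_one, Real.norm_of_nonneg (zero_le_one.trans (le_max_left _ _))])
  linarith [(abs_le.1 hstart).1]

theorem exists_norm_le_of_energy_le (hN : DissipativeGradient j γ N J) (M : ℝ) :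
    ∃ K, ∀ x y, ‖x‖ ≤ M → energy j γ J y ≤ energy j γ J x → ‖y‖ ≤ K := by
  obtain ⟨C, hC⟩ := hN.exists_norm_sub_le_energy
  obtain ⟨C', hC'⟩ := hN.exists_abs_energy_le M
  exact ⟨C' + C, fun x y hx hyx => by linarith [hC y, (abs_le.1 (hC' x hx)).2]⟩

end Coercivity

section EnergyDecay

variable {Φ : DiagonalForm ι j γ} {v₀ : V} {T s t : ℝ} {v : ℝ → V}

theorem energy_le (hN : DissipativeGradient j γ N J) (h : Φ.IsMild N v₀ T v) (hs : 0 ≤ s)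
    (hst : s ≤ t) (ht : t ≤ T) : energy j γ J (v t) ≤ energy j γ J (v s) := by
  have hNc := hN.lipschitzOnBalls.continuous
  have hdecay := h.sub_le_of_galerkin hNc hN.hasFDerivAt_energy
    (D := fun x y => 1 / 4 * ‖N x - N y‖ ^ 2) (by fun_prop)
    (fun F x y _ => Φ.dirichletForm_add_inner_galerkinField_le F (N y) (N x) x) hs hst ht
    (C := 0) fun τ _ => by rw [sub_self, norm_zero, zero_pow two_ne_zero, mul_zero]
  linarith

theorem norm_sq_sub_norm_sq_le (hN : Continuous N) (h : Φ.IsMild N v₀ T v) (hT : 0 ≤ T) {c : ℝ}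
    (hc : ∀ t ∈ Icc 0 T, c ≤ dirichletForm j γ (v t) (v t) + ⟪N (v t), j (v t)⟫_ℝ) :
    1 / 2 * ‖j (v T)‖ ^ 2 - 1 / 2 * ‖j v₀‖ ^ 2 ≤ -c * T := by
  have hG (x : V) : HasFDerivAt (fun x => 1 / 2 * ‖j x‖ ^ 2) ((innerSL ℝ (j x)).comp j) x := by
    refine (((hasStrictFDerivAt_norm_sq (j x)).hasFDerivAt.comp x j.hasFDerivAt).const_mul
      (1 / 2)).congr_fderiv ?_
    rw [ContinuousLinearMap.smul_comp, ← Nat.cast_smul_eq_nsmul ℝ, smul_smul]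
    norm_num
  have hdecay := h.sub_le_of_galerkin hN hG
    (D := fun x y => -(dirichletForm j γ x x + ⟪N y, j x⟫_ℝ))
    ((continuous_dirichletForm_self.comp continuous_fst).add
      ((hN.comp continuous_snd).inner (j.continuous.comp continuous_fst))).neg
    (fun F x y hx => (Φ.inner_apply_galerkinField_self hx (N y)).le) le_rfl hT le_rfl
    fun t ht => neg_le_neg (hc t ht)
  rwa [h.apply_zero hT, sub_zero] at hdecay

theorem exists_isMild [CompleteSpace V] (hN : DissipativeGradient j γ N J)
    (Φ : DiagonalForm ι j γ) (v₀ : V) : ∃ v, ∀ T, Φ.IsMild N v₀ T v := by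
  obtain ⟨K, hK⟩ := hN.exists_norm_le_of_energy_le ‖v₀‖
  obtain ⟨L, N', hN', hNN'⟩ := hN.lipschitzOnBalls.exists_lipschitzWith_eqOn_closedBall (K + 1)
  obtain ⟨v, hv⟩ := Φ.exists_isMild_of_lipschitzWith hN' v₀
  have hsame {T : ℝ} (hbound : ∀ t ∈ Icc 0 T, ‖v t‖ ≤ K + 1) : Φ.IsMild N v₀ T v := by
    refine ⟨(hv 0).continuous, fun t ht i => ?_⟩
    rw [(hv T).inner_eq t ht i]
    exact Φ.coeff_congr v₀ i ht.1 fun s hs =>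
      hNN' (mem_closedBall_zero_iff.2 (hbound s ⟨hs.1, hs.2.trans ht.2⟩))
  have hapriori : ∀ t, 0 ≤ t → ‖v t‖ ≤ K := fun t ht => by
    have h0 := (hv 0).apply_zero le_rfl
    refine forall_le_of_bootstrap (hv 0).continuous.norm (lt_add_one K)
      (hK v₀ _ le_rfl (h0 ▸ le_rfl)) (fun T hT hbound => hK v₀ _ le_rfl ?_) ht
    exact h0 ▸ hN.energy_le (hsame hbound) le_rfl hT le_rfl
  exact ⟨v, fun T => hsame fun t ht => (hapriori t ht.1).trans (lt_add_one K).le⟩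

theorem exists_norm_le (hN : DissipativeGradient j γ N J) (Φ : DiagonalForm ι j γ) (M : ℝ) :
    ∃ K, ∀ v₀ v, ‖v₀‖ ≤ M → (∀ T, Φ.IsMild N v₀ T v) → ∀ t, 0 ≤ t → ‖v t‖ ≤ K := by
  obtain ⟨K, hK⟩ := hN.exists_norm_le_of_energy_le M
  refine ⟨K, fun v₀ v hv₀ hv t ht => hK v₀ _ hv₀ ?_⟩
  exact (hv 0).apply_zero le_rfl ▸ hN.energy_le (hv t) le_rfl ht le_rfl

theorem exists_absorbing (hN : DissipativeGradient j γ N J) (Φ : DiagonalForm ι j γ) :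
    ∃ R, ∀ M, ∃ t₀, 0 ≤ t₀ ∧ ∀ v₀ v, ‖v₀‖ ≤ M → (∀ T, Φ.IsMild N v₀ T v) →
      ∀ t, t₀ ≤ t → ‖v t‖ ≤ R := by
  obtain ⟨a, ha, b, hdiss⟩ := hN.dissipative
  obtain ⟨R, hR⟩ := hN.exists_norm_le_of_energy_le √((b + 1) / a)
  refine ⟨R, fun M => ⟨M ^ 2 / 2 + 1, by positivity, fun v₀ v hv₀ hv t ht => ?_⟩⟩
  set T := M ^ 2 / 2 + 1 with hT_def
  have hT : 0 ≤ T := by positivity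
  obtain ⟨s, hs, hsmall⟩ : ∃ s ∈ Icc 0 T, a * ‖v s‖ ^ 2 - b ≤ 1 := by
    by_contra! hlarge
    have hdecay := norm_sq_sub_norm_sq_le hN.lipschitzOnBalls.continuous (hv T) hT (c := 1)
      fun t ht => (hlarge t ht).le.trans (hdiss _)
    have hjv₀ : ‖j v₀‖ ^ 2 ≤ M ^ 2 :=
      pow_le_pow_left₀ (norm_nonneg _) ((Φ.norm_apply_le v₀).trans hv₀) 2
    linarith [sq_nonneg ‖j (v T)‖]
  refine hR (v s) (v t) ?_ (hN.energy_le (hv t) hs.1 (hs.2.trans ht) le_rfl)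
  refine Real.le_sqrt_of_sq_le ?_
  rw [le_div_iff₀' ha]
  linarith

end EnergyDecay

end DissipativeGradient

end GradientFlow

/-! ### The fractional Sobolev space -/

section SquareIntegrals

variable {Y E : Type*} [MeasurableSpace Y] [NormedAddCommGroup E] {μ : Measure Y}

theorem eLpNorm_two_sq (μ : Measure Y) (f : Y → E) : eLpNorm f 2 μ ^ 2 = ∫⁻ y, ‖f y‖ₑ ^ 2 ∂μ :=
  by simpa only [NNReal.coe_ofNat, ENNReal.rpow_ofNat, ENNReal.coe_ofNat] using
    eLpNorm_nnreal_pow_eq_lintegral (μ := μ) (f := f) (p := 2) two_ne_zero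

theorem memLp_two_of_lintegral_lt_top {f : Y → E} (hf : AEStronglyMeasurable f μ)
    (h : ∫⁻ y, ‖f y‖ₑ ^ 2 ∂μ < ⊤) : MemLp f 2 μ :=
  ⟨hf, (ENNReal.pow_lt_top_iff.1 (eLpNorm_two_sq μ f ▸ h)).resolve_right two_ne_zero⟩

theorem sq_lintegral_le {f : Y → ℝ≥0∞} (hf : AEMeasurable f μ) :
    (∫⁻ y, f y ∂μ) ^ 2 ≤ μ univ * ∫⁻ y, f y ^ 2 ∂μ := by
  have h := ENNReal.lintegral_mul_le_Lp_mul_Lq μ Real.HolderConjugate.two_two hf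
    (aemeasurable_const (b := (1 : ℝ≥0∞)))
  simp only [Pi.mul_apply, mul_one, ENNReal.one_rpow, lintegral_const, one_mul, one_div] at h
  calc (∫⁻ y, f y ∂μ) ^ 2
      ≤ ((∫⁻ y, f y ^ (2 : ℝ) ∂μ) ^ (2⁻¹ : ℝ) * μ univ ^ (2⁻¹ : ℝ)) ^ 2 := pow_le_pow_left' h 2
    _ = μ univ * ∫⁻ y, f y ^ 2 ∂μ := by
      have hroot (x : ℝ≥0∞) : (x ^ (2⁻¹ : ℝ)) ^ 2 = x :=
        mod_cast ENNReal.rpow_inv_natCast_pow (n := 2) two_ne_zero x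
      rw [mul_pow, hroot, hroot, mul_comm]
      simp only [ENNReal.rpow_ofNat]

theorem norm_sq_le_toReal {x : E} {c : ℝ≥0∞} (hc : c ≠ ⊤) (h : ‖x‖ₑ ^ 2 ≤ c) :
    ‖x‖ ^ 2 ≤ c.toReal := by
  rwa [← toReal_enorm, ← ENNReal.toReal_pow, ENNReal.toReal_le_toReal
    (ENNReal.pow_ne_top enorm_ne_top) hc]

theorem enorm_sq_eq_ofReal (x : ℝ) : ‖x‖ₑ ^ 2 = ENNReal.ofReal (x ^ 2) := by
  rw [← enorm_pow, Real.enorm_of_nonneg (sq_nonneg x)]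

end SquareIntegrals

section ZeroExtension

theorem measurableSet_Omega : MeasurableSet Omega := measurableSet_Ioo

instance : IsFiniteMeasure (volume.restrict Omega) := by
  rw [Omega]
  infer_instance

theorem measurable_zeroExt (u : L2Omega) : Measurable (zeroExt u) :=
  (Lp.stronglyMeasurable u).measurable.indicator measurableSet_Omega

theorem integrable_zeroExt (u : L2Omega) : Integrable (zeroExt u) :=
  (integrable_indicator_iff measurableSet_Omega).2 ((Lp.memLp u).integrable one_le_two)

theorem support_zeroExt_subset (u : L2Omega) : Function.support (zeroExt u) ⊆ Omega :=
  support_indicator_subset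

theorem zeroExt_ae_eq {u : L2Omega} {w : ℝ → ℝ} (h : u =ᵐ[volume.restrict Omega] w)
    (hw : Function.support w ⊆ Omega) : zeroExt u =ᵐ[volume] w :=
  ((ae_eq_restrict_iff_indicator_ae_eq measurableSet_Omega).1 h).trans
    (indicator_eq_self.2 hw).eventuallyEq

theorem zeroExt_add (u v : L2Omega) : zeroExt (u + v) =ᵐ[volume] zeroExt u + zeroExt v :=
  ((ae_eq_restrict_iff_indicator_ae_eq measurableSet_Omega).1 (Lp.coeFn_add u v)).trans
    (indicator_add' _ _ _).eventuallyEq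

theorem zeroExt_sub (u v : L2Omega) : zeroExt (u - v) =ᵐ[volume] zeroExt u - zeroExt v :=
  ((ae_eq_restrict_iff_indicator_ae_eq measurableSet_Omega).1 (Lp.coeFn_sub u v)).trans
    (indicator_sub' _ _ _).eventuallyEq

theorem zeroExt_smul (c : ℝ) (u : L2Omega) : zeroExt (c • u) =ᵐ[volume] c • zeroExt u :=
  ((ae_eq_restrict_iff_indicator_ae_eq measurableSet_Omega).1 (Lp.coeFn_smul c u)).trans
    (indicator_const_smul Omega c u).eventuallyEq

theorem zeroExt_zero : zeroExt 0 =ᵐ[volume] 0 :=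
  ((ae_eq_restrict_iff_indicator_ae_eq measurableSet_Omega).1 (Lp.coeFn_zero ℝ 2 _)).trans
    (indicator_zero' _).eventuallyEq

theorem lintegral_enorm_zeroExt_sq (u : L2Omega) : ∫⁻ x, ‖zeroExt u x‖ₑ ^ 2 = ‖u‖ₑ ^ 2 := by
  rw [← eLpNorm_two_sq, zeroExt, eLpNorm_indicator_eq_eLpNorm_restrict measurableSet_Omega,
    Lp.enorm_def]

theorem enorm_sub_sq_of_zeroExt_ae_eq {u u' : L2Omega} {w w' : ℝ → ℝ}
    (h : zeroExt u =ᵐ[volume] w) (h' : zeroExt u' =ᵐ[volume] w') :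
    ‖u - u'‖ₑ ^ 2 = ∫⁻ x, ‖w x - w' x‖ₑ ^ 2 := by
  rw [← lintegral_enorm_zeroExt_sq]
  refine lintegral_congr_ae ?_
  filter_upwards [zeroExt_sub u u', h, h'] with x hx hw hw'
  rw [hx, Pi.sub_apply, hw, hw']

theorem inner_eq_integral_of_zeroExt_ae_eq (k : L2Omega) {u : L2Omega} {w : ℝ → ℝ}
    (h : zeroExt u =ᵐ[volume] w) : ⟪k, u⟫_ℝ = ∫ x in Omega, k x * w x := by
  rw [L2.inner_def]
  refine integral_congr_ae ?_
  filter_upwards [ae_restrict_of_ae h, ae_restrict_mem measurableSet_Omega] with x hx hmem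
  rw [← hx, zeroExt, indicator_of_mem hmem]
  exact mul_comm _ _

end ZeroExtension

section DifferenceQuotient

variable {α : ℝ} {u v : ℝ → ℝ}

/-- The weighted difference `(u x - u y) / |x - y| ^ ((1 + α) / 2)`, whose `L²` norm over the plane
is the Gagliardo seminorm of order `α / 2`. The diagonal is irrelevant, since there the difference
vanishes. -/
def diffQuot (α : ℝ) (u : ℝ → ℝ) (p : ℝ × ℝ) : ℝ :=
  (u p.1 - u p.2) * |p.1 - p.2| ^ (-((1 + α) / 2))

/-- The squared Gagliardo seminorm of order `α / 2` of a function on the line. -/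
def lineGagliardoSq (α : ℝ) (u : ℝ → ℝ) : ℝ≥0∞ := ∫⁻ p : ℝ × ℝ, ‖diffQuot α u p‖ₑ ^ 2

theorem measurable_diffQuot (hu : Measurable u) : Measurable (diffQuot α u) := by
  unfold diffQuot
  fun_prop

theorem diffQuot_congr (h : u =ᵐ[volume] v) : diffQuot α u =ᵐ[volume] diffQuot α v := by
  filter_upwards [(Measure.quasiMeasurePreserving_fst (μ := volume) (ν := volume)).ae_eq_comp h,
    (Measure.quasiMeasurePreserving_snd (μ := volume) (ν := volume)).ae_eq_comp h] with p hp₁ hp₂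
  rw [Function.comp_apply, Function.comp_apply] at hp₁ hp₂
  rw [diffQuot, diffQuot, hp₁, hp₂]

theorem lineGagliardoSq_congr (h : u =ᵐ[volume] v) : lineGagliardoSq α u = lineGagliardoSq α v :=
  lintegral_congr_ae <| (diffQuot_congr (α := α) h).mono fun p hp => by simp only [hp]

theorem diffQuot_mul_diffQuot (α : ℝ) (u v : ℝ → ℝ) (x y : ℝ) :
    diffQuot α u (x, y) * diffQuot α v (x, y) =
      (u x - u y) * (v x - v y) / |x - y| ^ (1 + α) := by
  rcases eq_or_ne x y with rfl | hxy
  · simp [diffQuot]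
  have hpos : 0 < |x - y| := abs_pos.2 (sub_ne_zero.2 hxy)
  simp only [diffQuot]
  rw [mul_mul_mul_comm, ← Real.rpow_add hpos, div_eq_mul_inv (_ * _), ← Real.rpow_neg hpos.le,
    ← neg_add, add_halves]

theorem enorm_diffQuot_sq (α : ℝ) (u : ℝ → ℝ) (x y : ℝ) :
    ‖diffQuot α u (x, y)‖ₑ ^ 2 = ENNReal.ofReal ((u x - u y) ^ 2 / |x - y| ^ (1 + α)) := by
  rw [enorm_sq_eq_ofReal, sq, diffQuot_mul_diffQuot, ← sq]

theorem lineGagliardoSq_eq_lintegral (hu : Measurable u) :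
    lineGagliardoSq α u = ∫⁻ x, ∫⁻ y, ‖diffQuot α u (x, y)‖ₑ ^ 2 := by
  rw [lineGagliardoSq, Measure.volume_eq_prod, lintegral_prod]
  exact ((measurable_diffQuot hu).enorm.pow_const 2).aemeasurable

theorem gagliardoSq_eq (α : ℝ) (u : L2Omega) :
    gagliardoSq α u = lineGagliardoSq α (zeroExt u) := by
  rw [lineGagliardoSq_eq_lintegral (measurable_zeroExt u), gagliardoSq]
  simp only [enorm_diffQuot_sq]

theorem mul_enorm_sq_le_lineGagliardoSq_zeroExt (hα : 0 ≤ 1 + α) (u : L2Omega) :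
    ENNReal.ofReal (Real.pi / (3 * Real.pi) ^ (1 + α)) * ‖u‖ₑ ^ 2 ≤
      lineGagliardoSq α (zeroExt u) := by
  have hπ := Real.pi_pos
  -- For `x ∈ Ω` the points `y ∈ [π, 2π)` lie at distance at most `3π`, and there `u y = 0`.
  have hkernel (x y : ℝ) (hy : y ∈ Ico Real.pi (2 * Real.pi)) :
      ENNReal.ofReal (1 / (3 * Real.pi) ^ (1 + α)) * ‖zeroExt u x‖ₑ ^ 2 ≤
        ‖diffQuot α (zeroExt u) (x, y)‖ₑ ^ 2 := by
    by_cases hx : x ∈ Omega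
    · have huy : zeroExt u y = 0 := indicator_of_notMem (fun h => h.2.not_ge hy.1) _
      have hdist : |x - y| ≤ 3 * Real.pi :=
        abs_le.2 ⟨by linarith [hx.1, hy.2], by linarith [hx.2, hy.1]⟩
      have hpos : 0 < |x - y| := abs_pos.2 (sub_neg.2 (hx.2.trans_le hy.1)).ne
      rw [enorm_diffQuot_sq, huy, sub_zero, enorm_sq_eq_ofReal,
        ← ENNReal.ofReal_mul (by positivity), one_div_mul_eq_div]
      gcongr
    · rw [zeroExt, indicator_of_notMem hx, enorm_zero, zero_pow two_ne_zero, mul_zero]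
      exact zero_le
  have hvolume : volume (Ico Real.pi (2 * Real.pi)) = ENNReal.ofReal Real.pi := by
    rw [Real.volume_Ico, two_mul, add_sub_cancel_right]
  rw [lineGagliardoSq_eq_lintegral (measurable_zeroExt u), ← lintegral_enorm_zeroExt_sq,
    ← lintegral_const_mul' _ _ ENNReal.ofReal_ne_top]
  refine lintegral_mono fun x => ?_
  calc ENNReal.ofReal (Real.pi / (3 * Real.pi) ^ (1 + α)) * ‖zeroExt u x‖ₑ ^ 2
      = ∫⁻ _ in Ico Real.pi (2 * Real.pi),
          ENNReal.ofReal (1 / (3 * Real.pi) ^ (1 + α)) * ‖zeroExt u x‖ₑ ^ 2 := by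
        rw [setLIntegral_const, hvolume, mul_right_comm, ← ENNReal.ofReal_mul (by positivity),
          one_div_mul_eq_div]
    _ ≤ ∫⁻ y in Ico Real.pi (2 * Real.pi), ‖diffQuot α (zeroExt u) (x, y)‖ₑ ^ 2 :=
        setLIntegral_mono' measurableSet_Ico (hkernel x)
    _ ≤ ∫⁻ y, ‖diffQuot α (zeroExt u) (x, y)‖ₑ ^ 2 := setLIntegral_le_lintegral _ _

end DifferenceQuotient

section SobolevSpace

/-- The space `H₀^{α/2}(Ω)`, encoded as the graph of the map `u ↦ diffQuot α (zeroExt u)` from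
`L²(Ω)` to `L²(ℝ²)`, so that it inherits its Hilbert space structure. -/
def H0Space (α : ℝ) : Submodule ℝ (WithLp 2 (L2Omega × Lp ℝ 2 (volume : Measure (ℝ × ℝ)))) where
  carrier := {p | p.snd =ᵐ[volume] diffQuot α (zeroExt p.fst)}
  add_mem' {p q} hp hq := by
    change (p + q).snd =ᵐ[volume] diffQuot α (zeroExt (p + q).fst)
    filter_upwards [Lp.coeFn_add p.snd q.snd, diffQuot_congr (zeroExt_add p.fst q.fst), hp, hq]
      with x hsnd hfst hpx hqx
    rw [WithLp.add_snd, WithLp.add_fst, hsnd, hfst, Pi.add_apply, hpx, hqx]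
    simp only [diffQuot, Pi.add_apply]
    ring
  zero_mem' := by
    filter_upwards [Lp.coeFn_zero ℝ 2 (volume : Measure (ℝ × ℝ)), diffQuot_congr zeroExt_zero]
      with x hsnd hfst
    rw [WithLp.zero_snd, WithLp.zero_fst, hsnd, hfst]
    simp only [diffQuot, Pi.zero_apply, sub_zero, zero_mul]
  smul_mem' c p hp := by
    change (c • p).snd =ᵐ[volume] diffQuot α (zeroExt (c • p).fst)
    filter_upwards [Lp.coeFn_smul c p.snd, diffQuot_congr (zeroExt_smul c p.fst), hp]
      with x hsnd hfst hpx
    rw [WithLp.smul_snd, WithLp.smul_fst, hsnd, hfst, Pi.smul_apply, hpx]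
    simp only [diffQuot, Pi.smul_apply, smul_eq_mul]
    ring

theorem isClosed_H0Space (α : ℝ) :
    IsClosed (H0Space α : Set (WithLp 2 (L2Omega × Lp ℝ 2 (volume : Measure (ℝ × ℝ))))) := by
  refine IsSeqClosed.isClosed fun p q hp hpq => ?_
  have hfst : Tendsto (fun n => (p n).fst) atTop (𝓝 q.fst) :=
    ((WithLp.fstL 2 ℝ _ _).continuous.tendsto q).comp hpq
  have hsnd : Tendsto (fun n => (p n).snd) atTop (𝓝 q.snd) :=
    ((WithLp.sndL 2 ℝ _ _).continuous.tendsto q).comp hpq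
  obtain ⟨a, ha, hfst_ae⟩ := (tendstoInMeasure_of_tendsto_Lp hfst).exists_seq_tendsto_ae
  obtain ⟨b, hb, hsnd_ae⟩ :=
    (tendstoInMeasure_of_tendsto_Lp (hsnd.comp ha.tendsto_atTop)).exists_seq_tendsto_ae
  have hext : ∀ᵐ x, Tendsto (fun n => zeroExt (p (a (b n))).fst x) atTop
      (𝓝 (zeroExt q.fst x)) := by
    filter_upwards [(ae_restrict_iff' measurableSet_Omega).1 hfst_ae] with x hx
    by_cases hmem : x ∈ Omega
    · simpa only [zeroExt, indicator_of_mem hmem] using! (hx hmem).comp hb.tendsto_atTop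
    · simpa only [zeroExt, indicator_of_notMem hmem] using tendsto_const_nhds
  change q.snd =ᵐ[volume] diffQuot α (zeroExt q.fst)
  filter_upwards [(Measure.quasiMeasurePreserving_fst (μ := volume) (ν := volume)).ae hext,
    (Measure.quasiMeasurePreserving_snd (μ := volume) (ν := volume)).ae hext, hsnd_ae,
    ae_all_iff.2 fun n => hp (a (b n))] with x hx₁ hx₂ hlim heq
  refine tendsto_nhds_unique hlim ?_
  simp only [Function.comp_apply, heq, diffQuot]
  exact (hx₁.sub hx₂).mul_const _

instance (α : ℝ) : CompleteSpace (H0Space α) := (isClosed_H0Space α).completeSpace_coe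

namespace H0Space

/-- The embedding of `H₀^{α/2}(Ω)` into `L²(Ω)`. -/
def incl (α : ℝ) : H0Space α →L[ℝ] L2Omega :=
  (WithLp.fstL 2 ℝ _ _).comp (H0Space α).subtypeL

/-- The map taking an element of `H₀^{α/2}(Ω)` to its weighted differences. -/
def diff (α : ℝ) : H0Space α →L[ℝ] Lp ℝ 2 (volume : Measure (ℝ × ℝ)) :=
  (WithLp.sndL 2 ℝ _ _).comp (H0Space α).subtypeL

variable {α : ℝ}

theorem diff_ae_eq (v : H0Space α) : diff α v =ᵐ[volume] diffQuot α (zeroExt (incl α v)) := v.2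

theorem norm_sq_eq (v : H0Space α) : ‖v‖ ^ 2 = ‖incl α v‖ ^ 2 + ‖diff α v‖ ^ 2 :=
  WithLp.prod_norm_sq_eq_of_L2 v.1

theorem inner_eq (v w : H0Space α) :
    ⟪v, w⟫_ℝ = ⟪incl α v, incl α w⟫_ℝ + ⟪diff α v, diff α w⟫_ℝ :=
  WithLp.prod_inner_apply v.1 w.1

theorem norm_incl_le (v : H0Space α) : ‖incl α v‖ ≤ ‖v‖ := by
  refine le_of_sq_le_sq ?_ (norm_nonneg _)
  rw [norm_sq_eq]
  exact le_add_of_nonneg_right (sq_nonneg _)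

theorem enorm_diff_sq (v : H0Space α) :
    ‖diff α v‖ₑ ^ 2 = lineGagliardoSq α (zeroExt (incl α v)) := by
  rw [Lp.enorm_def, eLpNorm_congr_ae (diff_ae_eq v), eLpNorm_two_sq, lineGagliardoSq]

theorem enorm_sq_eq (v : H0Space α) :
    ‖v‖ₑ ^ 2 = ‖incl α v‖ₑ ^ 2 + lineGagliardoSq α (zeroExt (incl α v)) := by
  rw [← enorm_diff_sq]
  simp only [← ofReal_norm]
  rw [← ENNReal.ofReal_pow (norm_nonneg _), ← ENNReal.ofReal_pow (norm_nonneg _),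
    ← ENNReal.ofReal_pow (norm_nonneg _), norm_sq_eq, ENNReal.ofReal_add (by positivity)
    (by positivity)]

theorem lineGagliardoSq_ne_top (v : H0Space α) : lineGagliardoSq α (zeroExt (incl α v)) ≠ ⊤ :=
  enorm_diff_sq v ▸ ENNReal.pow_ne_top enorm_ne_top

theorem eH0Norm_incl (v : H0Space α) : eH0Norm α (incl α v) = ‖v‖ₑ := by
  rw [eH0Norm, gagliardoSq_eq, ← enorm_sq_eq, one_div]
  exact_mod_cast ENNReal.pow_rpow_inv_natCast two_ne_zero ‖v‖ₑ

theorem incl_injective : Function.Injective (incl α) := by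
  refine (injective_iff_map_eq_zero _).2 fun v hv => ?_
  have hdiff : ‖diff α v‖ₑ ^ 2 = 0 := by
    rw [enorm_diff_sq, hv, lineGagliardoSq_congr zeroExt_zero, lineGagliardoSq]
    simp only [diffQuot, Pi.zero_apply, sub_zero, zero_mul, enorm_zero, zero_pow two_ne_zero,
      lintegral_zero]
  have hsq : ‖v‖ₑ ^ 2 = 0 := by
    rw [enorm_sq_eq, ← enorm_diff_sq, hdiff, hv, enorm_zero, zero_pow two_ne_zero, add_zero]
  exact enorm_eq_zero.1 ((pow_eq_zero_iff two_ne_zero).1 hsq)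

theorem exists_incl_eq {u : L2Omega} (hu : lineGagliardoSq α (zeroExt u) < ⊤) :
    ∃ v : H0Space α, incl α v = u := by
  have hmem : MemLp (diffQuot α (zeroExt u)) 2 (volume : Measure (ℝ × ℝ)) :=
    memLp_two_of_lintegral_lt_top
      (measurable_diffQuot (measurable_zeroExt u)).aestronglyMeasurable hu
  exact ⟨⟨WithLp.toLp 2 (u, hmem.toLp _), hmem.coeFn_toLp⟩, rfl⟩

theorem memH0_iff {u : L2Omega} : MemH0 α u ↔ ∃ v : H0Space α, incl α v = u := by
  refine ⟨fun h => exists_incl_eq ?_, ?_⟩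
  · rw [MemH0, eH0Norm, gagliardoSq_eq, ENNReal.rpow_lt_top_iff_of_pos one_half_pos] at h
    exact (ENNReal.add_lt_top.1 h).2
  · rintro ⟨v, rfl⟩
    rw [MemH0, eH0Norm_incl]
    exact enorm_lt_top

theorem exists_zeroExt_incl_ae_eq {w : ℝ → ℝ} (hm : Measurable w)
    (hsupp : Function.support w ⊆ Omega) (hsq : ∫⁻ x, ‖w x‖ₑ ^ 2 < ⊤)
    (hgag : lineGagliardoSq α w < ⊤) : ∃ v : H0Space α, zeroExt (incl α v) =ᵐ[volume] w := by
  have hmem : MemLp w 2 (volume.restrict Omega) :=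
    (memLp_two_of_lintegral_lt_top hm.aestronglyMeasurable hsq).restrict _
  have hext : zeroExt (hmem.toLp w) =ᵐ[volume] w := zeroExt_ae_eq hmem.coeFn_toLp hsupp
  obtain ⟨v, hv⟩ := exists_incl_eq (α := α) (u := hmem.toLp w)
    (by rwa [lineGagliardoSq_congr hext])
  exact ⟨v, by rwa [hv]⟩

theorem mul_norm_incl_sq_le (hα : 0 ≤ 1 + α) (v : H0Space α) :
    Real.pi / (3 * Real.pi) ^ (1 + α) * ‖incl α v‖ ^ 2 ≤ ‖diff α v‖ ^ 2 := by
  have h := mul_enorm_sq_le_lineGagliardoSq_zeroExt hα (incl α v)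
  have hπ := Real.pi_pos
  rw [← enorm_diff_sq, ← ofReal_norm, ← ofReal_norm, ← ENNReal.ofReal_pow (norm_nonneg _),
    ← ENNReal.ofReal_pow (norm_nonneg _), ← ENNReal.ofReal_mul (by positivity)] at h
  exact (ENNReal.ofReal_le_ofReal_iff (sq_nonneg _)).1 h

theorem norm_sq_le_mul_norm_diff_sq (hα : 0 ≤ 1 + α) (v : H0Space α) :
    ‖v‖ ^ 2 ≤ ((3 * Real.pi) ^ (1 + α) / Real.pi + 1) * ‖diff α v‖ ^ 2 := by
  have hpos : 0 < (3 * Real.pi) ^ (1 + α) := by positivity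
  have h := mul_norm_incl_sq_le hα v
  rw [div_mul_eq_mul_div, div_le_iff₀ hpos, mul_comm Real.pi, mul_comm (‖diff α v‖ ^ 2),
    ← le_div_iff₀ Real.pi_pos] at h
  rw [norm_sq_eq, add_one_mul, div_mul_eq_mul_div]
  gcongr

end H0Space

end SobolevSpace

section Compactness

variable {α : ℝ} {N : ℕ}

/-- The cell `[j / N, (j + 1) / N)` of the uniform partition of the line into intervals of length
`1 / N`. -/
def cell (N : ℕ) (j : ℤ) : Set ℝ := {y | ⌊(N : ℝ) * y⌋ = j}

theorem measurableSet_cell (N : ℕ) (j : ℤ) : MeasurableSet (cell N j) :=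
  (Int.measurable_floor.comp (measurable_const_mul (N : ℝ))) (measurableSet_singleton j)

theorem volume_cell (hN : 0 < N) (j : ℤ) : volume (cell N j) = ENNReal.ofReal (N : ℝ)⁻¹ := by
  have hN' : (0 : ℝ) < N := Nat.cast_pos.2 hN
  have hIco : cell N j = Ico (j / N : ℝ) ((j + 1) / N) := by
    ext y
    rw [cell, mem_ofPred_eq, Int.floor_eq_iff, mem_Ico, div_le_iff₀' hN', lt_div_iff₀' hN']
  rw [hIco, Real.volume_Ico, ← sub_div, add_sub_cancel_left, one_div]

theorem abs_sub_le_inv_of_mem_cell (hN : 0 < N) {x y : ℝ} (hy : y ∈ cell N ⌊(N : ℝ) * x⌋) :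
    |x - y| ≤ (N : ℝ)⁻¹ := by
  have hN' : (0 : ℝ) < N := Nat.cast_pos.2 hN
  have h := Int.abs_sub_lt_one_of_floor_eq_floor (hy : ⌊(N : ℝ) * y⌋ = ⌊(N : ℝ) * x⌋)
  rw [← mul_sub, abs_mul, abs_of_pos hN', abs_sub_comm] at h
  rw [← one_div, le_div_iff₀' hN']
  exact h.le

/-- The average of `u` over the cell containing `x`. -/
def cellAvg (N : ℕ) (u : ℝ → ℝ) (x : ℝ) : ℝ := N * ∫ y in cell N ⌊(N : ℝ) * x⌋, u y

theorem enorm_sub_sq_le_of_mem_cell (hα : 0 ≤ 1 + α) (hN : 0 < N) (u : ℝ → ℝ) {x y : ℝ}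
    (hy : y ∈ cell N ⌊(N : ℝ) * x⌋) :
    ‖u x - u y‖ₑ ^ 2 ≤ ENNReal.ofReal ((N : ℝ) ^ (-(1 + α))) * ‖diffQuot α u (x, y)‖ₑ ^ 2 := by
  rw [enorm_diffQuot_sq, ← ENNReal.ofReal_mul (by positivity), enorm_sq_eq_ofReal]
  refine ENNReal.ofReal_le_ofReal ?_
  rcases eq_or_ne x y with rfl | hxy
  · simp
  have hpos : 0 < |x - y| := abs_pos.2 (sub_ne_zero.2 hxy)
  have hrpow : |x - y| ^ (1 + α) ≤ (N : ℝ) ^ (-(1 + α)) := by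
    rw [Real.rpow_neg N.cast_nonneg, ← Real.inv_rpow N.cast_nonneg]
    exact Real.rpow_le_rpow hpos.le (abs_sub_le_inv_of_mem_cell hN hy) hα
  rw [← mul_div_assoc, le_div_iff₀ (by positivity), mul_comm]
  gcongr

theorem sub_cellAvg_eq (hN : 0 < N) {u : ℝ → ℝ} (hu : Integrable u) (x : ℝ) :
    u x - cellAvg N u x = N * ∫ y in cell N ⌊(N : ℝ) * x⌋, (u x - u y) := by
  have hN' : (N : ℝ) ≠ 0 := Nat.cast_ne_zero.2 hN.ne'
  have hvol : volume (cell N ⌊(N : ℝ) * x⌋) ≠ ⊤ := volume_cell hN _ ▸ ENNReal.ofReal_ne_top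
  have hconst : IntegrableOn (fun _ => u x) (cell N ⌊(N : ℝ) * x⌋) := integrableOn_const hvol
  rw [integral_sub hconst hu.integrableOn, setIntegral_const,
    Measure.real, volume_cell hN, ENNReal.toReal_ofReal (by positivity), smul_eq_mul, mul_sub,
    mul_inv_cancel_left₀ hN', cellAvg]

theorem enorm_sub_cellAvg_sq_le_setLIntegral (hN : 0 < N) {u : ℝ → ℝ} (hu : Integrable u) (x : ℝ) :
    ‖u x - cellAvg N u x‖ₑ ^ 2 ≤
      ENNReal.ofReal N * ∫⁻ y in cell N ⌊(N : ℝ) * x⌋, ‖u x - u y‖ₑ ^ 2 := by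
  have hN' : (0 : ℝ) < N := Nat.cast_pos.2 hN
  have hcancel : ENNReal.ofReal (N : ℝ) * ENNReal.ofReal (N : ℝ)⁻¹ = 1 := by
    rw [← ENNReal.ofReal_mul hN'.le, mul_inv_cancel₀ hN'.ne', ENNReal.ofReal_one]
  calc ‖u x - cellAvg N u x‖ₑ ^ 2
      ≤ (ENNReal.ofReal N * ∫⁻ y in cell N ⌊(N : ℝ) * x⌋, ‖u x - u y‖ₑ) ^ 2 := by
        rw [sub_cellAvg_eq hN hu, enorm_mul, Real.enorm_of_nonneg hN'.le]
        gcongr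
        exact enorm_integral_le_lintegral_enorm _
    _ ≤ ENNReal.ofReal N ^ 2 * (ENNReal.ofReal (N : ℝ)⁻¹ *
          ∫⁻ y in cell N ⌊(N : ℝ) * x⌋, ‖u x - u y‖ₑ ^ 2) := by
        rw [mul_pow, ← volume_cell hN ⌊(N : ℝ) * x⌋, ← Measure.restrict_apply_univ (cell N _)]
        gcongr
        exact sq_lintegral_le (hu.aestronglyMeasurable.restrict.aemeasurable.const_sub _).enorm
    _ = ENNReal.ofReal N * ∫⁻ y in cell N ⌊(N : ℝ) * x⌋, ‖u x - u y‖ₑ ^ 2 := by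
        rw [sq, ← mul_assoc, mul_assoc (ENNReal.ofReal N), hcancel, mul_one]

theorem enorm_sub_cellAvg_sq_le (hα : 0 ≤ 1 + α) (hN : 0 < N) {u : ℝ → ℝ} (hu : Integrable u)
    (x : ℝ) :
    ‖u x - cellAvg N u x‖ₑ ^ 2 ≤
      ENNReal.ofReal ((N : ℝ) ^ (-α)) * ∫⁻ y, ‖diffQuot α u (x, y)‖ₑ ^ 2 := by
  have hN' : (0 : ℝ) < N := Nat.cast_pos.2 hN
  have hpow : (N : ℝ) * (N : ℝ) ^ (-(1 + α)) = (N : ℝ) ^ (-α) := by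
    rw [neg_add, Real.rpow_add hN', Real.rpow_neg_one, mul_inv_cancel_left₀ hN'.ne']
  calc ‖u x - cellAvg N u x‖ₑ ^ 2
      ≤ ENNReal.ofReal N * ∫⁻ y in cell N ⌊(N : ℝ) * x⌋, ‖u x - u y‖ₑ ^ 2 :=
        enorm_sub_cellAvg_sq_le_setLIntegral hN hu x
    _ ≤ ENNReal.ofReal N * ∫⁻ y, ENNReal.ofReal ((N : ℝ) ^ (-(1 + α))) *
          ‖diffQuot α u (x, y)‖ₑ ^ 2 := by
        gcongr 1
        exact (setLIntegral_mono' (measurableSet_cell _ _)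
          fun y hy => enorm_sub_sq_le_of_mem_cell hα hN u hy).trans (setLIntegral_le_lintegral _ _)
    _ = ENNReal.ofReal ((N : ℝ) ^ (-α)) * ∫⁻ y, ‖diffQuot α u (x, y)‖ₑ ^ 2 := by
        rw [lintegral_const_mul' _ _ ENNReal.ofReal_ne_top, ← mul_assoc,
          ← ENNReal.ofReal_mul hN'.le, hpow]

theorem lintegral_sub_cellAvg_sq_le (hα : 0 ≤ 1 + α) (hN : 0 < N) {u : ℝ → ℝ} (hm : Measurable u)
    (hu : Integrable u) :
    ∫⁻ x, ‖u x - cellAvg N u x‖ₑ ^ 2 ≤ ENNReal.ofReal ((N : ℝ) ^ (-α)) * lineGagliardoSq α u := by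
  rw [lineGagliardoSq_eq_lintegral hm, ← lintegral_const_mul' _ _ ENNReal.ofReal_ne_top]
  exact lintegral_mono fun x => enorm_sub_cellAvg_sq_le hα hN hu x

/-- The indicator function of a cell. -/
def cellInd (N : ℕ) (j : ℤ) : L2Omega :=
  indicatorConstLp 2 (measurableSet_cell N j) (measure_ne_top _ _) (1 : ℝ)

/-- The cell averaging operator `u ↦ cellAvg N (zeroExt u)`, of finite rank on `L²(Ω)`: the cells
with indices between `-4 * N` and `4 * N` cover `Ω`, since `π < 4`. -/
def cellAvgOp (N : ℕ) : L2Omega →L[ℝ] L2Omega :=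
  ∑ j ∈ Finset.Icc (-(4 * N : ℤ)) (4 * N),
    (N : ℝ) • (innerSL ℝ (cellInd N j)).smulRight (cellInd N j)

theorem isCompactOperator_cellAvgOp (N : ℕ) : IsCompactOperator (cellAvgOp N) := by
  refine (compactOperator (RingHom.id ℝ) L2Omega L2Omega).sum_mem fun j _ => ?_
  have hinner : IsCompactOperator (innerSL ℝ (cellInd N j)) :=
    isCompactOperator_of_locallyCompactSpace_dom (innerSL ℝ (cellInd N j) : L2Omega →L[ℝ] ℝ)
  exact (hinner.clm_comp (ContinuousLinearMap.toSpanSingleton ℝ (cellInd N j))).smul (N : ℝ)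

theorem floor_mul_mem_Icc (hN : 0 < N) {x : ℝ} (hx : x ∈ Omega) :
    ⌊(N : ℝ) * x⌋ ∈ Finset.Icc (-(4 * N : ℤ)) (4 * N) := by
  have hN' : (0 : ℝ) < N := Nat.cast_pos.2 hN
  rw [Finset.mem_Icc, Int.le_floor]
  refine ⟨?_, (Int.floor_lt.2 ?_).le⟩ <;> push_cast <;>
    nlinarith [Real.pi_lt_four, hx.1, hx.2]

theorem cellAvgOp_apply (N : ℕ) (u : L2Omega) :
    cellAvgOp N u = ∑ j ∈ Finset.Icc (-(4 * N : ℤ)) (4 * N),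
      (N * ∫ y in cell N j, zeroExt u y) • cellInd N j := by
  have hinner (j : ℤ) : ⟪cellInd N j, u⟫_ℝ = ∫ y in cell N j, zeroExt u y := by
    rw [cellInd, L2.inner_indicatorConstLp_one, Measure.restrict_restrict (measurableSet_cell _ _)]
    exact (setIntegral_indicator measurableSet_Omega).symm
  simp only [cellAvgOp, sum_apply, smul_apply, ContinuousLinearMap.smulRight_apply,
    innerSL_apply_apply, hinner, smul_smul]

theorem cellAvgOp_ae_eq (hN : 0 < N) (u : L2Omega) :
    cellAvgOp N u =ᵐ[volume.restrict Omega] cellAvg N (zeroExt u) := by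
  have hterm (j : ℤ) : ((N * ∫ y in cell N j, zeroExt u y) • cellInd N j : L2Omega)
      =ᵐ[volume.restrict Omega]
        fun x => (N * ∫ y in cell N j, zeroExt u y) * (cell N j).indicator (fun _ => 1) x := by
    filter_upwards [Lp.coeFn_smul (N * ∫ y in cell N j, zeroExt u y) (cellInd N j),
      indicatorConstLp_coeFn (p := 2) (hs := measurableSet_cell N j)
        (hμs := measure_ne_top (volume.restrict Omega) _) (c := (1 : ℝ))] with x hsmul hind
    rw [hsmul, Pi.smul_apply, smul_eq_mul, cellInd, hind]
  rw [cellAvgOp_apply]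
  filter_upwards [ae_all_iff.2 hterm, ae_restrict_mem measurableSet_Omega,
    Lp.coeFn_finsetSum (Finset.Icc (-(4 * N : ℤ)) (4 * N))
      fun j => ((N * ∫ y in cell N j, zeroExt u y) • cellInd N j : L2Omega)] with x hx hmem hsum
  rw [hsum, Finset.sum_apply, Finset.sum_congr rfl fun j _ => hx j,
    Finset.sum_eq_single_of_mem _ (floor_mul_mem_Icc hN hmem) fun j _ hne => ?_]
  · rw [indicator_of_mem (show x ∈ cell N _ from rfl), mul_one, cellAvg]
  · rw [indicator_of_notMem (show x ∉ cell N j from hne.symm), mul_zero]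

theorem norm_sub_cellAvgOp_sq_le (hα : 0 ≤ 1 + α) (hN : 0 < N) (v : H0Space α) :
    ‖H0Space.incl α v - cellAvgOp N (H0Space.incl α v)‖ ^ 2 ≤ (N : ℝ) ^ (-α) * ‖v‖ ^ 2 := by
  set u := H0Space.incl α v
  have h : ‖u - cellAvgOp N u‖ₑ ^ 2 ≤ ENNReal.ofReal ((N : ℝ) ^ (-α)) * ‖v‖ₑ ^ 2 := by
    calc ‖u - cellAvgOp N u‖ₑ ^ 2
        = ∫⁻ x in Omega, ‖zeroExt u x - cellAvg N (zeroExt u) x‖ₑ ^ 2 := by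
          rw [Lp.enorm_def, eLpNorm_two_sq]
          refine lintegral_congr_ae ?_
          filter_upwards [Lp.coeFn_sub u (cellAvgOp N u), cellAvgOp_ae_eq hN u,
            ae_restrict_mem measurableSet_Omega] with x hsub havg hmem
          rw [hsub, Pi.sub_apply, havg, zeroExt, indicator_of_mem hmem]
      _ ≤ ∫⁻ x, ‖zeroExt u x - cellAvg N (zeroExt u) x‖ₑ ^ 2 := setLIntegral_le_lintegral _ _
      _ ≤ ENNReal.ofReal ((N : ℝ) ^ (-α)) * lineGagliardoSq α (zeroExt u) :=
          lintegral_sub_cellAvg_sq_le hα hN (measurable_zeroExt u) (integrable_zeroExt u)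
      _ ≤ ENNReal.ofReal ((N : ℝ) ^ (-α)) * ‖v‖ₑ ^ 2 := by
          rw [H0Space.enorm_sq_eq]
          gcongr
          exact le_add_self
  rw [← ofReal_norm v, ← ENNReal.ofReal_pow (norm_nonneg _),
    ← ENNReal.ofReal_mul (by positivity)] at h
  simpa only [ENNReal.toReal_ofReal (by positivity : 0 ≤ (N : ℝ) ^ (-α) * ‖v‖ ^ 2)] using
    norm_sq_le_toReal ENNReal.ofReal_ne_top h

theorem isCompactOperator_incl (hα : 0 < α) : IsCompactOperator (H0Space.incl α) := by
  refine isCompactOperator_of_tendsto (l := atTop)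
    (F := fun n : ℕ => (cellAvgOp (n + 1)).comp (H0Space.incl α)) ?_
    (Eventually.of_forall fun n => (isCompactOperator_cellAvgOp _).comp_clm _)
  have hrate : Tendsto (fun n : ℕ => √(((n + 1 : ℕ) : ℝ) ^ (-α))) atTop (𝓝 0) := by
    have h := ((tendsto_rpow_neg_atTop hα).comp
      (tendsto_natCast_atTop_atTop.comp (tendsto_add_atTop_nat 1))).sqrt
    simpa only [Real.sqrt_zero] using! h
  refine (tendsto_iff_norm_sub_tendsto_zero (E := H0Space α →L[ℝ] L2Omega)).2
    (squeeze_zero (fun _ => norm_nonneg (E := H0Space α →L[ℝ] L2Omega) _) (fun n => ?_) hrate)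
  rw [norm_sub_rev (E := H0Space α →L[ℝ] L2Omega)]
  refine ContinuousLinearMap.opNorm_le_bound _ (by positivity) fun v => ?_
  refine le_of_sq_le_sq ?_ (by positivity)
  rw [mul_pow, Real.sq_sqrt (by positivity)]
  exact norm_sub_cellAvgOp_sq_le (by linarith) n.succ_pos v

end Compactness

/-! ### The fractional Laplacian -/

section LevyKernel

variable {α : ℝ}

/-- The weight `min(z², 1) / |z|^(1 + α)`, integrable for `0 < α < 2`, which dominates second
differences of smooth functions divided by `|z|^(1 + α)`. -/
def levyWeight (α z : ℝ) : ℝ := min (z ^ 2) 1 / |z| ^ (1 + α)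

theorem levyWeight_nonneg (α z : ℝ) : 0 ≤ levyWeight α z := by
  unfold levyWeight
  positivity

theorem levyWeight_neg (α z : ℝ) : levyWeight α (-z) = levyWeight α z := by
  simp only [levyWeight, neg_sq, abs_neg]

theorem integrable_levyWeight (hα₀ : 0 < α) (hα₂ : α < 2) : Integrable (levyWeight α) := by
  have hIoc : IntegrableOn (levyWeight α) (Ioc 0 1) := by
    have h := (intervalIntegral.intervalIntegrable_rpow' (a := 0) (b := 1)
      (show -1 < 2 - (1 + α) by linarith)).1
    refine h.congr_fun (fun z hz => ?_) measurableSet_Ioc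
    have hz₀ : 0 < z := hz.1
    simp only [levyWeight]
    rw [min_eq_left (pow_le_one₀ hz₀.le hz.2), abs_of_pos hz₀, Real.rpow_sub hz₀, Real.rpow_two]
  have hIoi_one : IntegrableOn (levyWeight α) (Ioi 1) := by
    have h := integrableOn_Ioi_rpow_of_lt (show -(1 + α) < -1 by linarith) zero_lt_one
    refine h.congr_fun (fun z (hz : 1 < z) => ?_) measurableSet_Ioi
    have hz₀ : 0 < z := zero_lt_one.trans hz
    simp only [levyWeight]
    rw [min_eq_right (one_le_pow₀ hz.le), abs_of_pos hz₀, Real.rpow_neg hz₀.le, one_div]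
  have hIoi : IntegrableOn (levyWeight α) (Ioi 0) := by
    rw [← Ioc_union_Ioi_eq_Ioi zero_le_one]
    exact hIoc.union hIoi_one
  have hIic : IntegrableOn (levyWeight α) (Iic 0) := by
    have h := (integrableOn_Ici_iff_integrableOn_Ioi (f := levyWeight α)).2 hIoi
    rw [← neg_zero] at h
    simpa only [levyWeight_neg] using! h.comp_neg_Iic
  rw [← integrableOn_univ, ← Iic_union_Ioi (a := (0 : ℝ))]
  exact hIic.union hIoi

/-- The kernel `|z|^(-1-α)` cut off near the origin. -/
def truncKer (α ε : ℝ) : ℝ → ℝ := {z : ℝ | ε ≤ |z|}.indicator fun z => (|z| ^ (1 + α))⁻¹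

theorem truncKer_neg (α ε z : ℝ) : truncKer α ε (-z) = truncKer α ε z := by
  simp only [truncKer, indicator, mem_ofPred_eq, abs_neg]

theorem truncKer_nonneg (α ε z : ℝ) : 0 ≤ truncKer α ε z :=
  indicator_nonneg (fun z _ => by positivity) z

theorem truncKer_le_inv_rpow (α ε z : ℝ) : truncKer α ε z ≤ (|z| ^ (1 + α))⁻¹ :=
  indicator_le_self' (fun z _ => by positivity) z

theorem eventually_truncKer_eq (α : ℝ) {z : ℝ} (hz : z ≠ 0) :
    ∀ᶠ ε in 𝓝[>] (0 : ℝ), truncKer α ε z = (|z| ^ (1 + α))⁻¹ := by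
  filter_upwards [Ioo_mem_nhdsGT (abs_pos.2 hz)] with ε hε
  exact indicator_of_mem (show z ∈ {z : ℝ | ε ≤ |z|} from hε.2.le) _

@[fun_prop]
theorem measurable_truncKer (α ε : ℝ) : Measurable (truncKer α ε) :=
  Measurable.indicator (by fun_prop) (measurableSet_le measurable_const (by fun_prop))

theorem min_mul_truncKer_le (α ε z : ℝ) : min (z ^ 2) 1 * truncKer α ε z ≤ levyWeight α z := by
  rw [levyWeight, div_eq_mul_inv]
  gcongr
  exact truncKer_le_inv_rpow α ε z

theorem truncKer_le_mul_levyWeight {ε : ℝ} (hε : 0 < ε) (z : ℝ) :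
    truncKer α ε z ≤ (min (ε ^ 2) 1)⁻¹ * levyWeight α z := by
  by_cases hz : ε ≤ |z|
  · have hmin : min (ε ^ 2) 1 ≤ min (z ^ 2) 1 :=
      min_le_min_right _ (sq_abs z ▸ pow_le_pow_left₀ hε.le hz 2)
    rw [inv_mul_eq_div, le_div_iff₀ (by positivity), mul_comm]
    exact (mul_le_mul_of_nonneg_right hmin (truncKer_nonneg _ _ _)).trans
      (min_mul_truncKer_le _ _ z)
  · rw [truncKer, indicator_of_notMem (show z ∉ {z : ℝ | ε ≤ |z|} from hz)]
    exact mul_nonneg (by positivity) (levyWeight_nonneg _ _)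

theorem integrable_truncKer (hα₀ : 0 < α) (hα₂ : α < 2) {ε : ℝ} (hε : 0 < ε) :
    Integrable (truncKer α ε) := by
  refine ((integrable_levyWeight hα₀ hα₂).const_mul (min (ε ^ 2) 1)⁻¹).mono'
    (measurable_truncKer α ε).aestronglyMeasurable (ae_of_all _ fun z => ?_)
  rw [Real.norm_of_nonneg (truncKer_nonneg _ _ _)]
  exact truncKer_le_mul_levyWeight hε z

end LevyKernel

section Differences

variable {α : ℝ} {φ : ℝ → ℝ}

theorem exists_sub_sq_le (hφ : ContDiff ℝ 1 φ) (hc : HasCompactSupport φ) :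
    ∃ C, 0 ≤ C ∧ ∀ x y, (φ x - φ y) ^ 2 ≤ C * min ((x - y) ^ 2) 1 := by
  obtain ⟨M, hM⟩ := hc.exists_bound_of_continuous hφ.continuous
  obtain ⟨K, hK⟩ := hφ.lipschitzWith_of_hasCompactSupport hc one_ne_zero
  refine ⟨K ^ 2 + (2 * M) ^ 2, by positivity, fun x y => ?_⟩
  have hlip : |φ x - φ y| ≤ K * |x - y| := hK.dist_le_mul x y
  have hbdd : |φ x - φ y| ≤ 2 * M :=
    (abs_sub _ _).trans ((add_le_add (hM x) (hM y)).trans_eq (two_mul M).symm)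
  have hlip_sq := pow_le_pow_left₀ (abs_nonneg _) hlip 2
  have hbdd_sq := pow_le_pow_left₀ (abs_nonneg _) hbdd 2
  rw [mul_pow, sq_abs, sq_abs] at hlip_sq
  rw [sq_abs] at hbdd_sq
  rw [mul_min_of_nonneg _ _ (by positivity)]
  exact le_min (hlip_sq.trans (by gcongr; exact le_add_of_nonneg_right (sq_nonneg _)))
    (by rw [mul_one]; exact hbdd_sq.trans (le_add_of_nonneg_left (sq_nonneg _)))

/-- The symmetric second difference of `φ` at `x` with step `z`. -/
def secondDiff (φ : ℝ → ℝ) (x z : ℝ) : ℝ := 2 * φ x - φ (x - z) - φ (x + z)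

theorem exists_abs_secondDiff_le (hφ : ContDiff ℝ 2 φ) (hc : HasCompactSupport φ) :
    ∃ C, 0 ≤ C ∧ ∀ x z, |secondDiff φ x z| ≤ C * min (z ^ 2) 1 := by
  obtain ⟨M, hM⟩ := hc.exists_bound_of_continuous hφ.continuous
  have hM₀ : 0 ≤ M := (norm_nonneg _).trans (hM 0)
  obtain ⟨K, hK⟩ := ((contDiff_succ_iff_deriv (n := 1)).1 hφ).2.2.lipschitzWith_of_hasCompactSupport
    hc.deriv one_ne_zero
  have hdiff : Differentiable ℝ φ := hφ.differentiable two_ne_zero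
  refine ⟨K + 4 * M, by positivity, fun x z => ?_⟩
  have hquad : |secondDiff φ x z| ≤ K * z ^ 2 := by
    have hL : LipschitzWith (K * ‖z‖₊) (fun s => φ (s + z) - φ s) := by
      refine lipschitzWith_of_nnnorm_deriv_le (by fun_prop) fun s => ?_
      rw [deriv_fun_sub (by fun_prop) (by fun_prop), deriv_comp_add_const, ← NNReal.coe_le_coe]
      simpa [Real.dist_eq] using hK.dist_le_mul (s + z) s
    have h := hL.dist_le_mul (x - z) x
    simp only [sub_add_cancel, Real.dist_eq, NNReal.coe_mul, coe_nnnorm, Real.norm_eq_abs,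
      sub_sub_cancel_left, abs_neg, mul_assoc, ← sq, sq_abs] at h
    convert h using 2
    rw [secondDiff]
    ring
  have hbdd : |secondDiff φ x z| ≤ 4 * M := by
    have hx := abs_le.1 (hM x)
    have hsub := abs_le.1 (hM (x - z))
    have hadd := abs_le.1 (hM (x + z))
    exact abs_le.2 ⟨by rw [secondDiff]; linarith, by rw [secondDiff]; linarith⟩
  rw [mul_min_of_nonneg _ _ (by positivity)]
  exact le_min (hquad.trans (by gcongr; linarith)) (hbdd.trans (by linarith [K.2]))

theorem exists_norm_secondDiff_mul_truncKer_le (hφ : ContDiff ℝ 2 φ) (hc : HasCompactSupport φ) :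
    ∃ C, ∀ ε x z, ‖secondDiff φ x z * truncKer α ε z‖ ≤ C * levyWeight α z := by
  obtain ⟨C, hC₀, hC⟩ := exists_abs_secondDiff_le hφ hc
  refine ⟨C, fun ε x z => ?_⟩
  rw [norm_mul, Real.norm_of_nonneg (truncKer_nonneg _ _ _)]
  calc ‖secondDiff φ x z‖ * truncKer α ε z
      ≤ C * min (z ^ 2) 1 * truncKer α ε z :=
        mul_le_mul_of_nonneg_right (hC x z) (truncKer_nonneg _ _ _)
    _ ≤ C * levyWeight α z := by
        rw [mul_assoc]
        exact mul_le_mul_of_nonneg_left (min_mul_truncKer_le _ _ z) hC₀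

theorem lineGagliardoSq_lt_top_of_contDiff (hα₀ : 0 < α) (hα₂ : α < 2) (hφ : ContDiff ℝ 1 φ)
    (hc : HasCompactSupport φ) : lineGagliardoSq α φ < ⊤ := by
  obtain ⟨C, hC₀, hC⟩ := exists_sub_sq_le hφ hc
  set K := tsupport φ
  have hK : volume K < ⊤ := IsCompact.measure_lt_top hc
  have hbound : Integrable fun p : ℝ × ℝ =>
      K.indicator (fun _ => C) p.2 * levyWeight α (p.1 - p.2) :=
    Integrable.convolution_integrand (ContinuousLinearMap.mul ℝ ℝ)
      ((integrableOn_const hK.ne).integrable_indicator (isClosed_tsupport φ).measurableSet)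
      (integrable_levyWeight hα₀ hα₂)
  refine lt_of_le_of_lt (lintegral_mono fun (x, y) => ?_)
    (hbound.add hbound.swap).lintegral_lt_top
  rw [enorm_diffQuot_sq]
  refine ENNReal.ofReal_le_ofReal ?_
  simp only [Pi.add_apply, Function.comp_apply, Prod.swap_prod_mk]
  rw [← neg_sub x y, levyWeight_neg, ← add_mul]
  have hle : (φ x - φ y) ^ 2 / |x - y| ^ (1 + α) ≤ C * levyWeight α (x - y) := by
    rw [levyWeight, ← mul_div_assoc]
    exact div_le_div_of_nonneg_right (hC x y) (by positivity)
  have hind (z : ℝ) : 0 ≤ K.indicator (fun _ => C) z := indicator_nonneg (fun _ _ => hC₀) z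
  by_cases hx : x ∈ K
  · refine hle.trans (mul_le_mul_of_nonneg_right ?_ (levyWeight_nonneg _ _))
    exact (indicator_of_mem hx fun _ => C).ge.trans (le_add_of_nonneg_left (hind y))
  by_cases hy : y ∈ K
  · refine hle.trans (mul_le_mul_of_nonneg_right ?_ (levyWeight_nonneg _ _))
    exact (indicator_of_mem hy fun _ => C).ge.trans (le_add_of_nonneg_right (hind x))
  · rw [image_eq_zero_of_notMem_tsupport hx, image_eq_zero_of_notMem_tsupport hy, sub_self,
      zero_pow two_ne_zero, zero_div]
    exact mul_nonneg (add_nonneg (hind y) (hind x)) (levyWeight_nonneg _ _)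

end Differences

section PrincipalValue

variable {α : ℝ} {φ : ℝ → ℝ}

/-- The truncated fractional Laplacian of `φ`, without its normalising constant. -/
def truncLap (α ε : ℝ) (φ : ℝ → ℝ) (x : ℝ) : ℝ := ∫ y, (φ x - φ y) * truncKer α ε (x - y)

/-- The fractional Laplacian of `φ`, without its normalising constant, as an absolutely convergent
integral of second differences. -/
def levyLap (α : ℝ) (φ : ℝ → ℝ) (x : ℝ) : ℝ := 1 / 2 * ∫ z, secondDiff φ x z / |z| ^ (1 + α)

theorem setIntegral_compl_ball_eq_truncLap (α ε : ℝ) (φ : ℝ → ℝ) (x : ℝ) :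
    ∫ y in (Metric.ball x ε)ᶜ, (φ x - φ y) / |x - y| ^ (1 + α) = truncLap α ε φ x := by
  rw [← integral_indicator Metric.isOpen_ball.measurableSet.compl]
  refine integral_congr_ae (ae_of_all _ fun y => ?_)
  simp only [truncKer, indicator, mem_compl_iff, Metric.mem_ball, mem_ofPred_eq, not_lt,
    Real.dist_eq, abs_sub_comm y x]
  split_ifs
  · exact div_eq_mul_inv _ _
  · exact (mul_zero _).symm

theorem truncLap_eq_integral_secondDiff (hα₀ : 0 < α) (hα₂ : α < 2) (hφ : Continuous φ)
    (hc : HasCompactSupport φ) {ε : ℝ} (hε : 0 < ε) (x : ℝ) :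
    truncLap α ε φ x = 1 / 2 * ∫ z, secondDiff φ x z * truncKer α ε z := by
  obtain ⟨M, hM⟩ := hc.exists_bound_of_continuous hφ
  have hsub_int : Integrable fun z => (φ x - φ (x - z)) * truncKer α ε z :=
    (integrable_truncKer hα₀ hα₂ hε).bdd_mul (c := M + M) (by fun_prop)
      (ae_of_all _ fun z => (norm_sub_le _ _).trans (add_le_add (hM _) (hM _)))
  have hadd_int : Integrable fun z => (φ x - φ (x + z)) * truncKer α ε z := by
    simpa only [truncKer_neg, sub_neg_eq_add] using hsub_int.comp_neg
  have hsub : truncLap α ε φ x = ∫ z, (φ x - φ (x - z)) * truncKer α ε z := by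
    rw [truncLap, ← integral_sub_left_eq_self _ volume x]
    simp only [sub_sub_cancel]
  have hadd : truncLap α ε φ x = ∫ z, (φ x - φ (x + z)) * truncKer α ε z := by
    rw [hsub, ← integral_neg_eq_self]
    simp only [truncKer_neg, sub_neg_eq_add]
  have hsum : ∫ z, secondDiff φ x z * truncKer α ε z =
      (∫ z, (φ x - φ (x - z)) * truncKer α ε z) + ∫ z, (φ x - φ (x + z)) * truncKer α ε z := by
    rw [← integral_add hsub_int hadd_int]
    refine integral_congr_ae (ae_of_all _ fun z => ?_)
    simp only [secondDiff]
    ring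
  rw [hsum, ← hsub, ← hadd]
  ring

variable (hα₀ : 0 < α) (hα₂ : α < 2) (hφ : ContDiff ℝ 2 φ) (hc : HasCompactSupport φ)

include hα₀ hα₂ hφ hc

theorem exists_norm_truncLap_le : ∃ C, ∀ ε, 0 < ε → ∀ x, ‖truncLap α ε φ x‖ ≤ C := by
  obtain ⟨C, hC⟩ := exists_norm_secondDiff_mul_truncKer_le (α := α) hφ hc
  refine ⟨1 / 2 * ∫ z, C * levyWeight α z, fun ε hε x => ?_⟩
  rw [truncLap_eq_integral_secondDiff hα₀ hα₂ hφ.continuous hc hε, norm_mul,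
    Real.norm_of_nonneg one_half_pos.le]
  gcongr
  exact norm_integral_le_of_norm_le ((integrable_levyWeight hα₀ hα₂).const_mul C)
    (ae_of_all _ fun z => hC ε x z)

theorem tendsto_truncLap (x : ℝ) :
    Tendsto (fun ε => truncLap α ε φ x) (𝓝[>] 0) (𝓝 (levyLap α φ x)) := by
  obtain ⟨C, hC⟩ := exists_norm_secondDiff_mul_truncKer_le (α := α) hφ hc
  have hcont := hφ.continuous
  have h : Tendsto (fun ε => 1 / 2 * ∫ z, secondDiff φ x z * truncKer α ε z) (𝓝[>] 0)
      (𝓝 (levyLap α φ x)) := by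
    refine Tendsto.const_mul _ (tendsto_integral_filter_of_dominated_convergence
      (fun z => C * levyWeight α z) (Eventually.of_forall fun ε => ?_)
      (Eventually.of_forall fun ε => ae_of_all _ fun z => hC ε x z)
      ((integrable_levyWeight hα₀ hα₂).const_mul C) (ae_of_all _ fun z => ?_))
    · exact Measurable.aestronglyMeasurable (by unfold secondDiff; fun_prop)
    · rcases eq_or_ne z 0 with rfl | hz
      · have hzero : secondDiff φ x 0 = 0 := by
          rw [secondDiff, sub_zero, add_zero]
          ring
        simp only [hzero, zero_mul, zero_div, tendsto_const_nhds]
      · refine tendsto_const_nhds.congr' ((eventually_truncKer_eq α hz).mono fun ε hε => ?_)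
        simp only [hε, div_eq_mul_inv]
  refine h.congr' ?_
  filter_upwards [self_mem_nhdsWithin] with ε hε
  rw [truncLap_eq_integral_secondDiff hα₀ hα₂ hcont hc hε]

theorem fracLap_eq (x : ℝ) : fracLap α φ x = fracLapConst α * levyLap α φ x := by
  simp only [fracLap, setIntegral_compl_ball_eq_truncLap]
  rw [(tendsto_truncLap hα₀ hα₂ hφ hc x).limUnder_eq]

theorem tendsto_integral_mul_truncLap {u : ℝ → ℝ} (hu : Integrable u) :
    Tendsto (fun ε => ∫ x, u x * truncLap α ε φ x) (𝓝[>] 0) (𝓝 (∫ x, u x * levyLap α φ x)) := by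
  obtain ⟨C, hC⟩ := exists_norm_truncLap_le hα₀ hα₂ hφ hc
  have hcont := hφ.continuous
  refine tendsto_integral_filter_of_dominated_convergence (fun x => ‖u x‖ * C)
    (Eventually.of_forall fun ε => hu.aestronglyMeasurable.mul ?_) ?_ (hu.norm.mul_const C)
    (ae_of_all _ fun x => (tendsto_truncLap hα₀ hα₂ hφ hc x).const_mul _)
  · exact AEStronglyMeasurable.integral_prod_right' (μ := volume) (ν := volume)
      (f := fun p : ℝ × ℝ => (φ p.1 - φ p.2) * truncKer α ε (p.1 - p.2))
      (Measurable.aestronglyMeasurable (by fun_prop))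
  · filter_upwards [self_mem_nhdsWithin] with ε hε
    refine ae_of_all _ fun x => ?_
    rw [norm_mul]
    exact mul_le_mul_of_nonneg_left (hC ε hε x) (norm_nonneg _)

omit hα₀ hα₂ hc in
theorem tendsto_integral_prod_mul_truncKer {u : ℝ → ℝ} (hu : AEStronglyMeasurable u)
    (hint : Integrable fun p : ℝ × ℝ => diffQuot α u p * diffQuot α φ p) :
    Tendsto (fun ε => ∫ p : ℝ × ℝ,
        (u p.1 - u p.2) * ((φ p.1 - φ p.2) * truncKer α ε (p.1 - p.2))) (𝓝[>] 0)
      (𝓝 (∫ p : ℝ × ℝ, diffQuot α u p * diffQuot α φ p)) := by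
  have hcont := hφ.continuous
  refine tendsto_integral_filter_of_dominated_convergence _
    (Eventually.of_forall fun ε => ?_) (Eventually.of_forall fun ε => ae_of_all _ fun (x, y) => ?_)
    hint.norm (ae_of_all _ fun (x, y) => ?_)
  · exact (hu.comp_fst.sub hu.comp_snd).mul (Measurable.aestronglyMeasurable (by fun_prop))
  · rw [diffQuot_mul_diffQuot, ← mul_assoc, norm_mul, norm_div,
      Real.norm_of_nonneg (truncKer_nonneg _ _ _),
      Real.norm_of_nonneg (Real.rpow_nonneg (abs_nonneg _) _), div_eq_mul_inv]
    gcongr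
    exact truncKer_le_inv_rpow _ _ _
  · rw [diffQuot_mul_diffQuot]
    rcases eq_or_ne x y with rfl | hxy
    · simp only [sub_self, zero_mul, zero_div, tendsto_const_nhds]
    · refine tendsto_const_nhds.congr'
        ((eventually_truncKer_eq α (sub_ne_zero.2 hxy)).mono fun ε hε => ?_)
      simp only [hε, div_eq_mul_inv, mul_assoc]

theorem integral_prod_mul_truncKer {u : ℝ → ℝ} (hu : Integrable u) {ε : ℝ} (hε : 0 < ε) :
    ∫ p : ℝ × ℝ, (u p.1 - u p.2) * ((φ p.1 - φ p.2) * truncKer α ε (p.1 - p.2)) =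
      2 * ∫ x, u x * truncLap α ε φ x := by
  obtain ⟨M, hM⟩ := hc.exists_bound_of_continuous hφ.continuous
  have hcont := hφ.continuous
  have hflip (x y : ℝ) : u x * ((φ y - φ x) * truncKer α ε (y - x)) =
      -(u x * ((φ x - φ y) * truncKer α ε (x - y))) := by
    rw [← truncKer_neg, neg_sub]
    ring
  have hsnd : Integrable fun p : ℝ × ℝ =>
      u p.2 * ((φ p.1 - φ p.2) * truncKer α ε (p.1 - p.2)) := by
    have h := (hu.convolution_integrand (ContinuousLinearMap.mul ℝ ℝ)
      (integrable_truncKer hα₀ hα₂ hε)).bdd_mul (c := M + M)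
      (f := fun p : ℝ × ℝ => φ p.1 - φ p.2) (by fun_prop)
      (ae_of_all _ fun p => (norm_sub_le _ _).trans (add_le_add (hM p.1) (hM p.2)))
    refine h.congr (ae_of_all _ fun p => ?_)
    exact mul_left_comm _ _ _
  have hfst : Integrable fun p : ℝ × ℝ =>
      u p.1 * ((φ p.1 - φ p.2) * truncKer α ε (p.1 - p.2)) :=
    hsnd.swap.neg.congr (ae_of_all _ fun p => neg_eq_iff_eq_neg.2 (hflip p.1 p.2))
  have hswap : ∫ p : ℝ × ℝ, u p.2 * ((φ p.1 - φ p.2) * truncKer α ε (p.1 - p.2)) =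
      -∫ p : ℝ × ℝ, u p.1 * ((φ p.1 - φ p.2) * truncKer α ε (p.1 - p.2)) := by
    rw [Measure.volume_eq_prod, ← integral_prod_swap, ← integral_neg]
    exact integral_congr_ae (ae_of_all _ fun p => hflip p.1 p.2)
  simp only [sub_mul (u _)]
  rw [integral_sub hfst hsnd, hswap, sub_neg_eq_add, ← two_mul, Measure.volume_eq_prod,
    integral_prod _ hfst]
  simp only [integral_const_mul, truncLap]

theorem integral_diffQuot_mul_diffQuot {u : ℝ → ℝ} (hu : Integrable u)
    (hint : Integrable fun p : ℝ × ℝ => diffQuot α u p * diffQuot α φ p) :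
    ∫ p : ℝ × ℝ, diffQuot α u p * diffQuot α φ p = 2 * ∫ x, u x * levyLap α φ x := by
  refine tendsto_nhds_unique (tendsto_integral_prod_mul_truncKer hφ hu.aestronglyMeasurable hint)
    (((tendsto_integral_mul_truncLap hα₀ hα₂ hφ hc hu).const_mul 2).congr' ?_)
  filter_upwards [self_mem_nhdsWithin] with ε hε
  rw [integral_prod_mul_truncKer hα₀ hα₂ hφ hc hu hε]

end PrincipalValue

section WeakLimit

variable {V X : Type*} [NormedAddCommGroup V] [InnerProductSpace ℝ V] [CompleteSpace V]
  [NormedAddCommGroup X] [InnerProductSpace ℝ X] [CompleteSpace X]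

theorem dense_adjoint_image {j : V →L[ℝ] X} (hj : Function.Injective j) {D : Set X}
    (hD : Dense D) : Dense (ContinuousLinearMap.adjoint j '' D) := by
  have hrange : DenseRange (ContinuousLinearMap.adjoint j) := by
    change Dense ((ContinuousLinearMap.adjoint j).range : Set V)
    rw [Submodule.dense_iff_topologicalClosure_eq_top, Submodule.topologicalClosure_eq_top_iff,
      ContinuousLinearMap.orthogonal_range, ContinuousLinearMap.adjoint_adjoint]
    exact LinearMap.ker_eq_bot.2 hj
  exact hrange.dense_image (ContinuousLinearMap.adjoint j).continuous hD

omit [CompleteSpace V] in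
theorem tendsto_inner_of_dense {v : ℕ → V} {v₀ : V} {C : ℝ≥0} (hC : ∀ n, ‖v n‖ ≤ C) {D : Set V}
    (hD : Dense D) (h : ∀ z ∈ D, Tendsto (fun n => ⟪v n, z⟫_ℝ) atTop (𝓝 ⟪v₀, z⟫_ℝ)) (z : V) :
    Tendsto (fun n => ⟪v n, z⟫_ℝ) atTop (𝓝 ⟪v₀, z⟫_ℝ) := by
  have hequi : UniformEquicontinuous fun n z => ⟪v n, z⟫_ℝ :=
    LipschitzWith.uniformEquicontinuous _ C fun n =>
      ((innerSL ℝ (v n)).lipschitz).weaken (by simpa [← NNReal.coe_le_coe] using hC n)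
  have hclosed := hequi.equicontinuous.isClosed_setOfPred_tendsto (l := atTop)
    (f := fun z => ⟪v₀, z⟫_ℝ) (by fun_prop)
  exact hclosed.closure_subset_iff.2 h (hD z)

theorem mem_topologicalClosure_of_tendsto_inner {j : V →L[ℝ] X} (hj : Function.Injective j)
    {W : Submodule ℝ V} {v : ℕ → V} {v₀ : V} {C : ℝ≥0} (hC : ∀ n, ‖v n‖ ≤ C) (hv : ∀ n, v n ∈ W)
    {D : Set X} (hD : Dense D)
    (h : ∀ k ∈ D, Tendsto (fun n => ⟪k, j (v n)⟫_ℝ) atTop (𝓝 ⟪k, j v₀⟫_ℝ)) :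
    v₀ ∈ W.topologicalClosure := by
  have hweak := tendsto_inner_of_dense (v₀ := v₀) hC (dense_adjoint_image hj hD) <| by
    rintro _ ⟨k, hk, rfl⟩
    simpa only [ContinuousLinearMap.adjoint_inner_right, real_inner_comm] using h k hk
  rw [← Submodule.orthogonal_orthogonal_eq_closure, Submodule.mem_orthogonal']
  intro z hz
  refine tendsto_nhds_unique (hweak z) (tendsto_const_nhds.congr fun n => ?_)
  exact ((Submodule.mem_orthogonal _ _).1 hz _ (hv n)).symm

end WeakLimit

section Mollify

/-- The mollification of a function on the line by a bump function. -/
def mollify (η : ContDiffBump (0 : ℝ)) (u : ℝ → ℝ) (x : ℝ) : ℝ :=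
  ∫ z, η.normed volume z * u (x - z)

variable (η : ContDiffBump (0 : ℝ)) {α : ℝ} {u : ℝ → ℝ}

theorem mollify_eq_convolution (u : ℝ → ℝ) :
    mollify η u = convolution (η.normed volume) u (ContinuousLinearMap.mul ℝ ℝ) volume := rfl

theorem contDiff_mollify (hu : Integrable u) : ContDiff ℝ ∞ (mollify η u) := by
  rw [mollify_eq_convolution]
  exact η.hasCompactSupport_normed.contDiff_convolution_left _ η.contDiff_normed
    hu.locallyIntegrable

theorem support_mollify_subset {r : ℝ} (hr : 0 < r) (hu : Function.support u ⊆ Metric.ball 0 r) :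
    Function.support (mollify η u) ⊆ Metric.ball 0 (η.rOut + r) := by
  have hball := ball_add_ball η.rOut_pos hr (0 : ℝ) 0
  rw [add_zero] at hball
  rw [mollify_eq_convolution, ← hball]
  exact (support_convolution_subset _).trans (add_subset_add η.support_normed_eq.subset hu)

theorem isTestFunction_mollify (hi : Integrable u) {r : ℝ} (hr : 0 < r)
    (hu : Function.support u ⊆ Metric.ball 0 r) (hη : η.rOut + r < Real.pi) :
    IsTestFunction (mollify η u) := by
  have hsub : tsupport (mollify η u) ⊆ Metric.closedBall 0 (η.rOut + r) :=
    closure_minimal ((support_mollify_subset η hr hu).trans Metric.ball_subset_closedBall)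
      Metric.isClosed_closedBall
  refine ⟨contDiff_mollify η hi, (isCompact_closedBall _ _).of_isClosed_subset
    (isClosed_tsupport _) hsub, hsub.trans ?_⟩
  rw [Real.closedBall_eq_Icc, Omega]
  exact Icc_subset_Ioo (by linarith) (by linarith)

theorem enorm_integral_normed_mul_sq_le {g : ℝ → ℝ} (hg : Measurable g) :
    ‖∫ z, η.normed volume z * g z‖ₑ ^ 2 ≤
      ∫⁻ z, ENNReal.ofReal (η.normed volume z) * ‖g z‖ₑ ^ 2 := by
  set μ := (volume : Measure ℝ).withDensity fun z => ENNReal.ofReal (η.normed volume z) with hμ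
  have hmeas : Measurable fun z => ENNReal.ofReal (η.normed volume z) :=
    η.continuous_normed.measurable.ennreal_ofReal
  have hμ_univ : μ univ = 1 := by
    rw [hμ, withDensity_apply _ MeasurableSet.univ, Measure.restrict_univ,
      ← ofReal_integral_eq_lintegral_ofReal η.integrable_normed (ae_of_all _ η.nonneg_normed),
      η.integral_normed, ENNReal.ofReal_one]
  calc ‖∫ z, η.normed volume z * g z‖ₑ ^ 2
      ≤ (∫⁻ z, ‖η.normed volume z * g z‖ₑ) ^ 2 := by
        gcongr
        exact enorm_integral_le_lintegral_enorm _
    _ = (∫⁻ z, ‖g z‖ₑ ∂μ) ^ 2 := by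
        rw [hμ, lintegral_withDensity_eq_lintegral_mul _ hmeas hg.enorm]
        simp only [Pi.mul_apply, enorm_mul, Real.enorm_of_nonneg (η.nonneg_normed _)]
    _ ≤ μ univ * ∫⁻ z, ‖g z‖ₑ ^ 2 ∂μ := sq_lintegral_le hg.enorm.aemeasurable
    _ = ∫⁻ z, ENNReal.ofReal (η.normed volume z) * ‖g z‖ₑ ^ 2 := by
        rw [hμ_univ, one_mul, hμ,
          lintegral_withDensity_eq_lintegral_mul _ hmeas (hg.enorm.pow_const 2)]
        simp only [Pi.mul_apply]

theorem integrable_normed_mul (hu : Integrable u) (x : ℝ) :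
    Integrable fun z => η.normed volume z * u (x - z) := by
  obtain ⟨M, hM⟩ := (η.hasCompactSupport_normed (μ := volume)).exists_bound_of_continuous
    η.continuous_normed
  exact (hu.comp_sub_left x).bdd_mul η.continuous_normed.aestronglyMeasurable (ae_of_all _ hM)

theorem enorm_diffQuot_mollify_sq_le (hm : Measurable u) (hu : Integrable u) (p : ℝ × ℝ) :
    ‖diffQuot α (mollify η u) p‖ₑ ^ 2 ≤
      ∫⁻ z, ENNReal.ofReal (η.normed volume z) * ‖diffQuot α u (p - (z, z))‖ₑ ^ 2 := by
  have hcomm : diffQuot α (mollify η u) p =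
      ∫ z, η.normed volume z * diffQuot α u (p - (z, z)) := by
    simp only [diffQuot, mollify]
    rw [← integral_sub (integrable_normed_mul η hu _) (integrable_normed_mul η hu _),
      ← integral_mul_const]
    congr 1 with z
    simp only [Prod.fst_sub, Prod.snd_sub, sub_sub_sub_cancel_right]
    ring
  rw [hcomm]
  exact enorm_integral_normed_mul_sq_le η ((measurable_diffQuot hm).comp (by fun_prop))

theorem lineGagliardoSq_mollify_le (hm : Measurable u) (hu : Integrable u) :
    lineGagliardoSq α (mollify η u) ≤ lineGagliardoSq α u := by
  have hmd : Measurable (diffQuot α u) := measurable_diffQuot hm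
  have hmn : Measurable (η.normed (volume : Measure ℝ)) := η.continuous_normed.measurable
  calc lineGagliardoSq α (mollify η u)
      ≤ ∫⁻ p : ℝ × ℝ, ∫⁻ z, ENNReal.ofReal (η.normed volume z) *
          ‖diffQuot α u (p - (z, z))‖ₑ ^ 2 :=
        lintegral_mono (enorm_diffQuot_mollify_sq_le η hm hu)
    _ = ∫⁻ z, ∫⁻ p : ℝ × ℝ, ENNReal.ofReal (η.normed volume z) *
          ‖diffQuot α u (p - (z, z))‖ₑ ^ 2 := by
        refine lintegral_lintegral_swap (Measurable.aemeasurable ?_)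
        unfold Function.uncurry
        fun_prop
    _ = ∫⁻ z, ENNReal.ofReal (η.normed volume z) * lineGagliardoSq α u := by
        refine lintegral_congr fun z => ?_
        rw [lintegral_const_mul _ (by fun_prop), lineGagliardoSq,
          lintegral_sub_right_eq_self (fun p => ‖diffQuot α u p‖ₑ ^ 2) (z, z)]
    _ = lineGagliardoSq α u := by
        rw [lintegral_mul_const _ (by fun_prop),
          ← ofReal_integral_eq_lintegral_ofReal η.integrable_normed (ae_of_all _ η.nonneg_normed),
          η.integral_normed, ENNReal.ofReal_one, one_mul]

theorem normed_mul_rpow_le (hα : 0 ≤ 1 + α) (hη : η.rOut = 2 * η.rIn) (z : ℝ) :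
    η.normed volume z * |z| ^ (1 + α) ≤ η.rOut ^ α := by
  have hr := η.rOut_pos
  by_cases hz : z ∈ Function.support (η.normed volume)
  · have hz' : |z| ≤ η.rOut := by
      rw [η.support_normed_eq, mem_ball_zero_iff, Real.norm_eq_abs] at hz
      exact hz.le
    have hle : η.normed volume z ≤ η.rOut⁻¹ := by
      have h := η.normed_le_div_measure_closedBall_rIn (μ := volume) z
      rwa [Real.volume_real_closedBall η.rIn_pos.le, ← hη, one_div] at h
    calc η.normed volume z * |z| ^ (1 + α) ≤ η.rOut⁻¹ * η.rOut ^ (1 + α) := by gcongr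
      _ = η.rOut ^ α := by rw [Real.rpow_add hr, Real.rpow_one, inv_mul_cancel_left₀ hr.ne']
  · rw [Function.notMem_support.1 hz, zero_mul]
    positivity

theorem enorm_mollify_sub_sq_le (hα : 0 ≤ 1 + α) (hm : Measurable u) (hu : Integrable u)
    (hη : η.rOut = 2 * η.rIn) (x : ℝ) :
    ‖mollify η u x - u x‖ₑ ^ 2 ≤
      ENNReal.ofReal (η.rOut ^ α) * ∫⁻ y, ‖diffQuot α u (x, y)‖ₑ ^ 2 := by
  have hsub : mollify η u x - u x = ∫ z, η.normed volume z * (u (x - z) - u x) := by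
    simp only [mul_sub]
    rw [integral_sub (integrable_normed_mul η hu _) (η.integrable_normed.mul_const _),
      integral_mul_const, η.integral_normed, one_mul, mollify]
  rw [hsub]
  refine (enorm_integral_normed_mul_sq_le η (by fun_prop)).trans ?_
  rw [← lintegral_sub_left_eq_self (fun y => ‖diffQuot α u (x, y)‖ₑ ^ 2) x,
    ← lintegral_const_mul' _ _ ENNReal.ofReal_ne_top]
  refine lintegral_mono fun z => ?_
  have hr := η.rOut_pos
  rw [enorm_diffQuot_sq, ← ENNReal.ofReal_mul (by positivity), enorm_sq_eq_ofReal,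
    ← ENNReal.ofReal_mul (η.nonneg_normed _), sub_sub_cancel, sub_sq_comm]
  refine ENNReal.ofReal_le_ofReal ?_
  rcases eq_or_ne z 0 with rfl | hz
  · simp only [sub_zero, sub_self, zero_pow two_ne_zero, mul_zero, zero_div, le_refl]
  have hz' : 0 < |z| ^ (1 + α) := Real.rpow_pos_of_pos (abs_pos.2 hz) _
  rw [← mul_div_assoc, le_div_iff₀ hz', mul_right_comm]
  exact mul_le_mul_of_nonneg_right (normed_mul_rpow_le η hα hη z) (sq_nonneg _)

theorem lintegral_mollify_sub_le (hα : 0 ≤ 1 + α) (hm : Measurable u) (hu : Integrable u)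
    (hη : η.rOut = 2 * η.rIn) :
    ∫⁻ x, ‖mollify η u x - u x‖ₑ ^ 2 ≤ ENNReal.ofReal (η.rOut ^ α) * lineGagliardoSq α u := by
  rw [lineGagliardoSq_eq_lintegral hm, ← lintegral_const_mul' _ _ ENNReal.ofReal_ne_top]
  exact lintegral_mono (enorm_mollify_sub_sq_le η hα hm hu hη)

end Mollify

section Dilation

theorem lintegral_comp_mul_left_le {a : ℝ} (ha : 1 ≤ a) {f : ℝ → ℝ≥0∞} (hf : Measurable f) :
    ∫⁻ x, f (a * x) ≤ ∫⁻ x, f x := by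
  have ha₀ : 0 < a := zero_lt_one.trans_le ha
  rw [← lintegral_map hf (measurable_const_mul a), Real.map_volume_mul_left ha₀.ne',
    lintegral_smul_measure]
  refine mul_le_of_le_one_left zero_le ?_
  rw [ENNReal.ofReal_le_one, abs_of_pos (inv_pos.2 ha₀)]
  exact inv_le_one_of_one_le₀ ha

theorem lineGagliardoSq_comp_mul_left_le {α a : ℝ} (ha : 1 ≤ a) {u : ℝ → ℝ} (hm : Measurable u) :
    lineGagliardoSq α (fun x => u (a * x)) ≤
      ENNReal.ofReal (a ^ (1 + α)) * lineGagliardoSq α u := by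
  have ha₀ : 0 < a := zero_lt_one.trans_le ha
  have hmd : Measurable (diffQuot α u) := measurable_diffQuot hm
  have hscale (x y : ℝ) : ‖diffQuot α (fun x => u (a * x)) (x, y)‖ₑ ^ 2 =
      ENNReal.ofReal (a ^ (1 + α)) * ‖diffQuot α u (a * x, a * y)‖ₑ ^ 2 := by
    have hpow : a ^ (1 + α) ≠ 0 := (Real.rpow_pos_of_pos ha₀ _).ne'
    rw [enorm_diffQuot_sq, enorm_diffQuot_sq, ← ENNReal.ofReal_mul (by positivity), ← mul_sub,
      abs_mul, abs_of_pos ha₀, Real.mul_rpow ha₀.le (abs_nonneg _), ← mul_div_assoc,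
      mul_div_mul_left _ _ hpow]
  rw [lineGagliardoSq_eq_lintegral (by fun_prop), lineGagliardoSq_eq_lintegral hm]
  simp only [hscale, lintegral_const_mul' _ _ ENNReal.ofReal_ne_top]
  gcongr _ * ?_
  calc ∫⁻ x, ∫⁻ y, ‖diffQuot α u (a * x, a * y)‖ₑ ^ 2
      ≤ ∫⁻ x, ∫⁻ y, ‖diffQuot α u (a * x, y)‖ₑ ^ 2 :=
        lintegral_mono fun x => lintegral_comp_mul_left_le ha
          (f := fun y => ‖diffQuot α u (a * x, y)‖ₑ ^ 2) (by fun_prop)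
    _ ≤ ∫⁻ x, ∫⁻ y, ‖diffQuot α u (x, y)‖ₑ ^ 2 :=
        lintegral_comp_mul_left_le ha (f := fun x => ∫⁻ y, ‖diffQuot α u (x, y)‖ₑ ^ 2)
          (Measurable.lintegral_prod_right' (f := fun p => ‖diffQuot α u p‖ₑ ^ 2) (by fun_prop))

theorem tendsto_integral_comp_mul_left {u : ℝ → ℝ} (hu : Integrable u)
    (b : BoundedContinuousFunction ℝ ℝ) {a : ℕ → ℝ} (ha₀ : ∀ n, 0 < a n)
    (ha : Tendsto a atTop (𝓝 1)) :
    Tendsto (fun n => ∫ x, u (a n * x) * b x) atTop (𝓝 (∫ x, u x * b x)) := by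
  have hinv : Tendsto (fun n => (a n)⁻¹) atTop (𝓝 1) := by
    simpa only [inv_one] using ha.inv₀ one_ne_zero
  have hsubst (n : ℕ) : ∫ x, u (a n * x) * b x = (a n)⁻¹ * ∫ y, u y * b ((a n)⁻¹ * y) := by
    have h := Measure.integral_comp_mul_left (fun y => u y * b ((a n)⁻¹ * y)) (a n)
    rw [abs_of_pos (inv_pos.2 (ha₀ n)), smul_eq_mul] at h
    simpa only [inv_mul_cancel_left₀ (ha₀ n).ne'] using h
  simp only [hsubst]
  rw [← one_mul (∫ x, u x * b x)]
  refine hinv.mul (tendsto_integral_of_dominated_convergence (fun x => ‖u x‖ * ‖b‖) (fun n => ?_)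
    (hu.norm.mul_const _) (fun n => ae_of_all _ fun x => ?_) (ae_of_all _ fun x => ?_))
  · exact hu.aestronglyMeasurable.mul
      (b.continuous.comp (continuous_const_mul _)).aestronglyMeasurable
  · rw [norm_mul]
    exact mul_le_mul_of_nonneg_left (b.norm_coe_le_norm _) (norm_nonneg _)
  · refine tendsto_const_nhds.mul ((b.continuous.tendsto x).comp ?_)
    simpa only [one_mul] using hinv.mul_const x

end Dilation

namespace H0Space

variable {α : ℝ}

/-- The elements of `H₀^{α/2}(Ω)` represented by test functions. -/
def testElements (α : ℝ) : Set (H0Space α) :=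
  {v | ∃ φ, IsTestFunction φ ∧ zeroExt (incl α v) =ᵐ[volume] φ}

theorem exists_zeroExt_incl_ae_eq_of_isTestFunction (hα₀ : 0 < α) (hα₂ : α < 2) {φ : ℝ → ℝ}
    (hφ : IsTestFunction φ) : ∃ v : H0Space α, zeroExt (incl α v) =ᵐ[volume] φ := by
  obtain ⟨hsmooth, hc, hsupp⟩ := hφ
  refine exists_zeroExt_incl_ae_eq hsmooth.continuous.measurable
    ((subset_tsupport φ).trans hsupp) ?_
    (lineGagliardoSq_lt_top_of_contDiff hα₀ hα₂ (hsmooth.of_le (mod_cast le_top)) hc)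
  rw [← eLpNorm_two_sq]
  exact ENNReal.pow_lt_top (hsmooth.continuous.memLp_of_hasCompactSupport hc).2

theorem norm_diff_sq_le_of_lineGagliardoSq_le {v v' : H0Space α} {w : ℝ → ℝ} {c : ℝ} (hc : 0 ≤ c)
    (hv' : zeroExt (incl α v') =ᵐ[volume] w)
    (h : lineGagliardoSq α w ≤ ENNReal.ofReal c * lineGagliardoSq α (zeroExt (incl α v))) :
    ‖diff α v'‖ ^ 2 ≤ c * ‖diff α v‖ ^ 2 := by
  rw [← lineGagliardoSq_congr hv', ← enorm_diff_sq, ← enorm_diff_sq] at h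
  simpa [ENNReal.toReal_mul, ENNReal.toReal_ofReal hc] using
    norm_sq_le_toReal (ENNReal.mul_ne_top ENNReal.ofReal_ne_top
      (ENNReal.pow_ne_top enorm_ne_top)) h

theorem exists_mem_testElements_norm_sub_le (hα₀ : 0 < α) (hα₂ : α < 2) {v : H0Space α}
    {w : ℝ → ℝ} (hm : Measurable w) (hi : Integrable w) {r δ : ℝ} (hr : 0 < r) (hδ : 0 < δ)
    (hrδ : δ + r < Real.pi) (hw : Function.support w ⊆ Metric.ball 0 r)
    (hv : zeroExt (incl α v) =ᵐ[volume] w) :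
    ∃ z ∈ testElements α, ‖diff α z‖ ^ 2 ≤ ‖diff α v‖ ^ 2 ∧
      ‖incl α z - incl α v‖ ^ 2 ≤ δ ^ α * ‖diff α v‖ ^ 2 := by
  let η : ContDiffBump (0 : ℝ) := ⟨δ / 2, δ, half_pos hδ, half_lt_self hδ⟩
  have hη : η.rOut = 2 * η.rIn := (mul_div_cancel₀ δ two_ne_zero).symm
  have htest : IsTestFunction (mollify η w) := isTestFunction_mollify η hi hr hw hrδ
  obtain ⟨z, hz⟩ := exists_zeroExt_incl_ae_eq_of_isTestFunction hα₀ hα₂ htest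
  refine ⟨z, ⟨_, htest, hz⟩, ?_, ?_⟩
  · rw [← one_mul (‖diff α v‖ ^ 2)]
    refine norm_diff_sq_le_of_lineGagliardoSq_le zero_le_one hz ?_
    rw [ENNReal.ofReal_one, one_mul, lineGagliardoSq_congr hv]
    exact lineGagliardoSq_mollify_le η hm hi
  · have h : ‖incl α z - incl α v‖ₑ ^ 2 ≤ ENNReal.ofReal (δ ^ α) * ‖diff α v‖ₑ ^ 2 := by
      rw [enorm_sub_sq_of_zeroExt_ae_eq hz hv, enorm_diff_sq, lineGagliardoSq_congr hv]
      exact lintegral_mollify_sub_le η (by linarith) hm hi hη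
    simpa [ENNReal.toReal_mul, ENNReal.toReal_ofReal (Real.rpow_nonneg hδ.le α)] using
      norm_sq_le_toReal (ENNReal.mul_ne_top ENNReal.ofReal_ne_top
        (ENNReal.pow_ne_top enorm_ne_top)) h

theorem support_zeroExt_comp_mul_left_subset {a : ℝ} (ha : 0 < a) (u : L2Omega) :
    Function.support (fun x => zeroExt u (a * x)) ⊆ Metric.ball 0 (Real.pi / a) := by
  intro x hx
  have h : |a * x| < Real.pi := abs_lt.2 (support_zeroExt_subset u hx)
  rw [abs_mul, abs_of_pos ha] at h
  rwa [mem_ball_zero_iff, Real.norm_eq_abs, lt_div_iff₀' ha]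

theorem exists_dilation {a : ℝ} (ha : 1 ≤ a) (v : H0Space α) :
    ∃ v' : H0Space α, zeroExt (incl α v') =ᵐ[volume] (fun x => zeroExt (incl α v) (a * x)) ∧
      ‖diff α v'‖ ^ 2 ≤ a ^ (1 + α) * ‖diff α v‖ ^ 2 := by
  have ha₀ : 0 < a := zero_lt_one.trans_le ha
  have hm := measurable_zeroExt (incl α v)
  have hgag := lineGagliardoSq_comp_mul_left_le (α := α) ha hm
  have hsq := lintegral_comp_mul_left_le ha (f := fun x => ‖zeroExt (incl α v) x‖ₑ ^ 2)
    (by fun_prop)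
  obtain ⟨v', hv'⟩ := exists_zeroExt_incl_ae_eq (α := α) (hm.comp (measurable_const_mul a))
    ((support_zeroExt_comp_mul_left_subset ha₀ _).trans <| by
      rw [Real.ball_eq_Ioo, zero_sub, zero_add, Omega]
      have := div_le_self Real.pi_pos.le ha
      exact Ioo_subset_Ioo (neg_le_neg this) this)
    (hsq.trans_lt <| by
      rw [lintegral_enorm_zeroExt_sq]
      exact ENNReal.pow_lt_top enorm_lt_top)
    (hgag.trans_lt (ENNReal.mul_lt_top ENNReal.ofReal_lt_top (lineGagliardoSq_ne_top v).lt_top))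
  exact ⟨v', hv', norm_diff_sq_le_of_lineGagliardoSq_le (by positivity) hv' hgag⟩

theorem inner_toLp_incl (b : BoundedContinuousFunction ℝ ℝ) {v : H0Space α} {w : ℝ → ℝ}
    (hv : zeroExt (incl α v) =ᵐ[volume] w) :
    ⟪BoundedContinuousFunction.toLp 2 (volume.restrict Omega) ℝ b, incl α v⟫_ℝ =
      ∫ x, w x * b x := by
  calc ⟪BoundedContinuousFunction.toLp 2 (volume.restrict Omega) ℝ b, incl α v⟫_ℝ
      = ∫ x in Omega, zeroExt (incl α v) x * b x := by
        rw [inner_eq_integral_of_zeroExt_ae_eq _ EventuallyEq.rfl]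
        refine integral_congr_ae ?_
        filter_upwards [BoundedContinuousFunction.coeFn_toLp (volume.restrict Omega) ℝ b (p := 2)]
          with x hx
        rw [hx, mul_comm]
    _ = ∫ x, zeroExt (incl α v) x * b x :=
        setIntegral_eq_integral_of_forall_compl_eq_zero fun x hx => by
          rw [zeroExt, indicator_of_notMem hx, zero_mul]
    _ = ∫ x, w x * b x := integral_congr_ae (hv.mono fun x hx => by simp only [hx])

theorem exists_mem_testElements_near_dilation (hα₀ : 0 < α) (hα₂ : α < 2) (v : H0Space α) {t : ℝ}
    (ht₀ : 0 < t) (ht₁ : t ≤ 1) :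
    ∃ z ∈ testElements α, ∃ v' : H0Space α,
      zeroExt (incl α v') =ᵐ[volume] (fun x => zeroExt (incl α v) ((1 + t) * x)) ∧
      ‖diff α z‖ ^ 2 ≤ 2 ^ (1 + α) * ‖diff α v‖ ^ 2 ∧
      ‖incl α z - incl α v'‖ ^ 2 ≤ t ^ α * (2 ^ (1 + α) * ‖diff α v‖ ^ 2) := by
  have hpos : 0 < 1 + t := by linarith
  obtain ⟨v', hv', hdiff⟩ := exists_dilation (show 1 ≤ 1 + t by linarith) v
  have hdiff₂ : ‖diff α v'‖ ^ 2 ≤ 2 ^ (1 + α) * ‖diff α v‖ ^ 2 :=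
    hdiff.trans (by gcongr; linarith)
  have hroom : t + Real.pi / (1 + t) < Real.pi := by
    rw [← lt_sub_iff_add_lt', div_lt_iff₀ hpos]
    nlinarith [Real.pi_gt_three]
  obtain ⟨z, hz, hzdiff, hzincl⟩ := exists_mem_testElements_norm_sub_le hα₀ hα₂
    ((measurable_zeroExt _).comp (measurable_const_mul _))
    ((integrable_zeroExt _).comp_mul_left' hpos.ne') (div_pos Real.pi_pos hpos) ht₀ hroom
    (support_zeroExt_comp_mul_left_subset hpos _) hv'
  exact ⟨z, hz, v', hv', hzdiff.trans hdiff₂, hzincl.trans (by gcongr)⟩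

theorem dense_span_testElements (hα₀ : 0 < α) (hα₂ : α < 2) :
    Dense (Submodule.span ℝ (testElements α) : Set (H0Space α)) := by
  refine Submodule.dense_iff_topologicalClosure_eq_top.2 (eq_top_iff.2 fun v _ => ?_)
  let t : ℕ → ℝ := fun n => 1 / (n + 1)
  have ht₀ (n : ℕ) : 0 < t n := Nat.one_div_pos_of_nat
  have ht₁ (n : ℕ) : t n ≤ 1 := div_le_one_of_le₀ (by simp) (by positivity)
  have ht : Tendsto t atTop (𝓝 0) := tendsto_one_div_add_atTop_nhds_zero_nat
  choose z hz v' hv' hdiff hincl using fun n =>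
    exists_mem_testElements_near_dilation hα₀ hα₂ v (ht₀ n) (ht₁ n)
  set c := 2 ^ (1 + α) * ‖diff α v‖ ^ 2
  have hbound (n : ℕ) : ‖z n‖ ≤ √(((3 * Real.pi) ^ (1 + α) / Real.pi + 1) * c) := by
    refine Real.le_sqrt_of_sq_le ((norm_sq_le_mul_norm_diff_sq (by linarith) (z n)).trans ?_)
    gcongr
    exact hdiff n
  have hnear : Tendsto (fun n => incl α (z n) - incl α (v' n)) atTop (𝓝 0) := by
    have hpow := (ht.rpow_const (p := α) (Or.inr hα₀.le)).mul_const c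
    rw [Real.zero_rpow hα₀.ne', zero_mul] at hpow
    have hsq := squeeze_zero (fun n => sq_nonneg _) hincl hpow
    rw [tendsto_zero_iff_norm_tendsto_zero]
    simpa only [Real.sqrt_sq (norm_nonneg _), Real.sqrt_zero] using hsq.sqrt
  refine mem_topologicalClosure_of_tendsto_inner incl_injective
    (C := Real.toNNReal _) (fun n => (hbound n).trans (Real.le_coe_toNNReal _))
    (fun n => Submodule.subset_span (hz n))
    (BoundedContinuousFunction.toLp_denseRange (p := 2) (μ := volume.restrict Omega) (E := ℝ)
      ℝ (by norm_num)) ?_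
  rintro _ ⟨b, rfl⟩
  have hdil := tendsto_integral_comp_mul_left (integrable_zeroExt (incl α v)) b
    (fun n => add_pos zero_lt_one (ht₀ n)) (by simpa only [add_zero] using ht.const_add 1)
  rw [← inner_toLp_incl b EventuallyEq.rfl] at hdil
  simp only [← inner_toLp_incl b (hv' _)] at hdil
  have hsmall := (tendsto_const_nhds
    (x := BoundedContinuousFunction.toLp 2 (volume.restrict Omega) ℝ b)).inner (𝕜 := ℝ) hnear
  simpa only [← inner_add_right, add_sub_cancel, inner_zero_right, add_zero] using
    hdil.add hsmall

end H0Space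

section FormOperator

variable {V X : Type*} [NormedAddCommGroup V] [InnerProductSpace ℝ V]
  [NormedAddCommGroup X] [InnerProductSpace ℝ X] {ι : Type*} {j : V →L[ℝ] X} {γ : ℝ}

theorem DiagonalForm.exists_dirichletForm_eq_iff (Φ : DiagonalForm ι j γ) (u h : X) :
    (∃ v, j v = u ∧ ∀ z, dirichletForm j γ v z = ⟪h, j z⟫_ℝ) ↔
      ∀ i, ⟪Φ.e i, h⟫_ℝ = Φ.eig i * ⟪Φ.e i, u⟫_ℝ := by
  have hb (i : ι) (v : V) : dirichletForm j γ v (Φ.b i) = ⟪h, j (Φ.b i)⟫_ℝ ↔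
      ⟪Φ.e i, h⟫_ℝ = Φ.eig i * ⟪Φ.e i, j v⟫_ℝ := by
    rw [Φ.dirichletForm_b, Φ.apply_b, inner_smul_right, Φ.inner_apply, real_inner_comm (Φ.e i),
      eq_comm, mul_assoc, sq, mul_assoc, mul_right_inj' (Φ.σ_pos i).ne', mul_left_comm]
  constructor
  · rintro ⟨v, rfl, hv⟩ i
    exact (hb i v).1 (hv _)
  · intro hi
    have hγ := Φ.γ_pos.ne'
    have hk (i : ι) : ⟪Φ.e i, γ⁻¹ • h + u⟫_ℝ = (Φ.σ i)⁻¹ ^ 2 * ⟪Φ.e i, u⟫_ℝ := by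
      rw [inner_add_right, inner_smul_right, hi, eig]
      field_simp
      ring
    obtain ⟨v, hv⟩ := exists_forall_inner_hilbertBasis_eq Φ.b
      (a := fun i => Φ.σ i * ⟪Φ.e i, γ⁻¹ • h + u⟫_ℝ)
      ((hasSum_inner_hilbertBasis_sq Φ.e _).summable.of_nonneg_of_le (fun i => sq_nonneg _)
        fun i => by
          rw [mul_pow]
          exact mul_le_of_le_one_left (sq_nonneg _)
            (pow_le_one₀ (Φ.σ_pos i).le (Φ.σ_le_one i)))
    have hjv : j v = u := eq_of_forall_inner_hilbertBasis_eq Φ.e fun i => by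
      have hσ := (Φ.σ_pos i).ne'
      rw [Φ.inner_apply, hv, hk]
      field_simp
    refine ⟨v, hjv, DFunLike.congr_fun (g := (innerSL ℝ h).comp j) <| ContinuousLinearMap.ext_on
      (Submodule.dense_iff_topologicalClosure_eq_top.2 Φ.b.dense_span) ?_⟩
    rintro _ ⟨i, rfl⟩
    exact (hb i v).2 (by rw [hjv, hi])

end FormOperator

section FractionalLaplacian

variable {α : ℝ} (hα₀ : 0 < α) (hα₂ : α < 2)

include hα₀ hα₂

theorem fracLapConst_pos : 0 < fracLapConst α := by
  have hden : 0 < 1 - α / 2 := by linarith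
  unfold fracLapConst
  positivity

namespace H0Space

omit hα₀ hα₂ in
theorem dirichletForm_incl (γ : ℝ) (v w : H0Space α) :
    dirichletForm (incl α) γ v w = γ * ⟪diff α v, diff α w⟫_ℝ := by
  rw [dirichletForm_apply, inner_eq, add_sub_cancel_left]

theorem dirichletForm_incl_eq_integral_mul_fracLap {φ : ℝ → ℝ} (hφ : IsTestFunction φ)
    (v : H0Space α) {z : H0Space α} (hz : zeroExt (incl α z) =ᵐ[volume] φ) :
    dirichletForm (incl α) (fracLapConst α / 2) v z = ∫ x in Omega, incl α v x * fracLap α φ x := by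
  have hφ₂ : ContDiff ℝ 2 φ := contDiff_infty.1 hφ.1 2
  have hae : (fun p : ℝ × ℝ => ⟪diff α v p, diff α z p⟫_ℝ) =ᵐ[volume]
      fun p => diffQuot α (zeroExt (incl α v)) p * diffQuot α φ p := by
    filter_upwards [diff_ae_eq v, diff_ae_eq z, diffQuot_congr (α := α) hz] with p hv hz hφ
    rw [hv, hz, hφ, RCLike.inner_apply, conj_trivial, mul_comm]
  have hint : Integrable fun p => diffQuot α (zeroExt (incl α v)) p * diffQuot α φ p :=
    (L2.integrable_inner (𝕜 := ℝ) (diff α v) (diff α z)).congr hae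
  calc dirichletForm (incl α) (fracLapConst α / 2) v z
      = fracLapConst α / 2 * (2 * ∫ x, zeroExt (incl α v) x * levyLap α φ x) := by
        rw [dirichletForm_incl, L2.inner_def, integral_congr_ae hae,
          integral_diffQuot_mul_diffQuot hα₀ hα₂ hφ₂ hφ.2.1 (integrable_zeroExt _) hint]
    _ = ∫ x, zeroExt (incl α v) x * fracLap α φ x := by
        rw [← mul_assoc, div_mul_cancel₀ _ two_ne_zero, ← integral_const_mul]
        refine integral_congr_ae (ae_of_all _ fun x => ?_)
        simp only [fracLap_eq hα₀ hα₂ hφ₂ hφ.2.1, mul_left_comm]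
    _ = ∫ x in Omega, zeroExt (incl α v) x * fracLap α φ x :=
        (setIntegral_eq_integral_of_forall_compl_eq_zero fun x hx => by
          rw [zeroExt, indicator_of_notMem hx, zero_mul]).symm
    _ = ∫ x in Omega, incl α v x * fracLap α φ x :=
        setIntegral_congr_fun measurableSet_Omega fun x hx => by
          simp only [zeroExt, indicator_of_mem hx]

theorem hasFracLap_iff (u h : L2Omega) : HasFracLap α u h ↔ ∃ v : H0Space α, incl α v = u ∧
    ∀ z, dirichletForm (incl α) (fracLapConst α / 2) v z = ⟪h, incl α z⟫_ℝ := by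
  rw [HasFracLap, memH0_iff]
  constructor
  · rintro ⟨⟨v, rfl⟩, hv⟩
    refine ⟨v, rfl, DFunLike.congr_fun (g := (innerSL ℝ h).comp (incl α)) <|
      ContinuousLinearMap.ext_on (dense_span_testElements hα₀ hα₂) ?_⟩
    rintro z ⟨φ, hφ, hz⟩
    rw [dirichletForm_incl_eq_integral_mul_fracLap hα₀ hα₂ hφ v hz, hv φ hφ,
      ← inner_eq_integral_of_zeroExt_ae_eq h hz]
    rfl
  · rintro ⟨v, rfl, hv⟩
    refine ⟨⟨v, rfl⟩, fun φ hφ => ?_⟩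
    obtain ⟨z, hz⟩ := exists_zeroExt_incl_ae_eq_of_isTestFunction hα₀ hα₂ hφ
    rw [← dirichletForm_incl_eq_integral_mul_fracLap hα₀ hα₂ hφ v hz, hv,
      inner_eq_integral_of_zeroExt_ae_eq h hz]

theorem eq_zero_of_forall_inner_incl {h : L2Omega} (hh : ∀ v : H0Space α, ⟪h, incl α v⟫_ℝ = 0) :
    h = 0 := by
  have hloc : LocallyIntegrableOn h Omega :=
    IntegrableOn.locallyIntegrableOn ((Lp.memLp h).integrable (by norm_num))
  have hae : ∀ᵐ x, x ∈ Omega → h x = 0 := by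
    refine IsOpen.ae_eq_zero_of_integral_contDiff_smul_eq_zero isOpen_Ioo hloc
      fun φ hsmooth hcomp hsupp => ?_
    obtain ⟨v, hv⟩ := exists_zeroExt_incl_ae_eq_of_isTestFunction hα₀ hα₂ ⟨hsmooth, hcomp, hsupp⟩
    rw [← hh v, inner_eq_integral_of_zeroExt_ae_eq h hv,
      ← setIntegral_eq_integral_of_forall_compl_eq_zero (s := Omega) fun x hx => by
        rw [image_eq_zero_of_notMem_tsupport fun hφ => hx (hsupp hφ), zero_smul]]
    simp only [smul_eq_mul, mul_comm]
  rw [Lp.eq_zero_iff_ae_eq_zero]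
  exact (ae_restrict_iff' measurableSet_Omega).2 hae

theorem exists_diagonalForm_incl :
    ∃ ι : Type, Nonempty (DiagonalForm ι (incl α) (fracLapConst α / 2)) :=
  exists_diagonalForm (isCompactOperator_incl hα₀) incl_injective
    (fun _ => eq_zero_of_forall_inner_incl hα₀ hα₂) norm_incl_le
    (half_pos (fracLapConst_pos hα₀ hα₂))

variable {ι : Type*} (Φ : DiagonalForm ι (incl α) (fracLapConst α / 2))

theorem isFracHeatSemigroup_heat : IsFracHeatSemigroup α Φ.heat where
  zero := Φ.heat_zero
  add _ _ := Φ.heat_add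
  continuousOn := Φ.continuousOn_heat
  generator w h := by
    rw [Φ.tendsto_heat_iff, hasFracLap_iff hα₀ hα₂, Φ.exists_dirichletForm_eq_iff]
    simp only [inner_neg_right, neg_eq_iff_eq_neg]

theorem eq_heat_of_isFracHeatSemigroup {S : ℝ → L2Omega →L[ℝ] L2Omega}
    (hS : IsFracHeatSemigroup α S) {t : ℝ} (ht : 0 ≤ t) : S t = Φ.heat t := by
  have hheat := isFracHeatSemigroup_heat hα₀ hα₂ Φ
  refine Φ.eq_heat_of_generator hS.zero hS.add hS.continuousOn (fun i => ?_) ht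
  classical
  rw [hS.generator, ← hheat.generator, Φ.tendsto_heat_iff]
  intro k
  rw [inner_smul_right, orthonormal_iff_ite.1 Φ.e.orthonormal]
  split_ifs with hki
  · rw [hki, neg_mul]
  · simp only [mul_zero, neg_zero]

end H0Space

end FractionalLaplacian

/-! ### Superposition operators -/

section Superposition

variable {Y V : Type*} [MeasurableSpace Y] {μ : Measure Y} [NormedAddCommGroup V] [NormedSpace ℝ V]
  {j : V →L[ℝ] Lp ℝ 2 μ} {N : V → Lp ℝ 2 μ} {f : ℝ → ℝ}

theorem enorm_sub_mul_measure_rpow_le (hN : ∀ v, N v =ᵐ[μ] fun x => f (j v x)) {w : V} {s : Set Y}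
    (hs : μ s ≠ 0) (hw : ∀ᵐ x ∂μ.restrict s, j w x = 1) (c d : ℝ) :
    ‖f c - f d‖ₑ * μ s ^ (1 / 2 : ℝ) ≤ ‖N (c • w) - N (d • w)‖ₑ := by
  have hval (c : ℝ) : ∀ᵐ x ∂μ.restrict s, N (c • w) x = f c := by
    filter_upwards [ae_restrict_of_ae (hN (c • w)), hw,
      ae_restrict_of_ae (Lp.coeFn_smul c (j w))] with x hx hx₁ hxc
    rw [hx, map_smul, hxc, Pi.smul_apply, hx₁, smul_eq_mul, mul_one]
  calc ‖f c - f d‖ₑ * μ s ^ (1 / 2 : ℝ)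
      = eLpNorm (fun _ => f c - f d) 2 (μ.restrict s) := by
        rw [eLpNorm_const _ two_ne_zero (by simpa using hs), Measure.restrict_apply_univ,
          ENNReal.toReal_ofNat]
    _ = eLpNorm (N (c • w) - N (d • w) : Lp ℝ 2 μ) 2 (μ.restrict s) := by
        refine eLpNorm_congr_ae ?_
        filter_upwards [hval c, hval d, ae_restrict_of_ae (Lp.coeFn_sub (N (c • w)) (N (d • w)))]
          with x hxc hxd hx
        rw [hx, Pi.sub_apply, hxc, hxd]
    _ ≤ ‖N (c • w) - N (d • w)‖ₑ := by
        rw [Lp.enorm_def]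
        exact eLpNorm_restrict_le _ _ _ _

theorem continuous_of_continuous_superposition (hN : ∀ v, N v =ᵐ[μ] fun x => f (j v x))
    (hcont : Continuous N) {w : V} {s : Set Y} (hs : μ s ≠ 0)
    (hw : ∀ᵐ x ∂μ.restrict s, j w x = 1) : Continuous f := by
  have hs' : μ s ^ (1 / 2 : ℝ) ≠ 0 := by simpa using hs
  refine continuous_iff_continuousAt.2 fun d => tendsto_iff_edist_tendsto_0.2 ?_
  have hlim : Tendsto (fun c : ℝ => ‖N (c • w) - N (d • w)‖ₑ / μ s ^ (1 / 2 : ℝ)) (𝓝 d) (𝓝 0) := by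
    have hnum : Continuous fun c : ℝ => ‖N (c • w) - N (d • w)‖ₑ := by fun_prop
    have := ENNReal.Tendsto.div_const (hnum.tendsto d) (Or.inr hs')
    rwa [sub_self, enorm_zero, ENNReal.zero_div] at this
  refine tendsto_of_tendsto_of_tendsto_of_le_of_le tendsto_const_nhds hlim (fun _ => zero_le)
    fun c => ?_
  rw [edist_eq_enorm_sub]
  exact (ENNReal.le_div_iff_mul_le (Or.inl hs') (Or.inr enorm_ne_top)).2
    (enorm_sub_mul_measure_rpow_le hN hs hw c d)

/-- The primitive of `f` vanishing at `0`. -/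
def primitive (f : ℝ → ℝ) (s : ℝ) : ℝ := ∫ σ in (0 : ℝ)..s, f σ

variable (j f) in
/-- The potential `v ↦ ∫ F (j v)` of the superposition operator `v ↦ f (j v)`, where `F` is the
primitive of `f`. -/
def potential (v : V) : ℝ := ∫ x, primitive f (j v x) ∂μ

theorem primitive_add_sub (hf : Continuous f) (s δ : ℝ) :
    primitive f (s + δ) - primitive f s - f s * δ =
      ∫ θ in (0 : ℝ)..1, δ * (f (s + θ * δ) - f s) := by
  have hint (a b : ℝ) : IntervalIntegrable f volume a b := hf.intervalIntegrable a b
  have hsub : ∫ σ in s..s + δ, f σ = δ * ∫ θ in (0 : ℝ)..1, f (s + θ * δ) := by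
    simp only [mul_comm _ δ, intervalIntegral.mul_integral_comp_add_mul, mul_zero, add_zero,
      mul_one]
  rw [primitive, primitive, intervalIntegral.integral_interval_sub_left (hint _ _) (hint _ _), hsub,
    intervalIntegral.integral_const_mul, intervalIntegral.integral_sub
      (Continuous.intervalIntegrable (by fun_prop) _ _) intervalIntegrable_const,
    intervalIntegral.integral_const, sub_zero, one_smul, mul_sub, mul_comm δ (f s)]

theorem coe_add_smul_ae_eq (v d : V) (θ : ℝ) :
    j (v + θ • d) =ᵐ[μ] fun x => j v x + θ * j d x := by
  rw [map_add, map_smul]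
  filter_upwards [Lp.coeFn_add (j v) (θ • j d), Lp.coeFn_smul θ (j d)] with x hadd hsmul
  rw [hadd, Pi.add_apply, hsmul, Pi.smul_apply, smul_eq_mul]

theorem lintegral_mul_superposition_sub_le (hN : ∀ v, N v =ᵐ[μ] fun x => f (j v x)) (v d : V)
    (θ : ℝ) :
    ∫⁻ x, ‖j d x * (f (j v x + θ * j d x) - f (j v x))‖ₑ ∂μ ≤
      ‖j d‖ₑ * ‖N (v + θ • d) - N v‖ₑ := by
  have hsub : N (v + θ • d) - N v =ᵐ[μ] fun x => f (j v x + θ * j d x) - f (j v x) := by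
    filter_upwards [Lp.coeFn_sub (N (v + θ • d)) (N v), hN (v + θ • d), hN v,
      coe_add_smul_ae_eq v d θ] with x hx hx₁ hx₂ hx₃
    rw [hx, Pi.sub_apply, hx₁, hx₂, hx₃]
  have hholder := eLpNorm_smul_le_mul_eLpNorm (p := 2) (q := 2) (r := 1)
    (Lp.aestronglyMeasurable (N (v + θ • d) - N v)) (Lp.aestronglyMeasurable (j d))
  rw [eLpNorm_one_eq_lintegral_enorm, ← Lp.enorm_def, ← Lp.enorm_def] at hholder
  refine (lintegral_congr_ae ?_).trans_le hholder
  filter_upwards [hsub] with x hx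
  rw [Pi.smul_apply', hx, smul_eq_mul]

theorem lintegral_primitive_remainder_le [SFinite μ] (hf : Continuous f)
    (hN : ∀ v, N v =ᵐ[μ] fun x => f (j v x)) (v d : V) :
    ∫⁻ x, ‖primitive f (j (v + d) x) - primitive f (j v x) - f (j v x) * j d x‖ₑ ∂μ ≤
      ∫⁻ θ in Ioc (0 : ℝ) 1, ‖j d‖ₑ * ‖N (v + θ • d) - N v‖ₑ := by
  have hmeas (v : V) : Measurable (j v) := (Lp.stronglyMeasurable _).measurable
  have hadd := coe_add_smul_ae_eq (j := j) v d 1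
  simp only [one_smul, one_mul] at hadd
  calc ∫⁻ x, ‖primitive f (j (v + d) x) - primitive f (j v x) - f (j v x) * j d x‖ₑ ∂μ
      ≤ ∫⁻ x, (∫⁻ θ in Ioc (0 : ℝ) 1, ‖j d x * (f (j v x + θ * j d x) - f (j v x))‖ₑ) ∂μ := by
        refine lintegral_mono_ae (hadd.mono fun x hx => ?_)
        rw [hx, primitive_add_sub hf, intervalIntegral.integral_of_le zero_le_one]
        exact enorm_integral_le_lintegral_enorm _
    _ = ∫⁻ θ in Ioc (0 : ℝ) 1, ∫⁻ x, ‖j d x * (f (j v x + θ * j d x) - f (j v x))‖ₑ ∂μ := by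
        have hv : Measurable fun p : Y × ℝ => j v p.1 := (hmeas v).comp measurable_fst
        have hd : Measurable fun p : Y × ℝ => j d p.1 := (hmeas d).comp measurable_fst
        exact lintegral_lintegral_swap (hd.mul ((hf.measurable.comp
          (hv.add (measurable_snd.mul hd))).sub (hf.measurable.comp hv))).enorm.aemeasurable
    _ ≤ ∫⁻ θ in Ioc (0 : ℝ) 1, ‖j d‖ₑ * ‖N (v + θ • d) - N v‖ₑ :=
        lintegral_mono fun θ => lintegral_mul_superposition_sub_le hN v d θ

theorem lintegral_primitive_remainder_le_of_lipschitzOnWith [SFinite μ] (hf : Continuous f)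
    (hN : ∀ v, N v =ᵐ[μ] fun x => f (j v x)) {R : ℝ} {L : ℝ≥0}
    (hL : LipschitzOnWith L N (Metric.closedBall 0 R)) {v d : V} (hR : ‖v‖ + ‖d‖ ≤ R) :
    ∫⁻ x, ‖primitive f (j (v + d) x) - primitive f (j v x) - f (j v x) * j d x‖ₑ ∂μ ≤
      ENNReal.ofReal (‖j‖ * L * ‖d‖ ^ 2) := by
  refine (lintegral_primitive_remainder_le hf hN v d).trans ?_
  calc ∫⁻ θ in Ioc (0 : ℝ) 1, ‖j d‖ₑ * ‖N (v + θ • d) - N v‖ₑ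
      ≤ ∫⁻ _ in Ioc (0 : ℝ) 1, ENNReal.ofReal (‖j‖ * L * ‖d‖ ^ 2) := by
        refine setLIntegral_mono measurable_const fun θ hθ => ?_
        have hθd : ‖θ • d‖ ≤ ‖d‖ := by
          rw [norm_smul, Real.norm_of_nonneg hθ.1.le]
          exact mul_le_of_le_one_left (norm_nonneg _) hθ.2
        have hlip : ‖N (v + θ • d) - N v‖ ≤ L * ‖d‖ := by
          refine (hL.norm_sub_le ?_ ?_).trans ?_
          · exact mem_closedBall_zero_iff.2 ((norm_add_le _ _).trans (by linarith))
          · exact mem_closedBall_zero_iff.2 (by linarith [norm_nonneg d])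
          · rw [add_sub_cancel_left]
            gcongr
        rw [← ofReal_norm, ← ofReal_norm, ← ENNReal.ofReal_mul (norm_nonneg _)]
        refine ENNReal.ofReal_le_ofReal ?_
        calc ‖j d‖ * ‖N (v + θ • d) - N v‖ ≤ (‖j‖ * ‖d‖) * (L * ‖d‖) := by
              gcongr
              exact j.le_opNorm d
          _ = ‖j‖ * L * ‖d‖ ^ 2 := by ring
    _ = ENNReal.ofReal (‖j‖ * L * ‖d‖ ^ 2) := by
        rw [setLIntegral_const, Real.volume_Ioc, sub_zero, ENNReal.ofReal_one, mul_one]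

theorem integrable_superposition_mul (hN : ∀ v, N v =ᵐ[μ] fun x => f (j v x)) (v d : V) :
    Integrable (fun x => f (j v x) * j d x) μ :=
  ((Lp.memLp (N v)).integrable_mul (Lp.memLp (j d))).congr ((hN v).mono fun x hx => by
    rw [Pi.mul_apply, hx])

theorem inner_superposition (hN : ∀ v, N v =ᵐ[μ] fun x => f (j v x)) (v d : V) :
    ⟪N v, j d⟫_ℝ = ∫ x, f (j v x) * j d x ∂μ := by
  rw [L2.inner_def]
  refine integral_congr_ae ((hN v).mono fun x hx => ?_)
  simp only [hx, RCLike.inner_apply, conj_trivial, mul_comm]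

theorem integrable_primitive_comp [SFinite μ] (hf : Continuous f)
    (hN : ∀ v, N v =ᵐ[μ] fun x => f (j v x)) (hlip : LipschitzOnBalls N) (v : V) :
    Integrable (fun x => primitive f (j v x)) μ := by
  obtain ⟨L, hL⟩ := hlip (‖(0 : V)‖ + ‖v‖)
  have hcont : Continuous (primitive f) :=
    intervalIntegral.continuous_primitive (fun _ _ => hf.intervalIntegrable _ _) 0
  have hmeas (v : V) : AEStronglyMeasurable (fun x => primitive f (j v x)) μ :=
    hcont.comp_aestronglyMeasurable (Lp.aestronglyMeasurable _)
  have hlin := integrable_superposition_mul hN 0 v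
  have hrem : Integrable (fun x => primitive f (j (0 + v) x) - primitive f (j 0 x) -
      f (j 0 x) * j v x) μ :=
    ⟨((hmeas _).sub (hmeas _)).sub hlin.aestronglyMeasurable,
      (lintegral_primitive_remainder_le_of_lipschitzOnWith hf hN hL le_rfl).trans_lt
        ENNReal.ofReal_lt_top⟩
  refine (hrem.add hlin).congr ?_
  filter_upwards [Lp.coeFn_zero ℝ 2 μ] with x hx
  have hzero : primitive f 0 = 0 := intervalIntegral.integral_same
  rw [Pi.add_apply, sub_add_cancel, zero_add, map_zero, hx, Pi.zero_apply, hzero, sub_zero]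

theorem hasFDerivAt_potential [SFinite μ] (hf : Continuous f)
    (hN : ∀ v, N v =ᵐ[μ] fun x => f (j v x)) (hlip : LipschitzOnBalls N) (v : V) :
    HasFDerivAt (potential j f) ((innerSL ℝ (N v)).comp j) v := by
  obtain ⟨L, hL⟩ := hlip (‖v‖ + 1)
  have hint := integrable_primitive_comp hf hN hlip
  refine HasFDerivAt.of_isLittleO (Asymptotics.IsBigO.trans_isLittleO
    (Asymptotics.IsBigO.of_bound (‖j‖ * L) ?_) (Asymptotics.isLittleO_pow_sub_sub v one_lt_two))
  filter_upwards [Metric.ball_mem_nhds v one_pos] with w hw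
  rw [Metric.mem_ball, dist_eq_norm] at hw
  have hrem := lintegral_primitive_remainder_le_of_lipschitzOnWith hf hN hL (v := v) (d := w - v)
    (by linarith)
  rw [add_sub_cancel] at hrem
  have hsplit : potential j f w - potential j f v - ⟪N v, j (w - v)⟫_ℝ =
      ∫ x, (primitive f (j w x) - primitive f (j v x) - f (j v x) * j (w - v) x) ∂μ := by
    rw [inner_superposition hN, potential, potential, ← integral_sub (hint w) (hint v),
      ← integral_sub (by exact (hint w).sub (hint v)) (integrable_superposition_mul hN _ _)]
  have hle := (enorm_integral_le_lintegral_enorm _).trans hrem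
  rw [← hsplit, ← ofReal_norm, ENNReal.ofReal_le_ofReal_iff (by positivity)] at hle
  simpa only [norm_pow, norm_norm, ContinuousLinearMap.comp_apply, innerSL_apply_apply] using hle

end Superposition

theorem superpose_ae_eq {f : ℝ → ℝ} {u : L2Omega}
    (h : MemLp (fun x => f (u x)) 2 (volume.restrict Omega)) :
    superpose f u =ᵐ[volume.restrict Omega] fun x => f (u x) := by
  rw [superpose, dif_pos h]
  exact h.coeFn_toLp

theorem GrowthCondition.exists_neg_le_mul {f : ℝ → ℝ} (hf : GrowthCondition f) :
    ∃ c, ∀ s, -c ≤ f s * s := by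
  obtain ⟨p, -, c₁, c₂, _, _, hc₁, -, -, -, h⟩ := hf
  refine ⟨c₂, fun s => ?_⟩
  have hpow : 0 ≤ c₁ * |s| ^ p := by positivity
  linarith [(h s).1]

namespace H0Space

variable {α : ℝ} {f : ℝ → ℝ}

theorem eH0Norm_incl_le_iff {v : H0Space α} {M : ℝ≥0} : eH0Norm α (incl α v) ≤ M ↔ ‖v‖ ≤ M := by
  rw [eH0Norm_incl, enorm_eq_nnnorm, ENNReal.coe_le_coe, ← NNReal.coe_le_coe, coe_nnnorm]

theorem exists_incl_eq_of_eH0Norm_le {u : L2Omega} {M : ℝ≥0} (hu : eH0Norm α u ≤ M) :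
    ∃ v : H0Space α, incl α v = u ∧ ‖v‖ ≤ M := by
  obtain ⟨v, rfl⟩ := memH0_iff.1 (hu.trans_lt ENNReal.coe_lt_top)
  exact ⟨v, rfl, eH0Norm_incl_le_iff.1 hu⟩

theorem exists_incl_eq_one (hα₀ : 0 < α) (hα₂ : α < 2) :
    ∃ v : H0Space α, ∀ᵐ x ∂(volume.restrict Omega).restrict (Ioo (-1) 1), incl α v x = 1 := by
  set η : ContDiffBump (0 : ℝ) := ⟨1, 2, one_pos, one_lt_two⟩
  have hη : IsTestFunction η := by
    refine ⟨η.contDiff, η.hasCompactSupport, ?_⟩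
    rw [η.tsupport_eq, Real.closedBall_eq_Icc, zero_sub, zero_add]
    have hπ : (2 : ℝ) < Real.pi := by linarith [Real.pi_gt_three]
    exact Icc_subset_Ioo (neg_lt_neg hπ) hπ
  obtain ⟨v, hv⟩ := exists_zeroExt_incl_ae_eq_of_isTestFunction hα₀ hα₂ hη
  refine ⟨v, ?_⟩
  filter_upwards [ae_restrict_of_ae (ae_restrict_of_ae hv),
    ae_restrict_of_ae (ae_restrict_mem measurableSet_Omega), ae_restrict_mem measurableSet_Ioo]
    with x hx hxΩ hx₁
  rw [← indicator_of_mem hxΩ (incl α v), ← zeroExt, hx, η.one_of_mem_closedBall]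
  rw [Real.closedBall_eq_Icc, zero_sub, zero_add]
  exact Ioo_subset_Icc_self hx₁

variable (hf : LipschitzOnBoundedSets α f)

include hf

theorem superpose_incl_ae_eq (v : H0Space α) :
    superpose f (incl α v) =ᵐ[volume.restrict Omega] fun x => f (incl α v x) :=
  superpose_ae_eq (hf.1 _ (memH0_iff.2 ⟨v, rfl⟩))

theorem lipschitzOnBalls_superpose_incl :
    LipschitzOnBalls fun v : H0Space α => superpose f (incl α v) := by
  intro R
  obtain ⟨L, hL⟩ := hf.2 R.toNNReal
  refine ⟨L, fun v hv w hw => ?_⟩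
  have hball {v : H0Space α} (hv : v ∈ Metric.closedBall 0 R) :
      eH0Norm α (incl α v) ≤ R.toNNReal :=
    eH0Norm_incl_le_iff.2 ((mem_closedBall_zero_iff.1 hv).trans (Real.le_coe_toNNReal R))
  have hle := hL _ _ (hball hv) (hball hw)
  rwa [← map_sub, eH0Norm_incl, ← edist_eq_enorm_sub, ← edist_eq_enorm_sub] at hle

theorem lipschitzOnBalls_superpose_sub (g : L2Omega) :
    LipschitzOnBalls fun v : H0Space α => superpose f (incl α v) - g := by
  intro R
  obtain ⟨L, hL⟩ := lipschitzOnBalls_superpose_incl hf R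
  refine ⟨L, fun v hv w hw => ?_⟩
  rw [edist_sub_right]
  exact hL hv hw

theorem continuous_of_lipschitzOnBoundedSets (hα₀ : 0 < α) (hα₂ : α < 2) : Continuous f := by
  obtain ⟨v, hv⟩ := exists_incl_eq_one hα₀ hα₂
  refine continuous_of_continuous_superposition (superpose_incl_ae_eq hf)
    (lipschitzOnBalls_superpose_incl hf).continuous (s := Ioo (-1) 1) ?_ hv
  have hsub : Ioo (-1) 1 ⊆ Omega :=
    Ioo_subset_Ioo (by linarith [Real.two_le_pi]) (by linarith [Real.two_le_pi])
  rw [Measure.restrict_apply measurableSet_Ioo, inter_eq_left.2 hsub, Real.volume_Ioo]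
  norm_num

theorem neg_mul_measureReal_le_inner_superpose {c : ℝ} (hc : ∀ s, -c ≤ f s * s) (v : H0Space α) :
    -c * (volume.restrict Omega).real univ ≤ ⟪superpose f (incl α v), incl α v⟫_ℝ := by
  rw [inner_superposition (superpose_incl_ae_eq hf), mul_comm, ← smul_eq_mul, ← integral_const]
  exact integral_mono (integrable_const _)
    (integrable_superposition_mul (superpose_incl_ae_eq hf) v v) fun x => hc _

theorem exists_dissipative (hα : 0 ≤ 1 + α) {γ : ℝ} (hγ : 0 < γ) {c : ℝ}
    (hc : ∀ s, -c ≤ f s * s) (g : L2Omega) :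
    ∃ a > 0, ∃ b, ∀ v : H0Space α, a * ‖v‖ ^ 2 - b ≤
      dirichletForm (incl α) γ v v + ⟪superpose f (incl α v) - g, incl α v⟫_ℝ := by
  set C := (3 * Real.pi) ^ (1 + α) / Real.pi + 1
  have hC : 0 < C := by positivity
  set a := γ / (2 * C)
  have ha : 0 < a := by positivity
  refine ⟨a, ha, c * (volume.restrict Omega).real univ + ‖g‖ ^ 2 / (4 * a), fun v => ?_⟩
  have hform : 2 * a * ‖v‖ ^ 2 ≤ dirichletForm (incl α) γ v v := by
    rw [dirichletForm_incl, real_inner_self_eq_norm_sq]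
    calc 2 * a * ‖v‖ ^ 2 ≤ 2 * a * (C * ‖diff α v‖ ^ 2) := by
          gcongr
          exact norm_sq_le_mul_norm_diff_sq hα v
      _ = γ * ‖diff α v‖ ^ 2 := by
          simp only [a]
          field_simp
  have hg : ⟪g, incl α v⟫_ℝ ≤ a * ‖v‖ ^ 2 + ‖g‖ ^ 2 / (4 * a) :=
    calc ⟪g, incl α v⟫_ℝ ≤ ‖g‖ * ‖v‖ :=
          (real_inner_le_norm _ _).trans (by gcongr; exact norm_incl_le v)
      _ ≤ a * ‖v‖ ^ 2 + ‖g‖ ^ 2 / (4 * a) := by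
          have hsq : 0 ≤ (2 * a * ‖v‖ - ‖g‖) ^ 2 / (4 * a) := by positivity
          have hexp : (2 * a * ‖v‖ - ‖g‖) ^ 2 / (4 * a) =
              a * ‖v‖ ^ 2 + ‖g‖ ^ 2 / (4 * a) - ‖g‖ * ‖v‖ := by
            field_simp
            ring
          linarith
  have hf' := neg_mul_measureReal_le_inner_superpose hf hc v
  rw [inner_sub_left]
  linarith

theorem dissipativeGradient_superpose_sub (hα₀ : 0 < α) (hα₂ : α < 2) {γ : ℝ} (hγ : 0 < γ) {c : ℝ}
    (hc : ∀ s, -c ≤ f s * s) (g : L2Omega) :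
    DissipativeGradient (incl α) γ (fun v => superpose f (incl α v) - g)
      (fun v => potential (incl α) f v - ⟪g, incl α v⟫_ℝ) where
  lipschitzOnBalls := lipschitzOnBalls_superpose_sub hf g
  hasFDerivAt v := by
    have hpot := hasFDerivAt_potential (continuous_of_lipschitzOnBoundedSets hf hα₀ hα₂)
      (superpose_incl_ae_eq hf) (lipschitzOnBalls_superpose_incl hf) v
    rw [map_sub, ContinuousLinearMap.sub_comp]
    exact hpot.sub ((innerSL ℝ g).comp (incl α)).hasFDerivAt
  dissipative := exists_dissipative hf (by linarith) hγ hc g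

end H0Space

/-! ### Solutions -/

namespace IsSolutionOn

variable {α : ℝ} {f : ℝ → ℝ} {g u₀ : L2Omega} {I : Set ℝ} {u : ℝ → L2Omega}

theorem mono {I' : Set ℝ} (h : IsSolutionOn α f g u₀ I u) (hI : I' ⊆ I) :
    IsSolutionOn α f g u₀ I' u where
  mem t ht := h.mem t (hI ht)
  continuousOn t ht := (h.continuousOn t (hI ht)).mono_left (nhdsWithin_mono t hI)
  duhamel := by
    obtain ⟨S, hS, hd⟩ := h.duhamel
    exact ⟨S, hS, fun t ht => hd t (hI ht)⟩

theorem exists_continuous_lift (h : IsSolutionOn α f g u₀ I u) {r : ℝ → ℝ} (hr : Continuous r)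
    (hrI : ∀ t, r t ∈ I) (hr_eq : ∀ t ∈ I, r t = t) :
    ∃ v : ℝ → H0Space α, Continuous v ∧ ∀ t ∈ I, H0Space.incl α (v t) = u t := by
  choose v hv using fun t => H0Space.memH0_iff.1 (h.mem (r t) (hrI t))
  refine ⟨v, ?_, fun t ht => by rw [hv, hr_eq t ht]⟩
  refine continuous_iff_continuousAt.2 fun t => tendsto_iff_edist_tendsto_0.2 ?_
  simp only [edist_eq_enorm_sub, ← H0Space.eH0Norm_incl, map_sub, hv]
  exact (h.continuousOn (r t) (hrI t)).comp
    (tendsto_nhdsWithin_iff.2 ⟨hr.tendsto t, Eventually.of_forall hrI⟩)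

end IsSolutionOn

namespace H0Space

variable {α : ℝ} (hα₀ : 0 < α) (hα₂ : α < 2) {f : ℝ → ℝ} (hf : LipschitzOnBoundedSets α f)
  {g : L2Omega} {ι : Type} {Φ : DiagonalForm ι (incl α) (fracLapConst α / 2)} {v₀ : H0Space α}
  {v : ℝ → H0Space α}

include hα₀ hα₂ hf

theorem isSolutionOn_of_isMild
    (h : ∀ T, Φ.IsMild (fun v => superpose f (incl α v) - g) v₀ T v) :
    IsSolutionOn α f g (incl α v₀) (Ici 0) fun t => incl α (v t) where
  mem t _ := memH0_iff.2 ⟨v t, rfl⟩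
  continuousOn t _ := by
    simp only [← map_sub, eH0Norm_incl, ← edist_eq_enorm_sub]
    exact (tendsto_iff_edist_tendsto_0.1 ((h 0).continuous.tendsto t)).mono_left nhdsWithin_le_nhds
  duhamel := by
    refine ⟨Φ.heat, isFracHeatSemigroup_heat hα₀ hα₂ Φ, fun t ht => ?_⟩
    have hcont := (lipschitzOnBalls_superpose_sub hf g).continuous.comp (h t).continuous
    exact (Φ.forall_inner_eq_coeff_iff ht hcont.continuousOn).1
      ((h t).inner_eq t (right_mem_Icc.2 ht))

theorem isMild_of_isSolutionOn {T : ℝ} {u : ℝ → L2Omega}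
    (h : IsSolutionOn α f g (incl α v₀) (Icc 0 T) u) (hv : Continuous v)
    (hvu : ∀ t ∈ Icc 0 T, incl α (v t) = u t) :
    Φ.IsMild (fun v => superpose f (incl α v) - g) v₀ T v where
  continuous := hv
  inner_eq t ht := by
    have hcont : Continuous fun s => superpose f (incl α (v s)) - g :=
      (lipschitzOnBalls_superpose_sub hf g).continuous.comp hv
    refine (Φ.forall_inner_eq_coeff_iff ht.1 hcont.continuousOn).2 ?_
    obtain ⟨S, hS, hd⟩ := h.duhamel
    rw [hvu t ht, hd t ht, eq_heat_of_isFracHeatSemigroup hα₀ hα₂ Φ hS ht.1]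
    congr 1
    refine intervalIntegral.integral_congr fun s hs => ?_
    rw [uIcc_of_le ht.1] at hs
    simp only [← hvu s ⟨hs.1, hs.2.trans ht.2⟩,
      eq_heat_of_isFracHeatSemigroup hα₀ hα₂ Φ hS (sub_nonneg.2 hs.2)]

theorem eqOn_of_isMild_of_isSolutionOn {T : ℝ} (hT : 0 ≤ T)
    (hv : Φ.IsMild (fun v => superpose f (incl α v) - g) v₀ T v) {u : ℝ → L2Omega}
    (hu : IsSolutionOn α f g (incl α v₀) (Icc 0 T) u) :
    EqOn u (fun t => incl α (v t)) (Icc 0 T) := by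
  obtain ⟨w, hw, hwu⟩ := hu.exists_continuous_lift (r := fun t => max 0 (min T t)) (by fun_prop)
    (fun t => ⟨le_max_left _ _, max_le hT (min_le_left _ _)⟩)
    (fun t ht => by rw [min_eq_right ht.2, max_eq_right ht.1])
  intro t ht
  rw [← hwu t ht, (isMild_of_isSolutionOn hα₀ hα₂ hf hu hw hwu).eqOn
    (lipschitzOnBalls_superpose_sub hf g) hv ht]

variable (Φ) in
theorem exists_isMild_of_isSolutionOn_Ici {u : ℝ → L2Omega}
    (hu : IsSolutionOn α f g (incl α v₀) (Ici 0) u) :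
    ∃ v, (∀ T, Φ.IsMild (fun v => superpose f (incl α v) - g) v₀ T v) ∧
      ∀ t, 0 ≤ t → incl α (v t) = u t := by
  obtain ⟨v, hv, hvu⟩ := hu.exists_continuous_lift (r := max 0) (by fun_prop)
    (fun t => mem_Ici.2 (le_max_left _ _)) (fun t ht => max_eq_right ht)
  exact ⟨v, fun T => isMild_of_isSolutionOn hα₀ hα₂ hf (hu.mono Icc_subset_Ici_self) hv
    fun t ht => hvu t ht.1, hvu⟩

end H0Space

end

theorem theorem4p3_general (α : ℝ) (hα₀ : 0 < α) (hα₂ : α < 2) (f : ℝ → ℝ)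
    (hf : LipschitzOnBoundedSets α f) (hbelow : ∃ c, ∀ s, -c ≤ f s * s) (g : L2Omega) :
    (∀ u₀ : L2Omega, MemH0 α u₀ → ∃ u : ℝ → L2Omega,
      IsSolutionOn α f g u₀ (Ici 0) u ∧
      ∀ T : ℝ, 0 < T → ∀ v : ℝ → L2Omega, IsSolutionOn α f g u₀ (Icc 0 T) v →
        ∀ t ∈ Icc 0 T, v t = u t) ∧
    (∀ M : ℝ≥0, ∃ K : ℝ≥0, ∀ (u₀ : L2Omega) (u : ℝ → L2Omega), eH0Norm α u₀ ≤ M →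
      IsSolutionOn α f g u₀ (Ici 0) u → ∀ t : ℝ, 0 ≤ t → eH0Norm α (u t) ≤ K) ∧
    (∃ R : ℝ≥0, ∀ M : ℝ≥0, ∃ t₀ : ℝ, 0 ≤ t₀ ∧ ∀ (u₀ : L2Omega) (u : ℝ → L2Omega),
      eH0Norm α u₀ ≤ M → IsSolutionOn α f g u₀ (Ici 0) u →
        ∀ t : ℝ, t₀ ≤ t → eH0Norm α (u t) ≤ R) := by
  obtain ⟨ι, ⟨Φ⟩⟩ := H0Space.exists_diagonalForm_incl hα₀ hα₂
  obtain ⟨c, hc⟩ := hbelow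
  have hN := H0Space.dissipativeGradient_superpose_sub hf hα₀ hα₂
    (half_pos (fracLapConst_pos hα₀ hα₂)) hc g
  refine ⟨fun u₀ hu₀ => ?_, fun M => ?_, ?_⟩
  · obtain ⟨v₀, rfl⟩ := H0Space.memH0_iff.1 hu₀
    obtain ⟨v, hv⟩ := hN.exists_isMild Φ v₀
    exact ⟨_, H0Space.isSolutionOn_of_isMild hα₀ hα₂ hf hv, fun T hT w hw =>
      H0Space.eqOn_of_isMild_of_isSolutionOn hα₀ hα₂ hf hT.le (hv T) hw⟩
  · obtain ⟨K, hK⟩ := hN.exists_norm_le Φ M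
    refine ⟨K.toNNReal, fun u₀ u hu₀ hu t ht => ?_⟩
    obtain ⟨v₀, rfl, hv₀⟩ := H0Space.exists_incl_eq_of_eH0Norm_le hu₀
    obtain ⟨v, hv, hvu⟩ := H0Space.exists_isMild_of_isSolutionOn_Ici hα₀ hα₂ hf Φ hu
    rw [← hvu t ht, H0Space.eH0Norm_incl_le_iff]
    exact (hK v₀ v hv₀ hv t ht).trans (Real.le_coe_toNNReal K)
  · obtain ⟨R, hR⟩ := hN.exists_absorbing Φ
    refine ⟨R.toNNReal, fun M => ?_⟩
    obtain ⟨t₀, ht₀, hRM⟩ := hR M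
    refine ⟨t₀, ht₀, fun u₀ u hu₀ hu t ht => ?_⟩
    obtain ⟨v₀, rfl, hv₀⟩ := H0Space.exists_incl_eq_of_eH0Norm_le hu₀
    obtain ⟨v, hv, hvu⟩ := H0Space.exists_isMild_of_isSolutionOn_Ici hα₀ hα₂ hf Φ hu
    rw [← hvu t (ht₀.trans ht), H0Space.eH0Norm_incl_le_iff]
    exact (hRM v₀ v hv₀ hv t ht).trans (Real.le_coe_toNNReal R)

theorem theorem4p3 (α : ℝ) (hα₀ : 0 < α) (hα₂ : α < 2) (f : ℝ → ℝ)
    (hf : LipschitzOnBoundedSets α f) (hgrowth : GrowthCondition f) (g : L2Omega) :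
    -- global existence, and uniqueness on every time interval
    (∀ u₀ : L2Omega, MemH0 α u₀ → ∃ u : ℝ → L2Omega,
      IsSolutionOn α f g u₀ (Ici 0) u ∧
      ∀ T : ℝ, 0 < T → ∀ v : ℝ → L2Omega, IsSolutionOn α f g u₀ (Icc 0 T) v →
        ∀ t ∈ Icc 0 T, v t = u t) ∧
    -- bounds uniform in time
    (∀ M : ℝ≥0, ∃ K : ℝ≥0, ∀ (u₀ : L2Omega) (u : ℝ → L2Omega), eH0Norm α u₀ ≤ M →
      IsSolutionOn α f g u₀ (Ici 0) u → ∀ t : ℝ, 0 ≤ t → eH0Norm α (u t) ≤ K) ∧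
    -- a bounded absorbing set
    (∃ R : ℝ≥0, ∀ M : ℝ≥0, ∃ t₀ : ℝ, 0 ≤ t₀ ∧ ∀ (u₀ : L2Omega) (u : ℝ → L2Omega),
      eH0Norm α u₀ ≤ M → IsSolutionOn α f g u₀ (Ici 0) u →
        ∀ t : ℝ, t₀ ≤ t → eH0Norm α (u t) ≤ R) :=
  theorem4p3_general α hα₀ hα₂ f hf hgrowth.exists_neg_le_mul g
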